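/- Let $q\in\mathbb R$, $q\neq 0,-1$, and $c\in\mathbb C\setminus\{0\}$. Indices are pairs $A=(\alpha,\alpha')\in\{1,2\}^2$; repeated indices are summed; a 4-vector is written as a $2\times2$ matrix $x=(x^{\alpha\alpha'})$. Put $\epsilon=(\epsilon_{\alpha\beta})=\begin{pmatrix}0&1\\-q&0\end{pmatrix}$, $(\epsilon^{\alpha\beta})=\epsilon^{-1}$, $\hat R^{\alpha\beta}_{\gamma\delta}=q\,\delta^\alpha_\gamma\delta^\beta_\delta+\epsilon^{\alpha\beta}\epsilon_{\gamma\delta}=q\mathcal P_s-q^{-1}\mathcal P_a$ with $\mathcal P_a{}^{\alpha\beta}_{\gamma\delta}=-\epsilon^{\alpha\beta}\epsilon_{\gamma\delta}/(q+q^{-1})$, $\mathcal P_s=1-\mathcal P_a$; $\mathcal R=\hat R\otimes\hat R$ (this is $q$ times the braid matrix of $SO_q(4)$), $\mathsf P_a=\mathcal P_s\otimes\mathcal P_a$, $\mathsf P_{a'}=\mathcal P_a\otimes\mathcal P_s$, $\mathsf P_A=\mathsf P_a+\mathsf P_{a'}$. For a matrix $z$ put $|z|^2=z^{11}z^{22}-q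 z^{12}z^{21}$ and $\bar z=\epsilon^{-1}z^T\epsilon$. For $n\ge0$ let $\mathcal F_n$ be the algebra generated by the coordinates $x=y_0,y_1,\dots,y_n$ and the parameters $\rho_1^2,\dots,\rho_n^2$ with the relations $$\mathsf P_A\,y_\mu y_\mu=0,\qquad y_\mu^Ay_\nu^B=\mathcal R^{AB}_{CD}\,y_\nu^Cy_\mu^D\ (\nu<\mu),\qquad \rho_\nu^2\rho_\mu^2=q^2\rho_\mu^2\rho_\nu^2\ (\nu<\mu),$$ $$\rho_\nu^2y_\mu^A=q^{-2}y_\mu^A\rho_\nu^2\ (\nu<\mu),\qquad \rho_\nu^2y_\mu^A=y_\mu^A\rho_\nu^2\ (\nu\ge\mu),$$ enlarged by $|z_\mu|^{-1}$, $|y_\mu|^{-1}$ ($1\le\mu\le n$), where $z_\mu=x-y_1-\dots-y_\mu$, and by the inverses of $\phi_b=1+b\sum_{\mu=1}^n\rho_\mu^2|z_\mu|^{-2}$ ($b\in\mathbb C$); here, as usual, an element that commutes with $|z_\mu|^2$ (or $|y_\mu|^2$) up to the factor $q^{2k}$, $k\in\mathbb Z$, commutes with $|z_\mu|$ (or $|y_\mu|$)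 up to the factor $q^k$. The differential calculus on $\mathcal F_n$ is generated by $\xi^A=dx^A$, with $dy_\mu=0$ ($\mu\ge1$), $d\rho_\mu^2=0$, the Leibniz rule, and $$y_\mu^A\xi^B=\mathcal R^{AB}_{CD}\,\xi^Cy_\mu^D\ (\mu\ge0),\quad \rho_\mu^2\xi^A=\xi^A\rho_\mu^2,\quad |z_\mu|\,\xi^A=q\,\xi^A|z_\mu|,\quad |y_\mu|\,\xi^A=q\,\xi^A|y_\mu|,\quad \xi^A\xi^B=(\mathsf P_A)^{AB}_{CD}\,\xi^C\xi^D .$$ The $\xi^A$ are a basis of the right module of 1-forms, $df=\xi^A\partial_Af$ defines $\partial_A$, and the Hodge map on 2-forms is ${}^*(\xi^A\xi^B)=(\mathsf P_a-\mathsf P_{a'})^{AB}_{CD}\,\xi^C\xi^D$, extended right $\mathcal F_n$-linearly. Put $\partial^{\alpha\alpha'}=\epsilon^{\alpha\beta}\epsilon^{\alpha'\beta'}\partial_{\beta\beta'}$, $\Box=\epsilon^{\alpha\beta}\epsilon^{\alpha'\beta'}\partial_{\beta\beta'}\partial_{\alpha\alpha'}$ and $\hat{\mathcal D}=q\,\bar\xi\,\partial-\frac{q^{-1}}{q+1}I_2\,d$,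 where $\partial=(\partial^{\alpha\alpha'})$. The field strength of a $2\times2$ matrix $A$ of 1-forms is $F=dA+AA$. (i) For every $n\geq 0$ the function $$\phi=\phi_c=1+c\sum_{\mu=1}^n\rho_\mu^2\,\frac1{|x-y_1-\dots-y_\mu|^{2}}$$ is invertible and harmonic, $\Box\phi=0$, and $\hat A=\phi^{-1}\hat{\mathcal D}\phi$ solves the self-duality equation ${}^*F=F$. (The constant $c$ covers all normalizations of the square; $c=1/(1+q^2)$ corresponds to $z\cdot z=\epsilon_{\alpha\beta}\epsilon_{\alpha'\beta'}z^{\alpha\alpha'}z^{\beta\beta'}=(1+q^2)|z|^2$.) (ii) For $n=2$ the matrix $U_2=\frac{\bar z_1}{|z_1|}\frac{y_2}{|y_2|}\frac{\bar z_2}{|z_2|}$ is invertible, and $A_2=U_2^{-1}(\hat AU_2+dU_2)$ again solves ${}^*F=F$ and is regular in $z_1$ and $z_2$: if $A_2=\xi^A a_A$, the entries of the matrices $a_A$ belong to the subalgebra of $\mathcal F_2$ generated by the coordinates $x,y_1,y_2$, the parameters $\rho_1^2,\rho_2^2$, $|y_2|^{-1}$ and the inverses of the polynomials $$|z_2|^2|z_1|^2+b\,\big(|z_2|^2\rho_1^2+\rho_2^2|z_1|^2\big)=\phi_b\,|z_2|^2|z_1|^2,\qquad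 b=q^{2k}c,\ k\in\mathbb Z,$$ so that no negative powers of $|z_1|$ or $|z_2|$ occur in $A_2$. -/

import Mathlib

noncomputable section

namespace QInst

/-! ### Constant tensors

Vector indices are pairs `A = (α, α')` of spinor indices; the `4`-vector `x` is the `2 × 2` matrix
of entries `x^{αα'}`. -/

/-- Pairs of spinor indices, i.e. indices of the coordinates `x^{αα'}`. -/
abbrev Ix : Type := Fin 2 × Fin 2

/-- `ε_{αβ}`. -/
def epsLow (q : ℂ) : Matrix (Fin 2) (Fin 2) ℂ := !![0, 1; -q, 0]

/-- `ε^{αβ}`, the inverse matrix of `ε_{αβ}`. -/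
def epsUp (q : ℂ) : Matrix (Fin 2) (Fin 2) ℂ := !![0, -q⁻¹; 1, 0]

/-- The braid matrix `R̂^{αβ}_{γδ}` of `GL_q(2)`. -/
def braid2 (q : ℂ) (a b c d : Fin 2) : ℂ :=
  (if a = c ∧ b = d then q else 0) + epsUp q a b * epsLow q c d

/-- The `q`-antisymmetric projector `𝒫_a` of `GL_q(2)`. -/
def projAnti (q : ℂ) (a b c d : Fin 2) : ℂ :=
  -(epsUp q a b * epsLow q c d) / (q + q⁻¹)

/-- The `q`-symmetric projector `𝒫_s` of `GL_q(2)`. -/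
def projSym (q : ℂ) (a b c d : Fin 2) : ℂ :=
  (if a = c ∧ b = d then 1 else 0) + epsUp q a b * epsLow q c d / (q + q⁻¹)

/-- `R̂ ⊗ R̂ = q 𝖱̂`, where `𝖱̂` is the braid matrix of `SO_q(4)`, in the indices `A = (α, α')`. -/
def braid4 (q : ℂ) (A B C D : Ix) : ℂ :=
  braid2 q A.1 B.1 C.1 D.1 * braid2 q A.2 B.2 C.2 D.2

/-- The projector `𝖯_a = 𝒫_s ⊗ 𝒫_a` (on selfdual 2-forms). -/
def projSD (q : ℂ) (A B C D : Ix) : ℂ :=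
  projSym q A.1 B.1 C.1 D.1 * projAnti q A.2 B.2 C.2 D.2

/-- The projector `𝖯_{a'} = 𝒫_a ⊗ 𝒫_s` (on antiselfdual 2-forms). -/
def projASD (q : ℂ) (A B C D : Ix) : ℂ :=
  projAnti q A.1 B.1 C.1 D.1 * projSym q A.2 B.2 C.2 D.2

/-- The `SO_q(4)`-covariant antisymmetric projector `𝖯_A = 𝖯_a + 𝖯_{a'}`. -/
def projA (q : ℂ) (A B C D : Ix) : ℂ := projSD q A B C D + projASD q A B C D

/-- The `q`-determinant `|z|² = z^{11} z^{22} - q z^{12} z^{21}`. -/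
def qdet {R : Type*} [Ring R] [Algebra ℂ R] (q : ℂ) (z : Matrix (Fin 2) (Fin 2) R) : R :=
  z 0 0 * z 1 1 - q • (z 0 1 * z 1 0)

/-- The conjugate `z̄ = ε⁻¹ zᵀ ε`. -/
def qbar {R : Type*} [Ring R] [Algebra ℂ R] (q : ℂ) (z : Matrix (Fin 2) (Fin 2) R) :
    Matrix (Fin 2) (Fin 2) R :=
  Matrix.of fun i j => ∑ k, ∑ l, (epsUp q i k * epsLow q l j) • z l k

/-! ### The algebra of functions, with parameters

The generators are the coordinates `y_0 = x, y_1, …, y_n`, the parameters `ρ_1², …, ρ_n²`, and the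
inverses that are needed to form the rational functions below. A family indexed by `μ = 1, …, n`
is indexed by `Fin n`, the element `i : Fin n` standing for `μ = i + 1`. -/

/-- The generators. -/
inductive Gen (n : ℕ) : Type
  /-- The coordinates `y_μ^A`, `μ = 0, …, n`; the coordinates of the space are `x^A = y_0^A`. -/
  | y (μ : Fin (n + 1)) (A : Ix)
  /-- `ρ_μ²`. -/
  | rho (μ : Fin n)
  /-- `|z_μ|⁻¹` for `z_μ = x - y_1 - … - y_μ`. -/
  | zinv (μ : Fin n)
  /-- `|y_μ|⁻¹`. -/
  | yinv (μ : Fin n)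
  /-- The inverse of `φ_c = 1 + c ∑_μ ρ_μ² |z_μ|⁻²`. -/
  | pinv (c : ℂ)

/-- The free algebra on the generators. -/
abbrev Free (n : ℕ) : Type := FreeAlgebra ℂ (Gen n)

variable {n : ℕ}

/-- A generator as an element of the free algebra. -/
def gen (g : Gen n) : Free n := FreeAlgebra.ι ℂ g

/-- The matrix of the coordinates `y_μ^{αα'}`. -/
def yFree (μ : Fin (n + 1)) : Matrix (Fin 2) (Fin 2) (Free n) :=
  Matrix.of fun i j => gen (Gen.y μ (i, j))

/-- `z_μ = x - y_1 - … - y_μ`. -/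
def zFree (μ : Fin n) : Matrix (Fin 2) (Fin 2) (Free n) :=
  yFree 0 - ∑ ν ∈ Finset.univ.filter (fun ν : Fin n => ν ≤ μ), yFree ν.succ

/-- `N = ∑_μ ρ_μ² |z_μ|⁻²`. -/
def potFree (n : ℕ) : Free n :=
  ∑ μ : Fin n, gen (Gen.rho μ) * (gen (Gen.zinv μ)) ^ 2

/-- `φ_c = 1 + c ∑_μ ρ_μ² |z_μ|⁻²`. -/
def phiFree (n : ℕ) (c : ℂ) : Free n := 1 + c • potFree n

/-! ### The differential calculus

The `1`-forms are the expressions `∑_A ξ^A c_A` with `c_A` functions and `ξ^A = dx^A`. The calculus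
is given by the maps `λ_A^B` and `∂_A` on functions in
`f ξ^B = ∑_A ξ^A λ_A^B(f)` and `df = ∑_A ξ^A ∂_A f`. Associativity of the product of functions with
forms and the Leibniz rule `d(fg) = (df) g + f dg` say exactly that the block matrix
`J(f) = (λ_A^B(f), ∂_A f; 0, f)` is multiplicative in `f`. So `J` is determined by its values on the
generators, which are
* `y_μ^C ξ^B = ∑ (q 𝖱̂)^{CB}_{AD} ξ^A y_μ^D`, `dx^C = ξ^C` and `dy_μ^C = 0` for `μ ≥ 1`;
* `ρ_μ² ξ^A = ξ^A ρ_μ²`, `dρ_μ² = 0`;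
* `|z_μ|⁻¹ ξ^A = q⁻¹ ξ^A |z_μ|⁻¹`,
  `d|z_μ|⁻¹ = -q⁻¹/(q + 1) ∑_A ξ^A |z_μ|⁻² (∂_A |z_μ|²) |z_μ|⁻¹`;
* `|y_μ|⁻¹ ξ^A = q⁻¹ ξ^A |y_μ|⁻¹`, `d|y_μ|⁻¹ = 0`;
* `φ_c⁻¹ ξ^A = ξ^A φ_{c q⁻²}⁻¹`, `dφ_c⁻¹ = - φ_c⁻¹ (dφ_c) φ_c⁻¹`. -/

/-- The block matrix `(L, D; 0, f)`. -/
def block (L : Ix → Ix → Free n) (D : Ix → Free n) (f : Free n) :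
    Matrix (Option Ix) (Option Ix) (Free n) :=
  Matrix.of fun i j =>
    match i, j with
    | some A, some B => L A B
    | some A, none => D A
    | none, some _ => 0
    | none, none => f

/-- The matrix `λ_A^B = δ_A^B f`. -/
def diagBlock (f : Free n) : Ix → Ix → Free n := fun A B => if A = B then f else 0

/-- `J` on the generators `y_μ^A`, `ρ_μ²`. -/
def jetGen0 (q : ℂ) : Gen n → Matrix (Option Ix) (Option Ix) (Free n)
  | Gen.y μ C =>
      block (fun A B => ∑ D, braid4 q C B A D • gen (Gen.y μ D))
        (fun A => if μ = 0 ∧ A = C then 1 else 0) (gen (Gen.y μ C))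
  | Gen.rho μ => block (diagBlock (gen (Gen.rho μ))) (fun _ => 0) (gen (Gen.rho μ))
  | _ => 0

/-- `J` on polynomials in the `y_μ^A`, `ρ_μ²`. -/
def jet0 (q : ℂ) : Free n →ₐ[ℂ] Matrix (Option Ix) (Option Ix) (Free n) :=
  FreeAlgebra.lift ℂ (jetGen0 q)

/-- `J` on the generators `y_μ^A`, `ρ_μ²`, `|z_μ|⁻¹`, `|y_μ|⁻¹`. -/
def jetGen1 (q : ℂ) : Gen n → Matrix (Option Ix) (Option Ix) (Free n)
  | Gen.zinv μ =>
      block (diagBlock (q⁻¹ • gen (Gen.zinv μ)))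
        (fun A => (-(q⁻¹ / (q + 1))) •
          ((gen (Gen.zinv μ)) ^ 2 * jet0 q (qdet q (zFree μ)) (some A) none * gen (Gen.zinv μ)))
        (gen (Gen.zinv μ))
  | Gen.yinv μ => block (diagBlock (q⁻¹ • gen (Gen.yinv μ))) (fun _ => 0) (gen (Gen.yinv μ))
  | g => jetGen0 q g

/-- `J` on polynomials in the `y_μ^A`, `ρ_μ²`, `|z_μ|⁻¹`, `|y_μ|⁻¹`. -/
def jet1 (q : ℂ) : Free n →ₐ[ℂ] Matrix (Option Ix) (Option Ix) (Free n) :=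
  FreeAlgebra.lift ℂ (jetGen1 q)

/-- `J` on all generators. -/
def jetGen (q : ℂ) : Gen n → Matrix (Option Ix) (Option Ix) (Free n)
  | Gen.pinv c =>
      block (diagBlock (gen (Gen.pinv (c * q⁻¹ ^ 2))))
        (fun A => -(gen (Gen.pinv (c * q⁻¹ ^ 2)) * jet1 q (phiFree n c) (some A) none *
          gen (Gen.pinv c)))
        (gen (Gen.pinv c))
  | g => jetGen1 q g

/-- The homomorphism `J`. -/
def jet (q : ℂ) : Free n →ₐ[ℂ] Matrix (Option Ix) (Option Ix) (Free n) :=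
  FreeAlgebra.lift ℂ (jetGen q)

/-- The relations of the algebra of functions. Besides the congruence axioms they are the relations
between the coordinates and the parameters, the defining relations of the inverses, and, for
`s = |z_μ|⁻¹` and `s = |y_μ|⁻¹`, the usual rule for the commutation relations of a square root:
what commutes with `s⁻²` up to the factor `q^{2k}` commutes with `s⁻¹` up to the factor `q^k`.
The constructor `calc` is the compatibility of the relations with the calculus; the relations
listed before it are covariant, so it only serves to let `λ_A^B` and `∂_A` descend to the
quotient. -/
inductive Rel (q : ℂ) (n : ℕ) : Free n → Free n → Prop
  | refl (a : Free n) : Rel q n a a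
  | symm {a b : Free n} : Rel q n a b → Rel q n b a
  | trans {a b c : Free n} : Rel q n a b → Rel q n b c → Rel q n a c
  | add {a b c d : Free n} : Rel q n a b → Rel q n c d → Rel q n (a + c) (b + d)
  | mul {a b c d : Free n} : Rel q n a b → Rel q n c d → Rel q n (a * c) (b * d)
  /-- `𝖯_A y_μ y_μ = 0`. -/
  | coord (μ : Fin (n + 1)) (A B : Ix) :
      Rel q n (∑ C, ∑ D, projA q A B C D • (gen (Gen.y μ C) * gen (Gen.y μ D))) 0
  /-- `y_μ^A y_ν^B = (q 𝖱̂)^{AB}_{CD} y_ν^C y_μ^D` for `ν < μ`. -/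
  | braided (μ ν : Fin (n + 1)) (A B : Ix) : ν < μ →
      Rel q n (gen (Gen.y μ A) * gen (Gen.y ν B))
        (∑ C, ∑ D, braid4 q A B C D • (gen (Gen.y ν C) * gen (Gen.y μ D)))
  /-- `ρ_ν² ρ_μ² = q² ρ_μ² ρ_ν²` for `ν < μ`. -/
  | rho_rho (μ ν : Fin n) : ν < μ →
      Rel q n (gen (Gen.rho ν) * gen (Gen.rho μ)) (q ^ 2 • (gen (Gen.rho μ) * gen (Gen.rho ν)))
  /-- `ρ_ν² y_μ^A = q⁻² y_μ^A ρ_ν²` for `ν < μ`. -/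
  | rho_y (ν : Fin n) (μ : Fin (n + 1)) (A : Ix) : ν.succ < μ →
      Rel q n (gen (Gen.rho ν) * gen (Gen.y μ A))
        (q⁻¹ ^ 2 • (gen (Gen.y μ A) * gen (Gen.rho ν)))
  /-- `ρ_ν² y_μ^A = y_μ^A ρ_ν²` for `ν ≥ μ`. -/
  | rho_y' (ν : Fin n) (μ : Fin (n + 1)) (A : Ix) : μ ≤ ν.succ →
      Rel q n (gen (Gen.rho ν) * gen (Gen.y μ A)) (gen (Gen.y μ A) * gen (Gen.rho ν))
  | zinv_left (μ : Fin n) : Rel q n ((gen (Gen.zinv μ)) ^ 2 * qdet q (zFree μ)) 1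
  | zinv_right (μ : Fin n) : Rel q n (qdet q (zFree μ) * (gen (Gen.zinv μ)) ^ 2) 1
  | yinv_left (μ : Fin n) : Rel q n ((gen (Gen.yinv μ)) ^ 2 * qdet q (yFree μ.succ)) 1
  | yinv_right (μ : Fin n) : Rel q n (qdet q (yFree μ.succ) * (gen (Gen.yinv μ)) ^ 2) 1
  | pinv_left (c : ℂ) : Rel q n (gen (Gen.pinv c) * phiFree n c) 1
  | pinv_right (c : ℂ) : Rel q n (phiFree n c * gen (Gen.pinv c)) 1
  | zroot (μ : Fin n) (a : Free n) (k : ℤ) :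
      Rel q n (qdet q (zFree μ) * a) (q ^ (2 * k) • (a * qdet q (zFree μ))) →
      Rel q n (gen (Gen.zinv μ) * a) (q ^ (-k) • (a * gen (Gen.zinv μ)))
  | yroot (μ : Fin n) (a : Free n) (k : ℤ) :
      Rel q n (qdet q (yFree μ.succ) * a) (q ^ (2 * k) • (a * qdet q (yFree μ.succ))) →
      Rel q n (gen (Gen.yinv μ) * a) (q ^ (-k) • (a * gen (Gen.yinv μ)))
  | calc {a b : Free n} (i j : Option Ix) : Rel q n a b → Rel q n (jet q a i j) (jet q b i j)

/-- The congruence generated by the relations. -/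
def relCon (q : ℂ) (n : ℕ) : RingCon (Free n) where
  r := Rel q n
  iseqv := ⟨Rel.refl, Rel.symm, Rel.trans⟩
  add' := Rel.add
  mul' := Rel.mul

/-- The algebra of functions. -/
abbrev Fn (q : ℂ) (n : ℕ) : Type := (relCon q n).Quotient

/-- The class of an element of the free algebra. -/
def cls (q : ℂ) (a : Free n) : Fn q n := (relCon q n).mk' a

variable {q : ℂ}

/-- The map `λ_A^B` in `f ξ^B = ∑_A ξ^A λ_A^B(f)`. -/
def lam (A B : Ix) : Fn q n → Fn q n :=
  Quotient.map' (fun f => jet q f (some A) (some B)) (fun _ _ h => Rel.calc _ _ h)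

/-- The partial derivative `∂_A` in `df = ∑_A ξ^A ∂_A f`. -/
def del (A : Ix) : Fn q n → Fn q n :=
  Quotient.map' (fun f => jet q f (some A) none) (fun _ _ h => Rel.calc _ _ h)

/-! ### Forms -/

/-- The `1`-form `∑_A ξ^A ω_A`. -/
abbrev OneForm (q : ℂ) (n : ℕ) : Type := Ix → Fn q n

/-- The `2`-form `∑_{A,B} ξ^A ξ^B c_{AB}`, with `c` normalised by `c = c 𝖯_A`. By the relations
`(𝖯_s + 𝖯_t) ξ ξ = 0`, i.e. `ξ ξ = 𝖯_A ξ ξ`, every `2`-form has exactly one such `c`. -/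
abbrev TwoForm (q : ℂ) (n : ℕ) : Type := Ix → Ix → Fn q n

/-- The normalised coefficients of `∑_{A,B} ξ^A ξ^B c_{AB}`. -/
def antisym (c : Ix → Ix → Fn q n) : TwoForm q n :=
  fun C D => ∑ A, ∑ B, projA q A B C D • c A B

/-- `f ω`. -/
def lmul (f : Fn q n) (ω : OneForm q n) : OneForm q n := fun A => ∑ B, lam A B f * ω B

/-- `ω f`. -/
def rmul (ω : OneForm q n) (f : Fn q n) : OneForm q n := fun A => ω A * f

/-- `df`. -/
def diff (f : Fn q n) : OneForm q n := fun A => del A f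

/-- The product `ω η` of two `1`-forms. -/
def wedge (ω η : OneForm q n) : TwoForm q n :=
  antisym fun A C => ∑ B, lam C B (ω A) * η B

/-- `dω = - ∑ ξ^A ξ^B ∂_B ω_A` for a `1`-form `ω = ∑ ξ^A ω_A`. -/
def diff₁ (ω : OneForm q n) : TwoForm q n :=
  antisym fun A B => -(del B (ω A))

/-- The Hodge map on `2`-forms, `*(ξ^A ξ^B) = (𝖯_a - 𝖯_{a'})^{AB}_{CD} ξ^C ξ^D`. -/
def hodge (F : TwoForm q n) : TwoForm q n :=
  fun C D => ∑ A, ∑ B, (projSD q A B C D - projASD q A B C D) • F A B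

/-- Gauge potentials, i.e. `2 × 2` matrices of `1`-forms. -/
abbrev Pot (q : ℂ) (n : ℕ) : Type := Fin 2 → Fin 2 → OneForm q n

/-- The field strength `F = dA + A A`. -/
def curv (A : Pot q n) : Fin 2 → Fin 2 → TwoForm q n :=
  fun i j => diff₁ (A i j) + ∑ k, wedge (A i k) (A k j)

/-- The selfduality equation `*F = F`. -/
def IsSelfDual (A : Pot q n) : Prop := ∀ i j, hodge (curv A i j) = curv A i j

/-- The gauge transform `V (A U + dU)`, where `V` is the inverse of `U`. -/
def gauge (A : Pot q n) (U V : Matrix (Fin 2) (Fin 2) (Fn q n)) : Pot q n :=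
  fun i j => ∑ k, lmul (V i k) (∑ l, rmul (A k l) (U l j) + diff (U k j))

/-! ### Instantons -/

/-- `∂^A = ε^{αβ} ε^{α'β'} ∂_{ββ'}`, so that `∂_A = ε_{αβ} ε_{α'β'} ∂^{ββ'}`. -/
def delUp (A : Ix) (f : Fn q n) : Fn q n :=
  ∑ B : Ix, (epsUp q A.1 B.1 * epsUp q A.2 B.2) • del B f

/-- The Laplacian `□ = ∂_k g^{hk} ∂_h`. -/
def box (f : Fn q n) : Fn q n :=
  ∑ H : Ix, ∑ K : Ix, (epsUp q H.1 K.1 * epsUp q H.2 K.2) • del K (del H f)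

/-- `𝒟̂ f` for the matrix of differential operators
`𝒟̂ = q ξ̄ ∂ - q⁻¹/(q + 1) d`, where `ξ̄ = ε⁻¹ ξᵀ ε` and `∂` is the matrix of the `∂^{αα'}`. -/
def Dhat (f : Fn q n) : Pot q n :=
  fun i j A =>
    (∑ m, (q * (epsUp q i A.2 * epsLow q A.1 m)) • delUp (m, j) f) -
      (if i = j then (q⁻¹ / (q + 1)) • del A f else 0)

/-- `y_μ`, `μ = 0, …, n`. -/
def yMat (q : ℂ) {n : ℕ} (μ : Fin (n + 1)) : Matrix (Fin 2) (Fin 2) (Fn q n) :=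
  (yFree μ).map (cls q)

/-- `z_μ = x - y_1 - … - y_μ`. -/
def zMat (q : ℂ) {n : ℕ} (μ : Fin n) : Matrix (Fin 2) (Fin 2) (Fn q n) :=
  (zFree μ).map (cls q)

/-- `ρ_μ²`. -/
def rhoSq (q : ℂ) {n : ℕ} (μ : Fin n) : Fn q n := cls q (gen (Gen.rho μ))

/-- `|z_μ|⁻¹`. -/
def zNormInv (q : ℂ) {n : ℕ} (μ : Fin n) : Fn q n := cls q (gen (Gen.zinv μ))

/-- `|y_μ|⁻¹`. -/
def yNormInv (q : ℂ) {n : ℕ} (μ : Fin n) : Fn q n := cls q (gen (Gen.yinv μ))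

/-- `φ = 1 + c ∑_μ ρ_μ² |z_μ|⁻²`. -/
def phi (q : ℂ) (n : ℕ) (c : ℂ) : Fn q n :=
  1 + c • ∑ μ : Fin n, rhoSq q μ * zNormInv q μ ^ 2

/-- `φ⁻¹`. -/
def phiInv (q : ℂ) (n : ℕ) (c : ℂ) : Fn q n := cls q (gen (Gen.pinv c))

/-- The singular potential `Â = φ⁻¹ 𝒟̂ φ`. -/
def Ahat (q : ℂ) (n : ℕ) (c : ℂ) : Pot q n :=
  fun i j => lmul (phiInv q n c) (Dhat (phi q n c) i j)

/-- The singular gauge transformation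
`U_2 = (z̄_1 / |z_1|) (y_2 / |y_2|) (z̄_2 / |z_2|)`. -/
def U2 (q : ℂ) : Matrix (Fin 2) (Fin 2) (Fn q 2) :=
  (zNormInv q (0 : Fin 2) • qbar q (zMat q (0 : Fin 2))) *
    (yNormInv q (1 : Fin 2) • yMat q (2 : Fin 3)) *
    (zNormInv q (1 : Fin 2) • qbar q (zMat q (1 : Fin 2)))

/-- The polynomial `φ |z_2|² |z_1|² = |z_2|² |z_1|² + c (|z_2|² ρ_1² + ρ_2² |z_1|²)`, which for
`q = 1` vanishes neither at `z_1 = 0` nor at `z_2 = 0`. -/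
def regDenom (q c : ℂ) : Fn q 2 :=
  qdet q (zMat q 1) * qdet q (zMat q 0) +
    c • (qdet q (zMat q 1) * rhoSq q 0 + rhoSq q 1 * qdet q (zMat q 0))

/-- The functions without poles at `z_1 = 0` and `z_2 = 0`: the algebra generated by the
coordinates, the sizes, `|y_2|⁻¹` and the inverses of the polynomials `φ |z_2|² |z_1|²` and of their
`q`-rescaled versions. Negative powers of `|z_1|`, `|z_2|` are not among the generators. -/
def regularFn (q c : ℂ) : Subalgebra ℂ (Fn q 2) :=
  Algebra.adjoin ℂ
    ({a | ∃ (μ : Fin 3) (i j : Fin 2), a = yMat q μ i j} ∪ {a | ∃ μ : Fin 2, a = rhoSq q μ} ∪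
      {yNormInv q 1} ∪
      {a | ∃ k : ℤ, a * regDenom q (c * q ^ (2 * k)) = 1 ∧ regDenom q (c * q ^ (2 * k)) * a = 1})

end QInst

end

/-! The differential calculus enters only through the maps in `f ξ^B = ξ^A L_A^B(f)` and `df = ξ^A
D_A f`, so the analysis is done for an abstract `Calculus` and specialised to `fnCalc` at the end.
All constant-tensor identities reduce to 2×2 spinor checks, because `R̂ ⊗ R̂` and the projectors are
tensor products. As `ξξ = 𝖯_A ξξ`, the form `ξ^A ξ^B c_AB` is selfdual once `𝖯_a'` annihilates `c`.
For this it suffices that contracting the unprimed indices of `c` with `ε^{αβ}` leaves a multiple of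
`ε` in the primed ones (`IsSD`, `isSelfDual_of_isSD`).

For (i), let `N = ∑ ρ_μ² |z_μ|⁻²`. Four properties of `N` suffice (`IsSeed`): it passes `ξ` with
factor `q⁻²`, it commutes with its derivatives, these transform as a covector, and the
`ε`-contraction of its second derivatives vanishes. Differentiating `N ∂N = ∂N N` and contracting
forces the contraction of `∂N ∂N` to be a multiple of `ε` (`IsSeed.grad`). The quadratic part of the
curvature of `φ⁻¹ 𝒟̂ φ` is then a table of constants times one element (`IsSeed.quad`), while
harmonicity removes the linear part (`IsSeed.isSD_curv`). A single `ρ²|z|⁻²` is such an `N`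
(`IsSize.isSeed`). The `q`-factors between the `ρ_μ²` and the `y_μ` make the cross terms of a sum
cancel in pairs (`IsSize.D_pot_pair`, `IsSeed.sum`).

For (ii), the curvature transforms covariantly when `U` and its inverse respect the relations of
2-forms and `d² = 0` up to selfdual terms (`IsCov`, `isSD_curv_gauge`). This is closed under sums
and products, so it is checked on coordinates and inverse norms. For regularity put `U_i =
z̄_i/|z_i|`, `V_i = U_i⁻¹`, `G = y_2/|y_2|`, `u_i = ρ_i²|z_i|⁻²`. Then `𝒟̂ u_i = -q⁻² u_i dU_i V_i`
(`IsSize.dhat_pot`), and the decisive fact is the symmetry `U_1 G U_2 = U_2 G U_1`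
(`PairRel.gauge_eq`). Expanding `dU_2` in both orders cancels the terms `u_i dU_i V_i` of the
potential. What remains, with `p` an inverse of `1 + b(u_1 + u_2)`, is `p (V_1 dU_1 + b (u_2 V_1
dU_1 + u_1 V_2 dU_2))` plus `p` times a conjugate of `V_2 dU_2` (`Calculus.gauge_two`). Every term
can be written as a polynomial, possibly with powers of `|y_2|⁻¹`, times `|z_1|⁻² |z_2|⁻² p`, the
inverse of an admitted denominator (`PairRel.regular_eq`, `IsTwoInst.conj_mem`). -/

noncomputable section
namespace QInst

/-! ### First order calculi -/

/-- A first order calculus on `S` whose right module of `1`-forms has the basis `ξ^A`: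
the maps in `f ξ^B = ∑_A ξ^A L_A^B(f)` and `df = ∑_A ξ^A D_A f`. -/
structure Calculus (S : Type*) [Ring S] [Algebra ℂ S] where
  L : Ix → Ix → S →ₗ[ℂ] S
  D : Ix → S →ₗ[ℂ] S
  L_one : ∀ A B, L A B 1 = if A = B then 1 else 0
  L_mul : ∀ A B f g, L A B (f * g) = ∑ C, L A C f * L C B g
  D_mul : ∀ A f g, D A (f * g) = ∑ B, L A B f * D B g + D A f * g

namespace Calculus

variable {S : Type*} [Ring S] [Algebra ℂ S] (K : Calculus S)

theorem D_one (A : Ix) : K.D A 1 = 0 := by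
  have h := K.D_mul A 1 1
  simp only [K.L_one, mul_one, ite_mul, one_mul, zero_mul, Finset.sum_ite_eq, Finset.mem_univ,
    if_true] at h
  simpa using h

/-- `f ξ^A = r ξ^A f` for all `A`. -/
def IsDiag (f : S) (r : ℂ) : Prop := ∀ A B, K.L A B f = if A = B then r • f else 0

variable {K}

theorem IsDiag.L_mul {f : S} {r : ℂ} (h : K.IsDiag f r) (g : S) (A B : Ix) :
    K.L A B (f * g) = r • (f * K.L A B g) := by
  simp [K.L_mul, h A, ite_mul]

theorem IsDiag.L_mul_right {g : S} {r : ℂ} (h : K.IsDiag g r) (f : S) (A B : Ix) :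
    K.L A B (f * g) = r • (K.L A B f * g) := by
  simp only [K.L_mul, h _ B, mul_ite, mul_zero, Finset.sum_ite_eq', Finset.mem_univ, if_true,
    mul_smul_comm]

theorem IsDiag.D_mul {f : S} {r : ℂ} (h : K.IsDiag f r) (g : S) (A : Ix) :
    K.D A (f * g) = r • (f * K.D A g) + K.D A f * g := by
  simp [K.D_mul, h A, ite_mul]

theorem IsDiag.one : K.IsDiag 1 1 := fun A B => by simp [K.L_one]

theorem IsDiag.mul {f g : S} {r s : ℂ} (hf : K.IsDiag f r) (hg : K.IsDiag g s) :
    K.IsDiag (f * g) (r * s) := fun A B => by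
  rw [hf.L_mul, hg A B]
  split_ifs <;> simp [mul_smul]

theorem IsDiag.pow {f : S} {r : ℂ} (hf : K.IsDiag f r) (m : ℕ) :
    K.IsDiag (f ^ m) (r ^ m) := by
  induction m with
  | zero => simpa using IsDiag.one
  | succ m ih => simpa [pow_succ] using ih.mul hf

theorem IsDiag.sum {ι : Type*} (s : Finset ι) {f : ι → S} {r : ℂ}
    (hf : ∀ i ∈ s, K.IsDiag (f i) r) : K.IsDiag (∑ i ∈ s, f i) r := fun A B => by
  rw [map_sum, Finset.sum_congr rfl fun i hi => hf i hi A B]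
  split_ifs <;> simp [Finset.smul_sum]

variable (K)

/-- The calculus on matrices with entries in `S`. -/
def matrix : Calculus (Matrix (Fin 2) (Fin 2) S) where
  L A B := (K.L A B).mapMatrix
  D A := (K.D A).mapMatrix
  L_one A B := by
    ext i j
    simp only [LinearMap.mapMatrix_apply, Matrix.map_apply, Matrix.one_apply]
    split_ifs <;> simp_all [K.L_one, Matrix.one_apply]
  L_mul A B f g := by
    ext i j
    simp only [LinearMap.mapMatrix_apply, Matrix.map_apply, Matrix.mul_apply, map_sum, K.L_mul,
      Matrix.sum_apply]
    exact Finset.sum_comm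
  D_mul A f g := by
    ext i j
    simp only [LinearMap.mapMatrix_apply, Matrix.map_apply, Matrix.mul_apply, map_sum, K.D_mul,
      Matrix.sum_apply, Matrix.add_apply, Finset.sum_add_distrib]
    rw [Finset.sum_comm]

@[simp] theorem matrix_L (A B : Ix) (M : Matrix (Fin 2) (Fin 2) S) (i j : Fin 2) :
    K.matrix.L A B M i j = K.L A B (M i j) := rfl

@[simp] theorem matrix_D (A : Ix) (M : Matrix (Fin 2) (Fin 2) S) (i j : Fin 2) :
    K.matrix.D A M i j = K.D A (M i j) := rfl

end Calculus

/-! ### The calculus on the algebra of functions -/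

variable {n : ℕ} {q : ℂ}

/-- The quotient map as a homomorphism of algebras. -/
def clsHom (q : ℂ) (n : ℕ) : Free n →ₐ[ℂ] Fn q n := RingCon.mkₐ ℂ (relCon q n)

theorem cls_surjective (a : Fn q n) : ∃ b, cls q b = a := (relCon q n).mk'_surjective a

theorem cls_eq {a b : Free n} : cls q a = cls q b ↔ Rel q n a b := (relCon q n).eq

theorem cls_add (a b : Free n) : cls q (a + b) = cls q a + cls q b := rfl
theorem cls_mul (a b : Free n) : cls q (a * b) = cls q a * cls q b := rfl
theorem cls_smul (r : ℂ) (a : Free n) : cls q (r • a) = r • cls q a := rfl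
theorem cls_sub (a b : Free n) : cls q (a - b) = cls q a - cls q b := map_sub (clsHom q n) a b
theorem cls_one : cls q (1 : Free n) = 1 := rfl
theorem cls_zero : cls q (0 : Free n) = 0 := rfl
theorem cls_sum {ι : Type*} (s : Finset ι) (f : ι → Free n) :
    cls q (∑ i ∈ s, f i) = ∑ i ∈ s, cls q (f i) := map_sum (clsHom q n) f s

theorem lam_cls (A B : Ix) (f : Free n) :
    lam A B (cls q f) = cls q (jet q f (some A) (some B)) := rfl

theorem del_cls (A : Ix) (f : Free n) :
    del A (cls q f) = cls q (jet q f (some A) none) := rfl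

theorem jetGen_none (g : Gen n) :
    (∀ B, jetGen q g none (some B) = 0) ∧ jetGen q g none none = gen g := by
  cases g <;> simp [jetGen, jetGen1, jetGen0, block]

theorem jet_gen (g : Gen n) : jet q (gen g) = jetGen q g := by simp [jet, gen]

/-- The bottom row of the block matrix is `(0, f)`. With this, multiplicativity of the jet splits
into the product rule for `λ` and the twisted Leibniz rule. -/
theorem jet_none (f : Free n) :
    (∀ B, jet q f none (some B) = 0) ∧ jet q f none none = f := by
  induction f using FreeAlgebra.induction with
  | grade0 r => simp [Algebra.algebraMap_eq_smul_one]
  | grade1 g => simpa [jet, gen] using jetGen_none (q := q) g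
  | mul a b ha hb =>
    simp [Matrix.mul_apply, Fintype.sum_option, ha, hb]
  | add a b ha hb => simp [ha, hb]

/-- The calculus on the algebra of functions. -/
def fnCalc (q : ℂ) (n : ℕ) : Calculus (Fn q n) where
  L A B :=
    { toFun := lam A B
      map_add' := fun f g => by
        obtain ⟨f, rfl⟩ := cls_surjective f
        obtain ⟨g, rfl⟩ := cls_surjective g
        simp [← cls_add, lam_cls]
      map_smul' := fun r f => by
        obtain ⟨f, rfl⟩ := cls_surjective f
        simp [← cls_smul, lam_cls] }
  D A :=
    { toFun := del A
      map_add' := fun f g => by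
        obtain ⟨f, rfl⟩ := cls_surjective f
        obtain ⟨g, rfl⟩ := cls_surjective g
        simp [← cls_add, del_cls]
      map_smul' := fun r f => by
        obtain ⟨f, rfl⟩ := cls_surjective f
        simp [← cls_smul, del_cls] }
  L_one A B := by
    change lam A B (cls q 1) = _
    rw [lam_cls, map_one, Matrix.one_apply]
    split_ifs <;> simp_all [cls_one, cls_zero]
  L_mul A B f g := by
    obtain ⟨f, rfl⟩ := cls_surjective f
    obtain ⟨g, rfl⟩ := cls_surjective g
    change lam A B (cls q (f * g)) = ∑ C, lam A C (cls q f) * lam C B (cls q g)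
    rw [lam_cls A B (f * g)]
    simp only [lam_cls, map_mul, Matrix.mul_apply, Fintype.sum_option, jet_none, cls_sum, cls_mul,
      mul_zero, zero_add]
  D_mul A f g := by
    obtain ⟨f, rfl⟩ := cls_surjective f
    obtain ⟨g, rfl⟩ := cls_surjective g
    change del A (cls q (f * g)) = ∑ C, lam A C (cls q f) * del C (cls q g) + del A (cls q f) * cls q g
    rw [del_cls A (f * g)]
    simp only [lam_cls, del_cls, map_mul, Matrix.mul_apply, Fintype.sum_option, jet_none, cls_sum,
      cls_mul, cls_add]
    exact add_comm _ _

theorem fnCalc_L (A B : Ix) (f : Fn q n) : (fnCalc q n).L A B f = lam A B f := rfl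
theorem fnCalc_D (A : Ix) (f : Fn q n) : (fnCalc q n).D A f = del A f := rfl

end QInst
end

noncomputable section
namespace QInst

/-! ### Spinor identities -/

/-- The inverse of `braid2`. -/
def braidInv2 (q : ℂ) (a b c d : Fin 2) : ℂ :=
  (if a = c ∧ b = d then q⁻¹ else 0) + epsUp q a b * epsLow q c d

variable {q : ℂ} {S : Type*} [Ring S] [Algebra ℂ S]

/-- The tensors whose antiselfdual part vanishes. -/
def IsSD (q : ℂ) (c : Ix → Ix → S) : Prop :=
  ∃ k : S, ∀ i j, ∑ a, ∑ b, epsUp q a b • c (a, i) (b, j) = epsLow q i j • k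

theorem IsSD.add {c c' : Ix → Ix → S} (h : IsSD q c) (h' : IsSD q c') :
    IsSD q fun A B => c A B + c' A B := by
  obtain ⟨k, hk⟩ := h
  obtain ⟨k', hk'⟩ := h'
  exact ⟨k + k', fun i j => by simp only [smul_add, Finset.sum_add_distrib, hk, hk']⟩

theorem IsSD.neg {c : Ix → Ix → S} (h : IsSD q c) : IsSD q fun A B => -c A B := by
  obtain ⟨k, hk⟩ := h
  exact ⟨-k, fun i j => by simp only [smul_neg, Finset.sum_neg_distrib, hk]⟩

theorem IsSD.smul {c : Ix → Ix → S} (h : IsSD q c) (r : ℂ) : IsSD q fun A B => r • c A B := by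
  obtain ⟨k, hk⟩ := h
  exact ⟨r • k, fun i j => by
    simp only [smul_comm _ r, ← Finset.smul_sum, hk]⟩

theorem IsSD.mul_right {c : Ix → Ix → S} (h : IsSD q c) (f : S) :
    IsSD q fun A B => c A B * f := by
  obtain ⟨k, hk⟩ := h
  exact ⟨k * f, fun i j => by
    simp only [← smul_mul_assoc, ← Finset.sum_mul, hk]⟩

theorem IsSD.mul_left {c : Ix → Ix → S} (h : IsSD q c) (f : S) :
    IsSD q fun A B => f * c A B := by
  obtain ⟨k, hk⟩ := h
  exact ⟨f * k, fun i j => by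
    simp only [← mul_smul_comm, ← Finset.mul_sum, hk]⟩

theorem IsSD.zero : IsSD q fun _ _ => (0 : S) := ⟨0, fun i j => by simp⟩

theorem IsSD.sum {ι : Type*} (s : Finset ι) {c : ι → Ix → Ix → S}
    (h : ∀ i ∈ s, IsSD q (c i)) : IsSD q fun A B => ∑ i ∈ s, c i A B := by
  classical
  induction s using Finset.induction_on with
  | empty => simpa using IsSD.zero
  | insert i s hi ih =>
    simp only [Finset.sum_insert hi]
    exact (h i (Finset.mem_insert_self _ _)).add
      (ih fun j hj => h j (Finset.mem_insert_of_mem hj))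

/-- Since `𝒫_a` has rank one, `𝒫_a ⊗ 𝒫_s` sees only the `ε`-contraction of the unprimed indices, and
then only its symmetric part in the primed ones. -/
theorem projASD_sum (q : ℂ) (c : Ix → Ix → S) (C D : Ix) :
    ∑ A, ∑ B, projASD q A B C D • c A B =
      -(epsLow q C.1 D.1 / (q + q⁻¹)) • ∑ i, ∑ j, projSym q i j C.2 D.2 •
        ∑ a, ∑ b, epsUp q a b • c (a, i) (b, j) := by
  simp only [projASD, projAnti, Fintype.sum_prod_type, Fin.sum_univ_two, smul_add,
    smul_smul]
  module

theorem IsSD.projASD_sum_eq_zero (hq : q ≠ 0) (hq2 : q ^ 2 + 1 ≠ 0) {c : Ix → Ix → S}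
    (h : IsSD q c) (C D : Ix) : ∑ A, ∑ B, projASD q A B C D • c A B = 0 := by
  obtain ⟨k, hk⟩ := h
  -- `ε` is `q`-antisymmetric, so `𝒫_s` annihilates the contraction.
  have hs : ∀ c d, ∑ i, ∑ j, projSym q i j c d * epsLow q i j = 0 := by
    intro c d
    fin_cases c <;> fin_cases d <;> simp [projSym, epsLow, epsUp] <;> field_simp <;> ring
  rw [projASD_sum]
  simp only [hk, smul_smul, ← Finset.sum_smul]
  rw [hs]
  simp

/-- `𝒫_s` and `𝒫_a` are orthogonal idempotents, so the normalisation by `𝖯_A` is invisible to the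
Hodge map. -/
theorem projA_mul_hodge (hq : q ≠ 0) (hq2 : q ^ 2 + 1 ≠ 0) (A B C D : Ix) :
    ∑ E, ∑ F, (projSD q E F C D - projASD q E F C D) * projA q A B E F =
      projSD q A B C D - projASD q A B C D := by
  have h1 : ∀ a b c d, ∑ e, ∑ f, projAnti q e f c d * projAnti q a b e f = projAnti q a b c d := by
    intro a b c d
    simp only [projAnti, Fin.sum_univ_two, epsLow, epsUp]
    fin_cases a <;> fin_cases b <;> fin_cases c <;> fin_cases d <;> simp <;> field_simp <;> ring
  have h2 : ∀ a b c d, ∑ e, ∑ f, projSym q e f c d * projSym q a b e f = projSym q a b c d := by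
    intro a b c d
    simp only [projSym, Fin.sum_univ_two, epsLow, epsUp]
    fin_cases a <;> fin_cases b <;> fin_cases c <;> fin_cases d <;> simp <;> field_simp <;> ring
  have h3 : ∀ a b c d, ∑ e, ∑ f, projSym q e f c d * projAnti q a b e f = 0 := by
    intro a b c d
    simp only [projSym, projAnti, Fin.sum_univ_two, epsLow, epsUp]
    fin_cases a <;> fin_cases b <;> fin_cases c <;> fin_cases d <;> simp <;> field_simp <;> ring
  have h4 : ∀ a b c d, ∑ e, ∑ f, projAnti q e f c d * projSym q a b e f = 0 := by
    intro a b c d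
    simp only [projSym, projAnti, Fin.sum_univ_two, epsLow, epsUp]
    fin_cases a <;> fin_cases b <;> fin_cases c <;> fin_cases d <;> simp <;> field_simp <;> ring
  have key : ∀ (P P' T T' : Fin 2 → Fin 2 → Fin 2 → Fin 2 → ℂ),
      ∑ E : Ix, ∑ F : Ix, (P E.1 F.1 C.1 D.1 * P' E.2 F.2 C.2 D.2) *
        (T A.1 B.1 E.1 F.1 * T' A.2 B.2 E.2 F.2) =
      (∑ e, ∑ f, P e f C.1 D.1 * T A.1 B.1 e f) * ∑ e, ∑ f, P' e f C.2 D.2 * T' A.2 B.2 e f := by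
    intro P P' T T'
    simp only [Fintype.sum_prod_type, Fin.sum_univ_two]
    ring
  simp only [projA, sub_mul, mul_add, Finset.sum_sub_distrib, Finset.sum_add_distrib]
  simp only [projSD, projASD, key, h1, h2, h3, h4]
  ring

end QInst
end

noncomputable section
namespace QInst

/-! ### Curvature and gauge transformations -/

namespace Calculus

variable {q : ℂ} {S : Type*} [Ring S] [Algebra ℂ S] (K : Calculus S)

/-- The coefficients of `dω + ω ω`. -/
def curv (ω : Ix → S) : Ix → Ix → S :=
  fun A B => -(K.D B (ω A)) + ∑ E, K.L B E (ω A) * ω E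

/-- `f c` for a tensor `c`. -/
def act (f : S) (c : Ix → Ix → S) : Ix → Ix → S :=
  fun A B => ∑ E, ∑ F, K.L B F (K.L A E f) * c E F

/-- Associativity: `fg` can be moved past `ξξ` one factor at a time. -/
theorem act_mul (f g : S) (c : Ix → Ix → S) : K.act (f * g) c = K.act f (K.act g c) := by
  funext A B
  simp only [act, K.L_mul, map_sum, Finset.mul_sum, Finset.sum_mul, mul_assoc]
  calc _ = ∑ E, ∑ F, ∑ G, ∑ H, K.L B H (K.L A G f) * (K.L H F (K.L G E g) * c E F) := rfl
    _ = ∑ E, ∑ G, ∑ F, ∑ H, K.L B H (K.L A G f) * (K.L H F (K.L G E g) * c E F) :=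
      Finset.sum_congr rfl fun E _ => Finset.sum_comm
    _ = ∑ G, ∑ E, ∑ F, ∑ H, K.L B H (K.L A G f) * (K.L H F (K.L G E g) * c E F) :=
      Finset.sum_comm
    _ = ∑ G, ∑ E, ∑ H, ∑ F, K.L B H (K.L A G f) * (K.L H F (K.L G E g) * c E F) :=
      Finset.sum_congr rfl fun G _ => Finset.sum_congr rfl fun E _ => Finset.sum_comm
    _ = _ := Finset.sum_congr rfl fun G _ => Finset.sum_comm

theorem act_add_left (f g : S) (c : Ix → Ix → S) :
    K.act (f + g) c = fun A B => K.act f c A B + K.act g c A B := by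
  funext A B
  simp only [act, map_add, add_mul, Finset.sum_add_distrib]

theorem act_smul_left (r : ℂ) (f : S) (c : Ix → Ix → S) :
    K.act (r • f) c = fun A B => r • K.act f c A B := by
  funext A B
  simp only [act, map_smul, smul_mul_assoc, Finset.smul_sum]

/-- The compatibility of `f` with the relations between the `ξ^A ξ^B` and with `d² = 0`. -/
structure IsCov (q : ℂ) (f : S) : Prop where
  act : ∀ c, IsSD q c → IsSD q (K.act f c)
  comm : ∀ E, IsSD q fun A B => K.D B (K.L A E f) + K.L B E (K.D A f)
  sq : IsSD q fun A B => K.D B (K.D A f)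

variable {K}

/-- By Leibniz each defect of `fg` is `f` acting on a defect of `g` plus a defect of `f` times a
function. The clause `act` keeps the first summand selfdual. -/
theorem IsCov.mul {f g : S} (hf : K.IsCov q f) (hg : K.IsCov q g) : K.IsCov q (f * g) where
  act c hc := by
    rw [act_mul]
    exact hf.act _ (hg.act _ hc)
  comm E := by
    have h := (hf.act _ (hg.comm E)).add
      (IsSD.sum Finset.univ fun G _ => (hf.comm G).mul_right (K.L G E g))
    convert h using 3 with A B
    simp only [K.L_mul, K.D_mul, map_sum, map_add, Calculus.act, mul_add, add_mul,
      Finset.sum_add_distrib]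
    rw [add_add_add_comm]
  sq := by
    have h := ((hf.act _ hg.sq).add
      (IsSD.sum Finset.univ fun G _ => (hf.comm G).mul_right (K.D G g))).add (hf.sq.mul_right g)
    convert h using 3 with A B
    simp only [K.D_mul, map_sum, map_add, Calculus.act, add_mul,
      Finset.sum_add_distrib]
    abel

theorem IsCov.add {f g : S} (hf : K.IsCov q f) (hg : K.IsCov q g) : K.IsCov q (f + g) where
  act c hc := by
    rw [act_add_left]
    exact (hf.act _ hc).add (hg.act _ hc)
  comm E := by
    convert (hf.comm E).add (hg.comm E) using 3 with A B
    simp only [map_add]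
    abel
  sq := by simpa only [map_add] using hf.sq.add hg.sq

theorem IsCov.smul {f : S} (hf : K.IsCov q f) (r : ℂ) : K.IsCov q (r • f) where
  act c hc := by
    rw [act_smul_left]
    exact (hf.act _ hc).smul r
  comm E := by simpa only [map_smul, smul_add] using (hf.comm E).smul r
  sq := by simpa only [map_smul] using hf.sq.smul r

theorem IsCov.zero : K.IsCov q 0 where
  act c hc := by
    convert IsSD.zero using 3 with A B
    simp [Calculus.act]
  comm E := by simpa using IsSD.zero
  sq := by simpa using IsSD.zero

theorem IsCov.sum {ι : Type*} (s : Finset ι) {f : ι → S}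
    (h : ∀ i ∈ s, K.IsCov q (f i)) : K.IsCov q (∑ i ∈ s, f i) :=
  Finset.sum_induction f (K.IsCov q) (fun _ _ => IsCov.add) IsCov.zero h

theorem isSD_matrix_iff (c : Ix → Ix → Matrix (Fin 2) (Fin 2) S) :
    IsSD q c ↔ ∀ i j, IsSD q fun A B => c A B i j := by
  constructor
  · rintro ⟨k, hk⟩ i j
    exact ⟨k i j, fun a b => by simpa [Matrix.sum_apply] using congrFun (congrFun (hk a b) i) j⟩
  · intro h
    choose k hk using h
    refine ⟨Matrix.of k, fun a b => ?_⟩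
    ext i j
    simpa [Matrix.sum_apply] using hk i j a b

theorem IsCov.matrix {M : Matrix (Fin 2) (Fin 2) S} (h : ∀ i j, K.IsCov q (M i j)) :
    K.matrix.IsCov q M where
  act c hc := by
    rw [isSD_matrix_iff] at hc ⊢
    intro i j
    convert IsSD.sum Finset.univ fun l _ => (h i l).act _ (hc l j) using 3 with A B
    simp only [Calculus.act, Matrix.sum_apply, Matrix.mul_apply, matrix_L]
    calc _ = ∑ E, ∑ l, ∑ F, (K.L B F) ((K.L A E) (M i l)) * c E F l j :=
        Finset.sum_congr rfl fun E _ => Finset.sum_comm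
      _ = _ := Finset.sum_comm
  comm E := (isSD_matrix_iff _).2 fun i j => (h i j).comm E
  sq := (isSD_matrix_iff _).2 fun i j => (h i j).sq

variable (K)

/-- The gauge transform `V (ω U + dU)`. -/
def gauge (ω : Ix → S) (U V : S) : Ix → S :=
  fun A => ∑ B, K.L A B V * (ω B * U + K.D B U)

/-- This is `V (dU) V = -dV`, obtained from `d(VU) = 0`. -/
theorem sum_L_mul_D_inv {U V : S} (hUV : U * V = 1) (hVU : V * U = 1) (A : Ix) :
    ∑ G, K.L A G V * (K.D G U * V) = -K.D A V := by
  have h := congrArg (· * V) (K.D_mul A V U)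
  simp only [hVU, D_one, zero_mul, add_mul, mul_assoc, hUV, mul_one, Finset.sum_mul] at h
  exact eq_neg_of_add_eq_zero_left h.symm

/-- The usual `F ↦ V F U`, as an exact identity between unnormalised coefficients. Neither `d² = 0`
nor the relations of the `ξ^A ξ^B` are used, so `ddU` and the failure of `d(Vξ) = dV ξ` survive as
explicit remainders. -/
theorem curv_gauge (ω : Ix → S) {U V : S} (hUV : U * V = 1) (hVU : V * U = 1) (A B : Ix) :
    K.curv (K.gauge ω U V) A B =
      K.act V (fun E F => K.curv ω E F * U - K.D F (K.D E U)) A B -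
        ∑ E, (K.D B (K.L A E V) + K.L B E (K.D A V)) * (ω E * U + K.D E U) := by
  set η : Ix → S := fun E => ω E * U + K.D E U with hη
  have h1 : K.D B (K.gauge ω U V A) =
      K.act V (fun E F => K.D F (η E)) A B + ∑ E, K.D B (K.L A E V) * η E := by
    simp only [gauge, map_sum, K.D_mul, Finset.sum_add_distrib, act, hη]
  have h3 : ∀ H G, ∑ E, K.L H E (η G) * K.gauge ω U V E =
      ∑ E, K.L H E (ω G) * η E + ∑ E, K.L H E (K.D G U * V) * η E := by
    intro H G
    have : η G * V = ω G + K.D G U * V := by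
      simp only [hη, add_mul, mul_assoc, hUV, mul_one]
    calc ∑ E, K.L H E (η G) * K.gauge ω U V E
        = ∑ E, ∑ F, K.L H E (η G) * (K.L E F V * η F) :=
          Finset.sum_congr rfl fun E _ => Finset.mul_sum _ _ _
      _ = ∑ F, K.L H F (η G * V) * η F := by
          rw [Finset.sum_comm]
          simp only [K.L_mul, Finset.sum_mul, mul_assoc]
      _ = _ := by
          rw [this]
          simp only [map_add, add_mul, Finset.sum_add_distrib]
  have h2 : ∑ E, K.L B E (K.gauge ω U V A) * K.gauge ω U V E =
      K.act V (fun E F => ∑ H, K.L F H (ω E) * η H) A B -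
        ∑ E, K.L B E (K.D A V) * η E := by
    have h4 : ∑ E, K.L B E (K.gauge ω U V A) * K.gauge ω U V E =
        K.act V (fun E F => ∑ H, K.L F H (η E) * K.gauge ω U V H) A B := by
      conv_lhs => enter [2, E, 1]; rw [gauge]
      simp only [map_sum, K.L_mul, act, Finset.mul_sum, Finset.sum_mul, mul_assoc]
      rw [Finset.sum_comm]
      refine Finset.sum_congr rfl fun G _ => ?_
      exact Finset.sum_comm
    -- The Maurer–Cartan term: `V (dU V) η = -dV η`.
    have h5 : K.act V (fun E F => ∑ H, K.L F H (K.D E U * V) * η H) A B =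
        - ∑ E, K.L B E (K.D A V) * η E := by
      have h6 : ∀ H, ∑ G, ∑ F, K.L B F (K.L A G V) * K.L F H (K.D G U * V) =
          -K.L B H (K.D A V) := by
        intro H
        rw [← map_neg, ← K.sum_L_mul_D_inv hUV hVU A, map_sum]
        simp only [K.L_mul B]
      simp only [← Finset.sum_neg_distrib, ← neg_mul, ← h6, act, Finset.mul_sum, Finset.sum_mul,
        mul_assoc]
      rw [Finset.sum_comm]
      refine Eq.trans (Finset.sum_congr rfl fun F _ => Finset.sum_comm) ?_
      rw [Finset.sum_comm]
      refine Eq.trans (Finset.sum_congr rfl fun F _ => Finset.sum_comm) ?_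
      exact Finset.sum_congr rfl fun F _ => Finset.sum_congr rfl fun G _ =>
        Finset.sum_congr rfl fun H _ => rfl
    rw [h4, sub_eq_add_neg, ← h5]
    simp only [h3, act, mul_add, Finset.sum_add_distrib]
  have h6 : K.act V (fun E F => K.curv ω E F * U - K.D F (K.D E U)) A B =
      K.act V (fun E F => ∑ H, K.L F H (ω E) * η H) A B - K.act V (fun E F => K.D F (η E)) A B := by
    simp only [act, ← Finset.sum_sub_distrib, ← mul_sub]
    refine Finset.sum_congr rfl fun E _ => Finset.sum_congr rfl fun F _ => ?_
    congr 1
    simp only [curv, hη, map_add, K.D_mul, mul_add, Finset.sum_add_distrib, add_mul,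
      Finset.sum_mul, mul_assoc, neg_mul]
    abel
  rw [curv, h1, h2, h6]
  simp only [add_mul, Finset.sum_add_distrib]
  abel

/-- Each remainder in `curv_gauge` is one of the defects which `IsCov` declares selfdual. -/
theorem isSD_curv_gauge {ω : Ix → S} {U V : S} (hUV : U * V = 1) (hVU : V * U = 1)
    (hU : K.IsCov q U) (hV : K.IsCov q V) (h : IsSD q (K.curv ω)) :
    IsSD q (K.curv (K.gauge ω U V)) := by
  have h1 : IsSD q fun E F => K.curv ω E F * U - K.D F (K.D E U) := by
    simpa only [sub_eq_add_neg] using (h.mul_right U).add hU.sq.neg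
  have h2 := (hV.act _ h1).add (IsSD.sum Finset.univ fun E _ =>
    ((hV.comm E).mul_right (ω E * U + K.D E U))).neg
  convert h2 using 3 with A B
  rw [K.curv_gauge ω hUV hVU, sub_eq_add_neg]

end Calculus

/-! ### Selfduality of gauge potentials -/

theorem sum_comm_pairs {ι κ τ M : Type*} [Fintype ι] [Fintype κ] [Fintype τ] [AddCommMonoid M]
    (f : ι → ι → κ → τ → M) :
    ∑ e, ∑ f', ∑ a, ∑ b, f e f' a b = ∑ a, ∑ b, ∑ e, ∑ f', f e f' a b := by
  simpa only [Fintype.sum_prod_type] using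
    Finset.sum_comm (s := Finset.univ) (t := Finset.univ)
      (f := fun (x : ι × ι) (y : κ × τ) => f x.1 x.2 y.1 y.2)

variable {n : ℕ} {q : ℂ}

/-- The coefficients `a_A` of a gauge potential `ξ^A a_A`. -/
def coef (A : Pot q n) : Ix → Matrix (Fin 2) (Fin 2) (Fn q n) :=
  fun B => Matrix.of fun i j => A i j B

theorem curv_eq_antisym (A : Pot q n) (i j : Fin 2) :
    curv A i j = antisym fun B C => (fnCalc q n).matrix.curv (coef A) B C i j := by
  have key : ∀ (S : Type) [Ring S] [Algebra ℂ S] (p : Ix → Ix → ℂ) (d : Ix → Ix → S)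
      (m : Fin 2 → Ix → Ix → Ix → S),
      ∑ A, ∑ B, p A B • (-d A B) + ∑ k, ∑ A, ∑ B, p A B • ∑ E, m k A B E =
        ∑ A, ∑ B, p A B • (-d A B + ∑ E, ∑ k, m k A B E) := by
    intro S _ _ p d m
    simp only [smul_add, Finset.sum_add_distrib]
    congr 1
    rw [Finset.sum_comm]
    refine Finset.sum_congr rfl fun B _ => ?_
    rw [Finset.sum_comm]
    refine Finset.sum_congr rfl fun E _ => ?_
    rw [← Finset.smul_sum, Finset.sum_comm]
  funext C D
  simp only [curv, diff₁, wedge, Pi.add_apply, Finset.sum_apply, antisym, Calculus.curv,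
    Matrix.add_apply, Matrix.neg_apply, Matrix.sum_apply, Matrix.mul_apply, Calculus.matrix_L,
    Calculus.matrix_D, coef, Matrix.of_apply, fnCalc_L, fnCalc_D]
  exact key (Fn q n) (fun A B => projA q A B C D) (fun B C => del C (A i j B))
    (fun k B C E => lam C E (A i k B) * A k j E)

theorem IsSD.hodge_eq {S : Type*} [Ring S] [Algebra ℂ S] (hq : q ≠ 0) (hq2 : q ^ 2 + 1 ≠ 0)
    {c : Ix → Ix → S} (hc : IsSD q c) (C D : Ix) :
    ∑ E, ∑ F, (projSD q E F C D - projASD q E F C D) • ∑ A, ∑ B, projA q A B E F • c A B =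
      ∑ A, ∑ B, projA q A B C D • c A B := by
  have h := hc.projASD_sum_eq_zero hq hq2 C D
  have h2 := fun A B => projA_mul_hodge hq hq2 A B C D
  have h1 : ∑ E, ∑ F, (projSD q E F C D - projASD q E F C D) •
      ∑ A, ∑ B, projA q A B E F • c A B =
      ∑ A, ∑ B, (projSD q A B C D - projASD q A B C D) • c A B := by
    simp only [Finset.smul_sum, smul_smul]
    rw [sum_comm_pairs]
    simp only [← Finset.sum_smul, h2]
  rw [h1]
  simp only [projA, sub_smul, add_smul, Finset.sum_sub_distrib, Finset.sum_add_distrib, h,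
    sub_zero, add_zero]

theorem hodge_antisym (hq : q ≠ 0) (hq2 : q ^ 2 + 1 ≠ 0) {c : Ix → Ix → Fn q n}
    (hc : IsSD q c) : hodge (antisym c) = antisym c :=
  funext fun C => funext fun D => hc.hodge_eq hq hq2 C D

theorem isSelfDual_of_isSD (hq : q ≠ 0) (hq2 : q ^ 2 + 1 ≠ 0) {A : Pot q n}
    (h : IsSD q ((fnCalc q n).matrix.curv (coef A))) : IsSelfDual A := fun i j => by
  rw [curv_eq_antisym]
  exact hodge_antisym hq hq2 ((Calculus.isSD_matrix_iff _).1 h i j)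

theorem coef_gauge (A : Pot q n) (U V : Matrix (Fin 2) (Fin 2) (Fn q n)) :
    coef (gauge A U V) = (fnCalc q n).matrix.gauge (coef A) U V := by
  funext C
  ext i j
  simp only [coef, gauge, lmul, rmul, diff, Calculus.gauge, Matrix.of_apply, Matrix.sum_apply,
    Matrix.mul_apply, Matrix.add_apply, Calculus.matrix_L, Calculus.matrix_D, Finset.sum_apply,
    Pi.add_apply, fnCalc_L, fnCalc_D]
  exact Finset.sum_comm

end QInst
end

noncomputable section
namespace QInst

/-! ### The singular potentials of harmonic functions -/

namespace Calculus

variable {q : ℂ} {S : Type*} [Ring S] [Algebra ℂ S] (K : Calculus S)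

/-- The matrix-valued coefficients of `𝒟̂ f`. -/
def dhat (q : ℂ) (f : S) (A : Ix) : Matrix (Fin 2) (Fin 2) S :=
  Matrix.of fun i j => ∑ c, (q * (epsUp q i A.2 * epsUp q j c)) • K.D (A.1, c) f -
    if i = j then (q⁻¹ / (q + 1)) • K.D A f else 0

theorem dhat_add (f g : S) (A : Ix) : K.dhat q (f + g) A = K.dhat q f A + K.dhat q g A := by
  ext i j
  simp only [dhat, map_add, smul_add, Finset.sum_add_distrib, Matrix.of_apply, Matrix.add_apply]
  split_ifs <;> abel

theorem dhat_smul (r : ℂ) (f : S) (A : Ix) : K.dhat q (r • f) A = r • K.dhat q f A := by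
  ext i j
  simp only [dhat, map_smul, Matrix.of_apply, Matrix.smul_apply, smul_sub, Finset.smul_sum,
    smul_comm r, smul_ite, smul_zero]

theorem dhat_one (A : Ix) : K.dhat q 1 A = 0 := by
  ext i j
  simp [dhat, K.D_one]

/-- The properties of `∑ ρ_μ² |z_μ|⁻²` that make `φ⁻¹ 𝒟̂ φ` selfdual. -/
structure IsSeed (q : ℂ) (N : S) : Prop where
  diag : K.IsDiag N (q⁻¹ ^ 2)
  comm : ∀ A, N * K.D A N = K.D A N * N
  L_D : ∀ A G E, K.L G E (K.D A N) = ∑ F : Ix, (q⁻¹ ^ 2 *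
    (braidInv2 q E.1 F.1 A.1 G.1 * braidInv2 q E.2 F.2 A.2 G.2)) • K.D F N
  harm : ∀ i j, ∑ a, ∑ b, epsUp q a b • K.D (b, j) (K.D (a, i) N) = 0

variable {K}

/-- On the `q`-antisymmetric line `R̂⁻¹` acts by `-q`. Contracting the unprimed indices with `ε`
thus leaves only the primed factor of the braiding. -/
theorem braidInv2_contract (hq : q ≠ 0) (ρ : Fin 2 → Fin 2 → ℂ) (g : Ix → Ix → S) :
    ∑ a, ∑ b, epsUp q a b • ∑ E : Ix, ∑ F : Ix,
      (braidInv2 q E.1 F.1 a b * ρ E.2 F.2) • g F E =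
    -q • ∑ k, ∑ l, ρ k l • ∑ a, ∑ b, epsUp q a b • g (b, l) (a, k) := by
  simp only [Fintype.sum_prod_type, Fin.sum_univ_two, braidInv2, epsUp, epsLow, Matrix.of_apply,
    Matrix.cons_val', Matrix.cons_val_zero, Matrix.cons_val_one, Matrix.cons_val_fin_one,
    zero_smul, zero_add, add_zero, mul_zero, zero_mul, one_smul, and_true, and_false, if_true,
    if_false, Fin.isValue, one_ne_zero, zero_ne_one]
  match_scalars <;> field_simp <;> ring

/-- `dN dN = 0`. -/
theorem IsSeed.grad (hq : q ≠ 0) (hq2 : q ^ 2 + 1 ≠ 0) {N : S} (h : K.IsSeed q N) :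
    IsSD q fun A B => K.D B N * K.D A N := by
  set Q : Fin 2 → Fin 2 → S :=
    fun i j => ∑ a, ∑ b, epsUp q a b • (K.D (b, j) N * K.D (a, i) N) with hQ
  -- The derivative of `N ∂_A N = ∂_A N N`.
  have h1 : ∀ A B, q⁻¹ ^ 2 • (N * K.D B (K.D A N)) + K.D B N * K.D A N =
      ∑ E, ∑ F : Ix, (q⁻¹ ^ 2 * (braidInv2 q E.1 F.1 A.1 B.1 * braidInv2 q E.2 F.2 A.2 B.2)) •
        (K.D F N * K.D E N) + K.D B (K.D A N) * N := by
    intro A B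
    have := congrArg (K.D B) (h.comm A)
    rw [h.diag.D_mul, K.D_mul] at this
    simpa only [h.L_D, Finset.sum_mul, smul_mul_assoc] using this
  -- Contraction with `ε` removes the second derivatives by harmonicity. The factor `-q⁻¹` is `q⁻² ·
  -- (-q)`.
  have h2 : ∀ i j, Q i j = -q⁻¹ • ∑ k, ∑ l, braidInv2 q k l i j • Q k l := by
    intro i j
    have e1 : ∑ a, ∑ b, epsUp q a b • (N * K.D (b, j) (K.D (a, i) N)) = 0 := by
      simp only [← mul_smul_comm, ← Finset.mul_sum, h.harm, mul_zero]
    have e2 : ∑ a, ∑ b, epsUp q a b • (K.D (b, j) (K.D (a, i) N) * N) = 0 := by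
      simp only [← smul_mul_assoc, ← Finset.sum_mul, h.harm, zero_mul]
    have h5 : ∑ a, ∑ b, epsUp q a b • (q⁻¹ ^ 2 • (N * K.D (b, j) (K.D (a, i) N)) +
        K.D (b, j) N * K.D (a, i) N) = _ :=
      Finset.sum_congr rfl fun a _ => Finset.sum_congr rfl fun b _ => by rw [h1 (a, i) (b, j)]
    simp only [smul_add, Finset.sum_add_distrib, e2, smul_comm _ (q⁻¹ ^ 2), mul_smul (q⁻¹ ^ 2),
      ← Finset.smul_sum, e1, smul_zero, zero_add, add_zero] at h5
    rw [braidInv2_contract hq (fun k l => braidInv2 q k l i j), smul_smul] at h5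
    rw [hQ]
    simp only [h5]
    congr 1
    field_simp
  -- On the symmetric part `R̂⁻¹ = q⁻¹`, so `h2` reads `Q_s = -q⁻² Q_s`. As `q² + 1 ≠ 0`, only the
  -- `ε`-part of `Q` is left.
  have h3 : ∀ i j, (q ^ 2 + 1) • Q i j = epsLow q i j • (-q • ∑ k, ∑ l, epsUp q k l • Q k l) := by
    intro i j
    have e : ∑ k, ∑ l, braidInv2 q k l i j • Q k l =
        q⁻¹ • Q i j + epsLow q i j • ∑ k, ∑ l, epsUp q k l • Q k l := by
      simp only [braidInv2, add_smul, Finset.sum_add_distrib, ite_smul, zero_smul, ite_and,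
        Finset.smul_sum, smul_smul, mul_comm (epsLow q i j)]
      congr 1
      simp
    have h4 := congrArg (q ^ 2 • ·) (h2 i j)
    simp only [e] at h4
    rw [add_smul, h4]
    match_scalars <;> field_simp
    all_goals ring
  refine ⟨(q ^ 2 + 1)⁻¹ • (-q • ∑ k, ∑ l, epsUp q k l • Q k l), fun i j => ?_⟩
  rw [smul_comm, ← h3 i j, smul_smul, inv_mul_cancel₀ hq2, one_smul]

/-- The coefficients of the selfdual contraction of `dN 𝒟̂N`. -/
def quadCoef (q : ℂ) (i j c d : Fin 2) : ℂ :=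
  (if j = d then q * epsUp q i c else 0) - if i = j then q⁻¹ / (q + 1) * epsLow q c d else 0

/-- The finite check that makes the quadratic terms selfdual. The coefficient `q⁻¹/(q+1)` of `d` in
`𝒟̂` enters here. -/
theorem quadCoef_sum (hq : q ≠ 0) (hq1 : q + 1 ≠ 0) (i j c d : Fin 2) :
    q⁻¹ ^ 2 * quadCoef q i j c d + ∑ k, ∑ e, ∑ f,
      (∑ g, (q * (epsUp q i c * epsUp q k g)) * (-q⁻¹ * braidInv2 q e f g d) -
        if i = k then (q⁻¹ / (q + 1)) * (-q⁻¹ * braidInv2 q e f c d) else 0) *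
          quadCoef q k j e f =
    epsLow q c d * (q⁻¹ ^ 2 * quadCoef q i j 0 1 + ∑ k, ∑ e, ∑ f,
      (∑ g, (q * (epsUp q i 0 * epsUp q k g)) * (-q⁻¹ * braidInv2 q e f g 1) -
        if i = k then (q⁻¹ / (q + 1)) * (-q⁻¹ * braidInv2 q e f 0 1) else 0) *
          quadCoef q k j e f) := by
  simp only [quadCoef, braidInv2, epsUp, epsLow, Fin.sum_univ_two]
  fin_cases i <;> fin_cases j <;> fin_cases c <;> fin_cases d <;> simp <;> field_simp <;> ring

/-- `𝒟̂N` is linear in `∂N`, so the one element `k` of the gradient identity also governs the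
contraction of `∂N 𝒟̂N`. -/
theorem IsSeed.sum_D_dhat (hq : q ≠ 0) {N k : S}
    (hk : ∀ i j, ∑ a, ∑ b, epsUp q a b • (K.D (b, j) N * K.D (a, i) N) = epsLow q i j • k)
    (i j c d : Fin 2) :
    ∑ a, ∑ b, epsUp q a b • (K.D (b, d) N * K.dhat q N (a, c) i j) = quadCoef q i j c d • k := by
  have h1 : ∑ a, ∑ b, epsUp q a b • (K.D (b, d) N * K.dhat q N (a, c) i j) =
      ∑ e, (q * (epsUp q i c * epsUp q j e)) •
        ∑ a, ∑ b, epsUp q a b • (K.D (b, d) N * K.D (a, e) N) -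
      if i = j then (q⁻¹ / (q + 1)) •
        ∑ a, ∑ b, epsUp q a b • (K.D (b, d) N * K.D (a, c) N) else 0 := by
    simp only [dhat, Matrix.of_apply, Fin.sum_univ_two, mul_sub, mul_add]
    split_ifs <;> simp only [mul_smul_comm, mul_zero] <;> module
  have h2 : ∑ e, epsUp q j e * epsLow q e d = if j = d then 1 else 0 := by
    fin_cases j <;> fin_cases d <;> simp [epsUp, epsLow, hq]
  have h3 : ∑ e, q * (epsUp q i c * epsUp q j e) * epsLow q e d =
      if j = d then q * epsUp q i c else 0 := by
    rw [← mul_one (q * epsUp q i c), ← mul_zero (q * epsUp q i c), ← mul_ite, ← h2,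
      Finset.mul_sum]
    exact Finset.sum_congr rfl fun e _ => by ring
  rw [h1]
  simp only [hk, smul_smul, ← Finset.sum_smul, h3, quadCoef, sub_smul]
  split_ifs <;> simp

/-- The unprimed half of the inverse braiding contracts to `-q`; combined with `q⁻²` this leaves
`-q⁻¹` times the primed half. -/
theorem IsSeed.sum_L_D (hq : q ≠ 0) {N : S} (h : K.IsSeed q N) (c d : Fin 2) (E : Ix) :
    ∑ a, ∑ b, epsUp q a b • K.L (b, d) E (K.D (a, c) N) =
      ∑ f, (-q⁻¹ * braidInv2 q E.2 f c d) • ∑ e, epsUp q E.1 e • K.D (e, f) N := by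
  have h1 : ∀ x y, ∑ a, ∑ b, epsUp q a b * braidInv2 q x y a b = -q * epsUp q x y := by
    intro x y
    fin_cases x <;> fin_cases y <;> simp [braidInv2, epsUp, epsLow] <;> field_simp
  simp only [h.L_D, Fintype.sum_prod_type, Finset.smul_sum, smul_smul]
  rw [sum_comm_pairs]
  rw [Finset.sum_comm]
  refine Finset.sum_congr rfl fun f _ => Finset.sum_congr rfl fun e _ => ?_
  simp only [← Finset.sum_smul]
  congr 1
  calc _ = (∑ a, ∑ b, epsUp q a b * braidInv2 q E.1 e a b) *
        (q⁻¹ ^ 2 * braidInv2 q E.2 f c d) := by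
        simp only [Finset.sum_mul]
        exact Finset.sum_congr rfl fun a _ => Finset.sum_congr rfl fun b _ => by ring
    _ = _ := by
        rw [h1]
        field_simp

/-- The quadratic part of the field strength. -/
theorem IsSeed.quad (hq : q ≠ 0) (hq1 : q + 1 ≠ 0) (hq2 : q ^ 2 + 1 ≠ 0) {N : S}
    (h : K.IsSeed q N) (i j : Fin 2) :
    IsSD q fun A B => q⁻¹ ^ 2 • (K.D B N * K.dhat q N A i j) +
      ∑ k, ∑ E, K.L B E (K.dhat q N A i k) * K.dhat q N E k j := by
  obtain ⟨k, hk⟩ := h.grad hq hq2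
  have h2 := IsSeed.sum_D_dhat hq hk
  have h3 : ∀ c d l E, ∑ a, ∑ b, epsUp q a b • K.L (b, d) E (K.dhat q N (a, c) i l) =
      ∑ f, (∑ g, (q * (epsUp q i c * epsUp q l g)) * (-q⁻¹ * braidInv2 q E.2 f g d) -
        if i = l then (q⁻¹ / (q + 1)) * (-q⁻¹ * braidInv2 q E.2 f c d) else 0) •
          ∑ e, epsUp q E.1 e • K.D (e, f) N := by
    intro c d l E
    have h4 : ∑ a, ∑ b, epsUp q a b • K.L (b, d) E (K.dhat q N (a, c) i l) =
        ∑ g, (q * (epsUp q i c * epsUp q l g)) •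
          ∑ a, ∑ b, epsUp q a b • K.L (b, d) E (K.D (a, g) N) -
        if i = l then (q⁻¹ / (q + 1)) •
          ∑ a, ∑ b, epsUp q a b • K.L (b, d) E (K.D (a, c) N) else 0 := by
      simp only [dhat, Matrix.of_apply, Fin.sum_univ_two, map_sub, map_add, map_smul]
      split_ifs <;> simp only [map_smul, map_zero] <;> module
    rw [h4]
    simp only [h.sum_L_D hq]
    simp only [Fin.sum_univ_two]
    split_ifs <;> module
  refine ⟨(q⁻¹ ^ 2 * quadCoef q i j 0 1 + ∑ k, ∑ e, ∑ f,
      (∑ g, (q * (epsUp q i 0 * epsUp q k g)) * (-q⁻¹ * braidInv2 q e f g 1) -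
        if i = k then (q⁻¹ / (q + 1)) * (-q⁻¹ * braidInv2 q e f 0 1) else 0) *
          quadCoef q k j e f) • k, fun c d => ?_⟩
  rw [smul_smul, ← quadCoef_sum hq hq1, add_smul, mul_smul, ← h2]
  simp only [smul_add, Finset.sum_add_distrib]
  congr 1
  · simp only [Finset.smul_sum, smul_comm (q⁻¹ ^ 2)]
  · calc _ = ∑ l, ∑ E, (∑ a, ∑ b, epsUp q a b • K.L (b, d) E (K.dhat q N (a, c) i l)) *
          K.dhat q N E l j := by
          simp only [Finset.smul_sum, Finset.sum_mul, smul_mul_assoc]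
          exact sum_comm_pairs _
      _ = _ := by
          simp only [h3]
          simp only [Finset.sum_smul, mul_smul, ← h2]
          refine Finset.sum_congr rfl fun l _ => ?_
          rw [Fintype.sum_prod_type_right]
          refine Finset.sum_congr rfl fun e' _ => ?_
          simp only [Finset.sum_mul, Finset.smul_sum, smul_mul_assoc]
          rw [Finset.sum_comm]

end Calculus

end QInst
end

/-! ### Inverses of `1 + bN` and the curvature of the singular potential -/

noncomputable section
namespace QInst

namespace Calculus

variable {q : ℂ} {S : Type*} [Ring S] [Algebra ℂ S] {K : Calculus S} {N : S} {p : ℂ → S}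

theorem IsSeed.L_one_add (h : K.IsSeed q N) (b : ℂ) (A B : Ix) :
    K.L A B (1 + b • N) = if A = B then 1 + (b * q⁻¹ ^ 2) • N else 0 := by
  rw [map_add, map_smul, K.L_one, h.diag A B]
  split_ifs <;> simp [smul_smul]

/-- Passing `ξ` rescales `N` by `q⁻²`, which amounts to rescaling `b`. This is why a whole family of
inverses is needed. -/
theorem IsSeed.L_inv (h : K.IsSeed q N) (hl : ∀ b, p b * (1 + b • N) = 1)
    (hr : ∀ b, (1 + b • N) * p b = 1) (b : ℂ) (A B : Ix) :
    K.L A B (p b) = if A = B then p (b * q⁻¹ ^ 2) else 0 := by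
  have h1 := K.L_mul A B (1 + b • N) (p b)
  simp only [hr, K.L_one, h.L_one_add, ite_mul, zero_mul, Finset.sum_ite_eq, Finset.mem_univ,
    if_true] at h1
  rw [← one_mul (K.L A B (p b)), ← hl (b * q⁻¹ ^ 2), mul_assoc, ← h1]
  split_ifs <;> simp

theorem IsSeed.L_inv_mul (h : K.IsSeed q N) (hl : ∀ b, p b * (1 + b • N) = 1)
    (hr : ∀ b, (1 + b • N) * p b = 1) (b : ℂ) (A B : Ix) (f : S) :
    K.L A B (p b * f) = p (b * q⁻¹ ^ 2) * K.L A B f := by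
  simp [K.L_mul, h.L_inv hl hr, ite_mul]

theorem IsSeed.D_inv (h : K.IsSeed q N) (hl : ∀ b, p b * (1 + b • N) = 1)
    (hr : ∀ b, (1 + b • N) * p b = 1) (b : ℂ) (A : Ix) :
    K.D A (p b) = -(b • (p (b * q⁻¹ ^ 2) * K.D A N * p b)) := by
  have h1 := K.D_mul A (1 + b • N) (p b)
  simp only [hr, D_one, h.L_one_add, ite_mul, zero_mul, Finset.sum_ite_eq, Finset.mem_univ,
    if_true, map_add, map_smul, zero_add] at h1
  rw [← one_mul (K.D A (p b)), ← hl (b * q⁻¹ ^ 2), mul_assoc, eq_neg_of_add_eq_zero_left h1.symm]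
  simp only [mul_neg, smul_mul_assoc, mul_smul_comm, mul_assoc]

theorem IsSeed.D_inv_mul (h : K.IsSeed q N) (hl : ∀ b, p b * (1 + b • N) = 1)
    (hr : ∀ b, (1 + b • N) * p b = 1) (b : ℂ) (A : Ix) (f : S) :
    K.D A (p b * f) = p (b * q⁻¹ ^ 2) * K.D A f -
      b • (p (b * q⁻¹ ^ 2) * K.D A N * p b * f) := by
  simp [K.D_mul, h.L_inv hl hr, h.D_inv hl hr, ite_mul, sub_eq_add_neg, mul_assoc]

theorem commute_inv {S : Type*} [Ring S] {x r s : S} (h1 : r * s = 1) (h2 : s * r = 1) (h : Commute x s) :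
    Commute x r :=
  calc x * r = r * (s * x) * r := by rw [← mul_assoc, h1, one_mul]
    _ = r * x := by rw [← h.eq, mul_assoc, mul_assoc, h2, mul_one]

theorem IsSeed.commute_inv (h : K.IsSeed q N) (hl : ∀ b, p b * (1 + b • N) = 1)
    (hr : ∀ b, (1 + b • N) * p b = 1) (b : ℂ) (A : Ix) : Commute (K.D A N) (p b) :=
  Calculus.commute_inv (hl b) (hr b)
    ((Commute.one_right _).add_right (Commute.smul_right (h.comm A).symm b))

theorem IsSeed.commute_L_dhat (h : K.IsSeed q N) (hl : ∀ b, p b * (1 + b • N) = 1)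
    (hr : ∀ b, (1 + b • N) * p b = 1) (b : ℂ) (A E F : Ix) (i j : Fin 2) :
    Commute (K.L E F (K.dhat q N A i j)) (p b) := by
  have h1 : ∀ A, Commute (K.L E F (K.D A N)) (p b) := fun A => by
    rw [h.L_D]
    exact Commute.sum_left _ _ _ fun G _ => (h.commute_inv hl hr b G).smul_left _
  simp only [dhat, Matrix.of_apply, map_sub, map_sum, map_smul]
  refine Commute.sub_left (Commute.sum_left _ _ _ fun G _ => (h1 _).smul_left _) ?_
  split_ifs
  · rw [map_smul]
    exact (h1 _).smul_left _
  · simp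

/-- Harmonicity of a seed holds for all primed indices separately, so it passes to the linear
combination `𝒟̂N` of first derivatives. -/
theorem IsSeed.harm_dhat (h : K.IsSeed q N) (i j c d : Fin 2) :
    ∑ a, ∑ b, epsUp q a b • K.D (b, d) (K.dhat q N (a, c) i j) = 0 := by
  have h1 : ∑ a, ∑ b, epsUp q a b • K.D (b, d) (K.dhat q N (a, c) i j) =
      ∑ e, (q * (epsUp q i c * epsUp q j e)) •
        ∑ a, ∑ b, epsUp q a b • K.D (b, d) (K.D (a, e) N) -
      if i = j then (q⁻¹ / (q + 1)) •
        ∑ a, ∑ b, epsUp q a b • K.D (b, d) (K.D (a, c) N) else 0 := by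
    simp only [dhat, Matrix.of_apply, Fin.sum_univ_two, map_sub, map_add, map_smul]
    split_ifs <;> simp only [map_smul, map_zero] <;> module
  rw [h1]
  simp only [h.harm, smul_zero, Finset.sum_const_zero, ite_self, sub_zero]

/-- The potential `φ⁻¹ 𝒟̂ φ` is selfdual. -/
theorem IsSeed.isSD_curv (hq : q ≠ 0) (hq1 : q + 1 ≠ 0) (hq2 : q ^ 2 + 1 ≠ 0)
    (h : K.IsSeed q N) (hl : ∀ b, p b * (1 + b • N) = 1)
    (hr : ∀ b, (1 + b • N) * p b = 1) (c : ℂ) {ω : Ix → Matrix (Fin 2) (Fin 2) S}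
    (hω : ∀ A i j, ω A i j = c • (p (c * q⁻¹ ^ 2) * K.dhat q N A i j)) :
    IsSD q (K.matrix.curv ω) := by
  rw [isSD_matrix_iff]
  intro i j
  set c' := c * q⁻¹ ^ 2 with hc'
  set c'' := c' * q⁻¹ ^ 2 with hc''
  have h1 : IsSD q fun A B => K.D B (K.dhat q N A i j) :=
    ⟨0, fun a b => by rw [h.harm_dhat, smul_zero]⟩
  -- The curvature is `-c p(c'') ∂𝒟̂N + c² p(c'') p(c') (q⁻² ∂N 𝒟̂N + 𝒟̂N 𝒟̂N)`. The factor `q⁻²`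
  -- comes from `c c' = c² q⁻²`, and the inverses can be collected in front because they commute
  -- with `∂N`.
  have h2 := ((h1.mul_left (p c'')).smul (-c)).add
    (((h.quad hq hq1 hq2 i j).mul_left (p c'' * p c')).smul (c ^ 2))
  convert h2 using 3 with A B
  simp only [curv, Matrix.add_apply, Matrix.neg_apply, Matrix.sum_apply, Matrix.mul_apply, matrix_L,
    matrix_D, hω, map_smul, h.L_inv_mul hl hr, h.D_inv_mul hl hr, ← hc'']
  have e1 : p c'' * K.D B N * p c' * K.dhat q N A i j =
      p c'' * p c' * (K.D B N * K.dhat q N A i j) := by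
    rw [mul_assoc (p c''), (h.commute_inv hl hr c' B).eq]
    simp only [mul_assoc]
  have e2 : ∀ E k, c • (p c'' * K.L B E (K.dhat q N A i k)) * c • (p c' * K.dhat q N E k j) =
      c ^ 2 • (p c'' * p c' * (K.L B E (K.dhat q N A i k) * K.dhat q N E k j)) := by
    intro E k
    rw [smul_mul_smul_comm, ← pow_two, mul_assoc (p c''), ← mul_assoc _ (p c'),
      (h.commute_L_dhat hl hr c' A B E i k).eq]
    simp only [mul_assoc]
  simp only [e1, e2]
  rw [Finset.sum_comm]
  simp only [mul_add, smul_add, ← Finset.smul_sum, ← Finset.mul_sum, mul_smul_comm, hc']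
  module

end Calculus

end QInst
end

noncomputable section
namespace QInst

/-! ### Quantum matrices -/

section Coordinates

variable {q : ℂ} {S : Type*} [Ring S] [Algebra ℂ S]

/-- The relations `𝖯_A z z = 0`. -/
def IsCoord (q : ℂ) (z : Matrix (Fin 2) (Fin 2) S) : Prop :=
  ∀ A B, ∑ C : Ix, ∑ D : Ix, projA q A B C D • (z C.1 C.2 * z D.1 D.2) = 0

/-- The relations `y x = R x y`. -/
def IsBraided (q : ℂ) (y x : Matrix (Fin 2) (Fin 2) S) : Prop :=
  ∀ A B : Ix, y A.1 A.2 * x B.1 B.2 = ∑ C : Ix, ∑ D : Ix, braid4 q A B C D • (x C.1 C.2 * y D.1 D.2)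

theorem IsBraided.sub {y x x' : Matrix (Fin 2) (Fin 2) S} (h : IsBraided q y x)
    (h' : IsBraided q y x') : IsBraided q y (x - x') := fun A B => by
  simp only [Matrix.sub_apply, mul_sub, sub_mul, h A B, h' A B, smul_sub, Finset.sum_sub_distrib]

/-- `R̂` is `q` on `𝒫_s` and `-q⁻¹` on `𝒫_a`, so both mixed products carry the eigenvalue `-1`. -/
theorem projA_mul_braid4 (hq : q ≠ 0) (hq2 : q ^ 2 + 1 ≠ 0) (A B C D : Ix) :
    ∑ E, ∑ F, projA q A B E F * braid4 q E F C D = -projA q A B C D := by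
  have h1 : ∀ a b c d, ∑ e, ∑ f, projAnti q a b e f * braid2 q e f c d =
      -q⁻¹ * projAnti q a b c d := by
    intro a b c d
    simp only [projAnti, braid2, Fin.sum_univ_two, epsLow, epsUp]
    fin_cases a <;> fin_cases b <;> fin_cases c <;> fin_cases d <;> simp <;> field_simp <;> ring
  have h2 : ∀ a b c d, ∑ e, ∑ f, projSym q a b e f * braid2 q e f c d =
      q * projSym q a b c d := by
    intro a b c d
    simp only [projSym, braid2, Fin.sum_univ_two, epsLow, epsUp]
    fin_cases a <;> fin_cases b <;> fin_cases c <;> fin_cases d <;> simp <;> field_simp <;> ring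
  have key : ∀ (P P' : Fin 2 → Fin 2 → Fin 2 → Fin 2 → ℂ),
      ∑ E : Ix, ∑ F : Ix, (P A.1 B.1 E.1 F.1 * P' A.2 B.2 E.2 F.2) *
        (braid2 q E.1 F.1 C.1 D.1 * braid2 q E.2 F.2 C.2 D.2) =
      (∑ e, ∑ f, P A.1 B.1 e f * braid2 q e f C.1 D.1) *
        ∑ e, ∑ f, P' A.2 B.2 e f * braid2 q e f C.2 D.2 := by
    intro P P'
    simp only [Fintype.sum_prod_type, Fin.sum_univ_two]
    ring
  simp only [projA, projSD, projASD, braid4, add_mul, Finset.sum_add_distrib, key, h1, h2]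
  field_simp
  ring

/-- The coaddition property: under `𝖯_A` the braiding turns `yx` into `-xy`, so the mixed terms of
`(x - y)(x - y)` cancel. -/
theorem IsCoord.sub (hq : q ≠ 0) (hq2 : q ^ 2 + 1 ≠ 0) {y x : Matrix (Fin 2) (Fin 2) S}
    (hx : IsCoord q x) (hy : IsCoord q y) (h : IsBraided q y x) : IsCoord q (x - y) := by
  intro A B
  have h1 : ∑ C : Ix, ∑ D : Ix, projA q A B C D • (y C.1 C.2 * x D.1 D.2) =
      -∑ C : Ix, ∑ D : Ix, projA q A B C D • (x C.1 C.2 * y D.1 D.2) := by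
    simp only [h _ _, Finset.smul_sum, smul_smul]
    rw [sum_comm_pairs]
    simp only [← Finset.sum_smul, projA_mul_braid4 hq hq2, neg_smul, Finset.sum_neg_distrib]
  simp only [Matrix.sub_apply, mul_sub, sub_mul, smul_sub, Finset.sum_sub_distrib, hx A B, hy A B,
    h1]
  abel

theorem IsCoord.relations (hq : q ≠ 0) (hq2 : q ^ 2 + 1 ≠ 0) {z : Matrix (Fin 2) (Fin 2) S}
    (h : IsCoord q z) : z 0 0 * z 0 1 = q • (z 0 1 * z 0 0) ∧
      z 0 0 * z 1 0 = q • (z 1 0 * z 0 0) ∧ z 0 1 * z 1 1 = q • (z 1 1 * z 0 1) ∧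
      z 1 0 * z 1 1 = q • (z 1 1 * z 1 0) ∧ z 1 0 * z 0 1 = z 0 1 * z 1 0 ∧
      z 1 1 * z 0 0 = z 0 0 * z 1 1 - (q - q⁻¹) • (z 0 1 * z 1 0) := by
  have e1 := h (0, 0) (0, 1)
  have e2 := h (0, 0) (1, 0)
  have e3 := h (0, 1) (1, 1)
  have e4 := h (1, 0) (1, 1)
  have e5 := h (0, 0) (1, 1)
  have e6 := h (0, 1) (1, 0)
  simp only [Fintype.sum_prod_type, Fin.sum_univ_two, projA, projSD, projASD, projSym, projAnti,
    epsUp, epsLow, Matrix.of_apply, Matrix.cons_val', Matrix.cons_val_zero, Matrix.cons_val_one,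
    Matrix.cons_val_fin_one, zero_smul, zero_add, add_zero, mul_zero, zero_mul, and_true,
    and_false, if_true, if_false, Fin.isValue, one_ne_zero, zero_ne_one, neg_zero,
    zero_div, mul_one, one_mul] at e1 e2 e3 e4 e5 e6
  refine ⟨?_, ?_, ?_, ?_, ?_, ?_⟩
  · linear_combination (norm := skip) (q ^ 2 + 1) • e1
    match_scalars <;> field_simp <;> ring
  · linear_combination (norm := skip) (q ^ 2 + 1) • e2
    match_scalars <;> field_simp <;> ring
  · linear_combination (norm := skip) (q ^ 2 + 1) • e3
    match_scalars <;> field_simp <;> ring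
  · linear_combination (norm := skip) (q ^ 2 + 1) • e4
    match_scalars <;> field_simp <;> ring
  · linear_combination (norm := skip) (-2 : ℂ) • e6 - (q - q⁻¹) • e5
    match_scalars <;> field_simp <;> ring
  · linear_combination (norm := skip) (-2 : ℂ) • e5 + (q - q⁻¹) • e6
    match_scalars <;> field_simp <;> ring

theorem qbar_apply (z : Matrix (Fin 2) (Fin 2) S) (hq : q ≠ 0) :
    qbar q z = !![z 1 1, -(q⁻¹ • z 0 1); -(q • z 1 0), z 0 0] := by
  ext i j
  fin_cases i <;> fin_cases j <;>
    simp [qbar, Fin.sum_univ_two, epsUp, epsLow, hq]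

/-- `z̄` is the `q`-adjugate of a quantum matrix. -/
theorem IsCoord.mul_qbar (hq : q ≠ 0) (hq2 : q ^ 2 + 1 ≠ 0) {z : Matrix (Fin 2) (Fin 2) S}
    (h : IsCoord q z) : z * qbar q z = Matrix.scalar (Fin 2) (qdet q z) := by
  obtain ⟨r1, r2, r3, r4, r5, r6⟩ := h.relations hq hq2
  rw [qbar_apply z hq]
  ext i j
  fin_cases i <;> fin_cases j <;>
    simp [Matrix.mul_apply, Fin.sum_univ_two, qdet, r1, r4, r5, r6, hq, smul_smul]
  · abel
  · match_scalars <;> field_simp <;> ring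

theorem IsCoord.qbar_mul (hq : q ≠ 0) (hq2 : q ^ 2 + 1 ≠ 0) {z : Matrix (Fin 2) (Fin 2) S}
    (h : IsCoord q z) : qbar q z * z = Matrix.scalar (Fin 2) (qdet q z) := by
  obtain ⟨r1, r2, r3, r4, r5, r6⟩ := h.relations hq hq2
  rw [qbar_apply z hq]
  ext i j
  fin_cases i <;> fin_cases j <;>
    simp [Matrix.mul_apply, Fin.sum_univ_two, qdet, r2, r3, r5, r6, hq, smul_smul]
  · match_scalars <;> field_simp <;> ring
  · abel

/-- The determinant is central. -/
theorem IsCoord.commute_qdet (hq : q ≠ 0) (hq2 : q ^ 2 + 1 ≠ 0)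
    {z : Matrix (Fin 2) (Fin 2) S} (h : IsCoord q z) (i j : Fin 2) :
    Commute (qdet q z) (z i j) := by
  -- Bracket `z z̄ z` in the two possible ways.
  have h1 : Matrix.scalar (Fin 2) (qdet q z) * z = z * Matrix.scalar (Fin 2) (qdet q z) := by
    rw [← h.mul_qbar hq hq2, mul_assoc, h.qbar_mul hq hq2, h.mul_qbar hq hq2]
  simpa [Matrix.scalar_apply, commute_iff_eq] using congrFun (congrFun h1 i) j

/-- `∑ ε_{AB} z^A z^B`. -/
theorem IsCoord.sum_eps (hq : q ≠ 0) (hq2 : q ^ 2 + 1 ≠ 0)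
    {z : Matrix (Fin 2) (Fin 2) S} (h : IsCoord q z) :
    ∑ A : Ix, ∑ B : Ix, (epsLow q A.1 B.1 * epsLow q A.2 B.2) • (z A.1 A.2 * z B.1 B.2) =
      (q ^ 2 + 1) • qdet q z := by
  obtain ⟨r1, r2, r3, r4, r5, r6⟩ := h.relations hq hq2
  simp [Fintype.sum_prod_type, Fin.sum_univ_two, epsLow, qdet, r5, r6]
  match_scalars <;> field_simp <;> ring

/-- A strand crosses a pair contracted with `ε` at the cost of a factor `q`. Both spinor factors
together give the `q²` in the commutation of vectors with norms. -/
theorem eps_braid2_braid2 (hq : q ≠ 0) (a d f g : Fin 2) :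
    ∑ b, ∑ c, ∑ e, epsLow q b c * (braid2 q a b d e * braid2 q e c f g) =
      if a = g then q * epsLow q d f else 0 := by
  simp only [braid2, Fin.sum_univ_two, epsLow, epsUp]
  fin_cases a <;> fin_cases d <;> fin_cases f <;> fin_cases g <;> simp <;> field_simp

theorem eps_braid2_braid2' (hq : q ≠ 0) (b f g e : Fin 2) :
    ∑ a, ∑ c, ∑ d, epsLow q a c * (braid2 q a d f g * braid2 q c b d e) =
      if b = f then q * epsLow q g e else 0 := by
  simp only [braid2, Fin.sum_univ_two, epsLow, epsUp]
  fin_cases b <;> fin_cases f <;> fin_cases g <;> fin_cases e <;> simp [hq] <;> field_simp <;>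
    ring

theorem eps_braid4_braid4 (hq : q ≠ 0) (A D F G : Ix) :
    ∑ B : Ix, ∑ C : Ix, ∑ E : Ix, (epsLow q B.1 C.1 * epsLow q B.2 C.2) *
      (braid4 q A B D E * braid4 q E C F G) =
      if A = G then q ^ 2 * (epsLow q D.1 F.1 * epsLow q D.2 F.2) else 0 := by
  have h : ∑ B : Ix, ∑ C : Ix, ∑ E : Ix, (epsLow q B.1 C.1 * epsLow q B.2 C.2) *
      (braid4 q A B D E * braid4 q E C F G) =
      (∑ b, ∑ c, ∑ e, epsLow q b c * (braid2 q A.1 b D.1 e * braid2 q e c F.1 G.1)) *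
      ∑ b, ∑ c, ∑ e, epsLow q b c * (braid2 q A.2 b D.2 e * braid2 q e c F.2 G.2) := by
    simp only [Fintype.sum_prod_type, Fin.sum_univ_two, braid4]
    ring
  rw [h, eps_braid2_braid2 hq, eps_braid2_braid2 hq]
  simp only [Prod.ext_iff]
  split_ifs <;> simp_all
  ring

theorem eps_braid4_braid4' (hq : q ≠ 0) (B F G E : Ix) :
    ∑ A : Ix, ∑ C : Ix, ∑ D : Ix, (epsLow q A.1 C.1 * epsLow q A.2 C.2) *
      (braid4 q A D F G * braid4 q C B D E) =
      if B = F then q ^ 2 * (epsLow q G.1 E.1 * epsLow q G.2 E.2) else 0 := by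
  have h : ∑ A : Ix, ∑ C : Ix, ∑ D : Ix, (epsLow q A.1 C.1 * epsLow q A.2 C.2) *
      (braid4 q A D F G * braid4 q C B D E) =
      (∑ a, ∑ c, ∑ d, epsLow q a c * (braid2 q a d F.1 G.1 * braid2 q c B.1 d E.1)) *
      ∑ a, ∑ c, ∑ d, epsLow q a c * (braid2 q a d F.2 G.2 * braid2 q c B.2 d E.2) := by
    simp only [Fintype.sum_prod_type, Fin.sum_univ_two, braid4]
    ring
  rw [h, eps_braid2_braid2' hq, eps_braid2_braid2' hq]
  simp only [Prod.ext_iff]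
  split_ifs <;> simp_all
  ring

theorem sum_smul_sum_triple (r : Ix → Ix → ℂ) (t : Ix → Ix → Ix → Ix → Ix → ℂ)
    (X : Ix → Ix → Ix → S) :
    ∑ B, ∑ C, r B C • ∑ D, ∑ F, ∑ G, t B C D F G • X D F G =
      ∑ D, ∑ F, ∑ G, (∑ B, ∑ C, r B C * t B C D F G) • X D F G := by
  simp only [Finset.smul_sum, smul_smul, Finset.sum_smul]
  rw [sum_comm_pairs]
  refine Finset.sum_congr rfl fun D _ => Finset.sum_congr rfl fun F _ => ?_
  exact (Finset.sum_congr rfl fun B _ => Finset.sum_comm).trans Finset.sum_comm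

theorem sum_smul_sum_pair {ι κ : Type*} [Fintype ι] [Fintype κ] (r : ι → ι → ℂ)
    (t : ι → ι → κ → κ → ℂ) (X : κ → κ → S) :
    ∑ B, ∑ C, r B C • ∑ D, ∑ F, t B C D F • X D F =
      ∑ D, ∑ F, (∑ B, ∑ C, r B C * t B C D F) • X D F := by
  simp only [Finset.smul_sum, smul_smul, Finset.sum_smul]
  rw [sum_comm_pairs]

/-- `y |x|² = q² |x|² y`. -/
theorem IsBraided.mul_qdet (hq : q ≠ 0) (hq2 : q ^ 2 + 1 ≠ 0) {y x : Matrix (Fin 2) (Fin 2) S}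
    (hx : IsCoord q x) (h : IsBraided q y x) (i j : Fin 2) :
    y i j * qdet q x = q ^ 2 • (qdet q x * y i j) := by
  have h1 : ∀ A B C : Ix, y A.1 A.2 * (x B.1 B.2 * x C.1 C.2) =
      ∑ D : Ix, ∑ F : Ix, ∑ G : Ix, (∑ E, braid4 q A B D E * braid4 q E C F G) •
        (x D.1 D.2 * x F.1 F.2 * y G.1 G.2) := by
    intro A B C
    rw [← mul_assoc, h A B]
    simp only [Finset.sum_mul, smul_mul_assoc, mul_assoc, h _ C, Finset.mul_sum, mul_smul_comm,
      Finset.smul_sum, smul_smul, Finset.sum_smul]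
    refine Finset.sum_congr rfl fun D _ => ?_
    rw [Finset.sum_comm]
    refine Finset.sum_congr rfl fun F _ => ?_
    rw [Finset.sum_comm]
  have h2 := congrArg (y i j * ·) (hx.sum_eps hq hq2)
  have h3 : ∑ D : Ix, ∑ F : Ix, (q ^ 2 * (epsLow q D.1 F.1 * epsLow q D.2 F.2)) •
      (x D.1 D.2 * x F.1 F.2 * y i j) = (q ^ 2 + 1) • q ^ 2 • (qdet q x * y i j) := by
    rw [smul_comm, ← smul_mul_assoc (q ^ 2 + 1), ← hx.sum_eps hq hq2]
    simp only [Finset.sum_mul, Finset.smul_sum, smul_mul_assoc, smul_smul]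
  simp only [Finset.mul_sum, mul_smul_comm, h1 (i, j)] at h2
  rw [sum_smul_sum_triple] at h2
  simp only [Finset.mul_sum, eps_braid4_braid4 hq, ite_smul, zero_smul] at h2
  simp only [Finset.sum_ite_eq, Finset.mem_univ, if_true, h3] at h2
  exact (smul_right_injective S hq2 h2).symm

/-- `|y|² x = q² x |y|²`. -/
theorem IsBraided.qdet_mul (hq : q ≠ 0) (hq2 : q ^ 2 + 1 ≠ 0) {y x : Matrix (Fin 2) (Fin 2) S}
    (hy : IsCoord q y) (h : IsBraided q y x) (i j : Fin 2) :
    qdet q y * x i j = q ^ 2 • (x i j * qdet q y) := by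
  have h1 : ∀ A C B : Ix, y A.1 A.2 * y C.1 C.2 * x B.1 B.2 =
      ∑ G : Ix, ∑ E : Ix, ∑ F : Ix, (∑ D, braid4 q A D F G * braid4 q C B D E) •
        (x F.1 F.2 * (y G.1 G.2 * y E.1 E.2)) := by
    intro A C B
    rw [mul_assoc, h C B]
    simp only [Finset.mul_sum, mul_smul_comm, ← mul_assoc, h A, Finset.sum_mul, smul_mul_assoc,
      Finset.smul_sum, smul_smul, Finset.sum_smul]
    rw [sum_comm_pairs, Finset.sum_comm]
    refine Finset.sum_congr rfl fun G _ => ?_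
    rw [Finset.sum_congr rfl fun F _ => Finset.sum_comm, Finset.sum_comm]
    exact Finset.sum_congr rfl fun E _ => Finset.sum_congr rfl fun F _ =>
      Finset.sum_congr rfl fun D _ => by rw [mul_comm]
  have h2 := congrArg (· * x i j) (hy.sum_eps hq hq2)
  have h3 : ∑ G : Ix, ∑ E : Ix, (q ^ 2 * (epsLow q G.1 E.1 * epsLow q G.2 E.2)) •
      (x i j * (y G.1 G.2 * y E.1 E.2)) = (q ^ 2 + 1) • q ^ 2 • (x i j * qdet q y) := by
    rw [smul_comm, ← mul_smul_comm (q ^ 2 + 1), ← hy.sum_eps hq hq2]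
    simp only [Finset.mul_sum, Finset.smul_sum, mul_smul_comm, smul_smul]
  simp only [Finset.sum_mul, smul_mul_assoc, h1 _ _ (i, j)] at h2
  rw [sum_smul_sum_triple] at h2
  simp only [Finset.mul_sum, eps_braid4_braid4' hq, ite_smul, zero_smul] at h2
  simp only [Finset.sum_ite_eq, Finset.mem_univ, if_true, h3] at h2
  exact (smul_right_injective S hq2 h2).symm

end Coordinates

end QInst
end

/-! ### Derivatives and commutation rules of vectors and their norms -/

noncomputable section
namespace QInst

namespace Calculus

variable {q : ℂ} {S : Type*} [Ring S] [Algebra ℂ S] {K : Calculus S}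

/-- The coordinates with lowered index, `ε_{AB} z^B`. -/
def low (q : ℂ) (z : Matrix (Fin 2) (Fin 2) S) (A : Ix) : S :=
  ∑ F : Ix, (epsLow q A.1 F.1 * epsLow q A.2 F.2) • z F.1 F.2

variable (K)

/-- `y ξ = R ξ y`. -/
def IsVec (q : ℂ) (y : Matrix (Fin 2) (Fin 2) S) : Prop :=
  ∀ A B C : Ix, K.L A B (y C.1 C.2) = ∑ D : Ix, braid4 q C B A D • y D.1 D.2

/-- `dz^A = ξ^A`. -/
def IsDual (z : Matrix (Fin 2) (Fin 2) S) : Prop :=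
  ∀ A C : Ix, K.D A (z C.1 C.2) = if A = C then 1 else 0

variable {K}

theorem IsVec.sub {x y : Matrix (Fin 2) (Fin 2) S} (hx : K.IsVec q x) (hy : K.IsVec q y) :
    K.IsVec q (x - y) := fun A B C => by
  simp only [Matrix.sub_apply, map_sub, hx A B C, hy A B C, smul_sub, Finset.sum_sub_distrib]

/-- `d|z|² = q⁻² ξ^A ε_{AB} z^B`. -/
theorem D_qdet (hq : q ≠ 0) (hq2 : q ^ 2 + 1 ≠ 0) {z : Matrix (Fin 2) (Fin 2) S}
    (hz : IsCoord q z) (h : K.IsVec q z) (hd : K.IsDual z) (A : Ix) :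
    K.D A (qdet q z) = q⁻¹ ^ 2 • low q z A := by
  -- The metric is an eigenvector of `R̂ ⊗ R̂` with eigenvalue `(-q⁻¹)² = q⁻²`. Leibniz applied to
  -- `(q² + 1)|z|² = ε z z` therefore gives the factor `1 + q⁻²`.
  have h0 : ∀ c d, ∑ a, ∑ b, epsLow q a b * braid2 q a b c d = -q⁻¹ * epsLow q c d := by
    intro c d
    simp only [braid2, Fin.sum_univ_two, epsLow, epsUp]
    fin_cases c <;> fin_cases d <;> simp
  have h1 : ∀ F : Ix, ∑ C : Ix, ∑ D : Ix,
      (epsLow q C.1 D.1 * epsLow q C.2 D.2) * braid4 q C D A F =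
      q⁻¹ ^ 2 * (epsLow q A.1 F.1 * epsLow q A.2 F.2) := by
    intro F
    have : ∑ C : Ix, ∑ D : Ix, (epsLow q C.1 D.1 * epsLow q C.2 D.2) * braid4 q C D A F =
        (∑ a, ∑ b, epsLow q a b * braid2 q a b A.1 F.1) *
          ∑ a, ∑ b, epsLow q a b * braid2 q a b A.2 F.2 := by
      simp only [Fintype.sum_prod_type, Fin.sum_univ_two, braid4]
      ring
    rw [this, h0, h0]
    ring
  have h2 := congrArg (K.D A) (hz.sum_eps hq hq2)
  have h3 : ∀ C D : Ix, K.D A (z C.1 C.2 * z D.1 D.2) =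
      ∑ F : Ix, braid4 q C D A F • z F.1 F.2 + if A = C then z D.1 D.2 else 0 := by
    intro C D
    simp [K.D_mul, h _ _ _, hd _ _, ite_mul]
  simp only [map_sum, map_smul, h3, smul_add, Finset.sum_add_distrib, Finset.smul_sum,
    smul_smul] at h2
  rw [Finset.sum_congr rfl fun C _ => Finset.sum_comm, Finset.sum_comm] at h2
  simp only [← Finset.sum_smul, h1, smul_ite, smul_zero] at h2
  have h4 : ∑ C : Ix, ∑ D : Ix, (if A = C then (epsLow q C.1 D.1 * epsLow q C.2 D.2) • z D.1 D.2
      else 0) = low q z A := by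
    rw [Finset.sum_comm]
    simp [low]
  have h5 : (q ^ 2 + 1) • K.D A (QInst.qdet q z) = (q ^ 2 + 1) • q⁻¹ ^ 2 • low q z A := by
    rw [← h2, h4, low]
    simp only [mul_smul (q⁻¹ ^ 2), ← Finset.smul_sum]
    match_scalars
    field_simp
    ring
  exact smul_right_injective S hq2 h5

/-- Lowering an index with `ε` replaces the braid matrix by its inverse, with a factor `q` for each
spinor index. -/
theorem IsVec.L_low (hq : q ≠ 0) {z : Matrix (Fin 2) (Fin 2) S} (h : K.IsVec q z) (A G E : Ix) :
    K.L G E (low q z A) = q ^ 2 • ∑ F : Ix,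
      (braidInv2 q E.1 F.1 A.1 G.1 * braidInv2 q E.2 F.2 A.2 G.2) • low q z F := by
  have h0 : ∀ a e g d, ∑ f, epsLow q a f * braid2 q f e g d =
      q * ∑ k, braidInv2 q e k a g * epsLow q k d := by
    intro a e g d
    simp only [braid2, braidInv2, Fin.sum_univ_two, epsLow, epsUp]
    fin_cases a <;> fin_cases e <;> fin_cases g <;> fin_cases d <;> simp <;> field_simp <;> ring
  have h1 : ∀ D : Ix, ∑ F : Ix, (epsLow q A.1 F.1 * epsLow q A.2 F.2) * braid4 q F E G D =
      q ^ 2 * ∑ F : Ix, (braidInv2 q E.1 F.1 A.1 G.1 * braidInv2 q E.2 F.2 A.2 G.2) *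
        (epsLow q F.1 D.1 * epsLow q F.2 D.2) := by
    intro D
    have e1 : ∑ F : Ix, (epsLow q A.1 F.1 * epsLow q A.2 F.2) * braid4 q F E G D =
        (∑ f, epsLow q A.1 f * braid2 q f E.1 G.1 D.1) *
          ∑ f, epsLow q A.2 f * braid2 q f E.2 G.2 D.2 := by
      simp only [Fintype.sum_prod_type, Fin.sum_univ_two, braid4]
      ring
    rw [e1, h0, h0]
    simp only [Fintype.sum_prod_type, Fin.sum_univ_two]
    ring
  simp only [low, map_sum, map_smul, h _ _ _, Finset.smul_sum, smul_smul]
  rw [Finset.sum_comm]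
  simp only [← Finset.sum_smul, h1, Finset.mul_sum]
  rw [Finset.sum_comm]
  simp only [Finset.sum_smul, mul_assoc]

theorem IsDual.D_low {z : Matrix (Fin 2) (Fin 2) S} (hd : K.IsDual z) (A B : Ix) :
    K.D B (low q z A) = (epsLow q A.1 B.1 * epsLow q A.2 B.2) • 1 := by
  simp [low, hd _ _]

theorem low_apply (z : Matrix (Fin 2) (Fin 2) S) :
    low q z (0, 0) = z 1 1 ∧ low q z (0, 1) = -(q • z 1 0) ∧ low q z (1, 0) = -(q • z 0 1) ∧
      low q z (1, 1) = q ^ 2 • z 0 0 := by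
  refine ⟨?_, ?_, ?_, ?_⟩ <;>
    simp [low, Fintype.sum_prod_type, Fin.sum_univ_two, epsLow, pow_two]

/-- The lowered form of `z̄ z = |z|²`; it makes the terms quadratic in `z_A` selfdual in second
derivatives. -/
theorem IsCoord.sum_low (hq : q ≠ 0) (hq2 : q ^ 2 + 1 ≠ 0) {z : Matrix (Fin 2) (Fin 2) S}
    (hz : IsCoord q z) (i j : Fin 2) :
    ∑ a, ∑ b, epsUp q a b • (low q z (b, j) * low q z (a, i)) =
      epsLow q i j • (-q) • qdet q z := by
  obtain ⟨r1, r2, r3, r4, r5, r6⟩ := hz.relations hq hq2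
  obtain ⟨l1, l2, l3, l4⟩ := low_apply (q := q) z
  fin_cases i <;> fin_cases j <;>
    simp [Fin.sum_univ_two, epsUp, epsLow, l1, l2, l3, l4, qdet, r1, r2, r3, r4, r5, r6,
      -zero_smul] <;>
    match_scalars <;> field_simp <;> ring

theorem commute_low {z : Matrix (Fin 2) (Fin 2) S} {f : S} (h : ∀ i j, Commute f (z i j))
    (A : Ix) : Commute f (low q z A) :=
  Commute.sum_right _ _ _ fun _ _ => (h _ _).smul_right _

end Calculus

end QInst
end

noncomputable section
namespace QInst

namespace Calculus

variable {q : ℂ} {S : Type*} [Ring S] [Algebra ℂ S] {K : Calculus S}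

/-! ### Covariance of the generators -/

theorem IsDiag.act {f : S} {r : ℂ} (h : K.IsDiag f r) (c : Ix → Ix → S) :
    K.act f c = fun A B => (r * r) • (f * c A B) := by
  funext A B
  simp only [Calculus.act, h A _, apply_ite (K.L B _), map_smul, h B _, map_zero, smul_ite,
    smul_zero, ite_mul, zero_mul, smul_mul_assoc]
  simp [smul_smul]

theorem sum_split (e : Fin 2 → Fin 2 → ℂ) (r : Fin 2 → Fin 2 → Fin 2 → Fin 2 → ℂ)
    (s : Fin 2 → Fin 2 → ℂ) (X : Ix → Ix → S) :
    ∑ c, ∑ d, e c d • ∑ A : Ix, ∑ B : Ix, (r A.1 B.1 c d * s A.2 B.2) • X A B =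
      ∑ i, ∑ j, s i j • ∑ a, ∑ b, (∑ c, ∑ d, e c d * r a b c d) • X (a, i) (b, j) := by
  rw [sum_smul_sum_pair]
  simp only [Fintype.sum_prod_type_right, Finset.smul_sum, smul_smul]
  refine Finset.sum_congr rfl fun i _ => ?_
  rw [Finset.sum_comm]
  refine Finset.sum_congr rfl fun j _ => ?_
  refine Finset.sum_congr rfl fun a _ => Finset.sum_congr rfl fun b _ => ?_
  congr 1
  simp only [Finset.mul_sum]
  exact Finset.sum_congr rfl fun c _ => Finset.sum_congr rfl fun d _ => by ring

theorem epsUp_braid2_braid2 (hq : q ≠ 0) (h a b k : Fin 2) :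
    ∑ c, ∑ d, epsUp q c d * ∑ g, braid2 q h a c g * braid2 q g b d k =
      if h = k then q * epsUp q a b else 0 := by
  simp only [braid2, Fin.sum_univ_two, epsLow, epsUp]
  fin_cases h <;> fin_cases a <;> fin_cases b <;> fin_cases k <;> simp [hq] <;> field_simp <;>
    ring

theorem epsUp_braid2 (hq : q ≠ 0) (c e : Fin 2) :
    ∑ a, ∑ b, epsUp q a b * braid2 q c e a b = -q⁻¹ * epsUp q c e := by
  simp only [braid2, Fin.sum_univ_two, epsLow, epsUp]
  fin_cases c <;> fin_cases e <;> simp <;> field_simp <;> ring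

/-- The component crosses both `ξ`'s by two braidings. The unprimed `ε^{αβ}` and the primed `ε` of
`IsSD` each slide through with a factor `q`, so the new multiplier is `q²` times this component
times the old one. -/
theorem IsVec.act_isSD (hq : q ≠ 0) {y : Matrix (Fin 2) (Fin 2) S} (hy : K.IsVec q y)
    (H : Ix) {c : Ix → Ix → S} (hc : IsSD q c) : IsSD q (K.act (y H.1 H.2) c) := by
  obtain ⟨k, hk⟩ := hc
  have h1 : ∀ A B C D : Ix, K.L D B (K.L C A (y H.1 H.2)) =
      ∑ F : Ix, ((∑ g, braid2 q H.1 A.1 C.1 g * braid2 q g B.1 D.1 F.1) *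
        ∑ g, braid2 q H.2 A.2 C.2 g * braid2 q g B.2 D.2 F.2) • y F.1 F.2 := by
    intro A B C D
    simp only [hy _ _ _, map_sum, map_smul, Finset.smul_sum, smul_smul]
    rw [Finset.sum_comm]
    simp only [← Finset.sum_smul]
    refine Finset.sum_congr rfl fun F _ => ?_
    congr 1
    simp only [Fintype.sum_prod_type, Fin.sum_univ_two, braid4]
    ring
  have h2 : ∀ i j, ∑ a, ∑ b, epsUp q a b • K.act (y H.1 H.2) c (a, i) (b, j) =
      ∑ F : Ix, ∑ a, ∑ b, epsUp q a b • ∑ A : Ix, ∑ B : Ix,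
        ((∑ g, braid2 q H.1 A.1 a g * braid2 q g B.1 b F.1) *
        ∑ g, braid2 q H.2 A.2 i g * braid2 q g B.2 j F.2) • (y F.1 F.2 * c A B) := by
    intro i j
    simp only [Calculus.act, h1, Finset.sum_mul, smul_mul_assoc]
    simp only [Finset.smul_sum]
    symm
    rw [Finset.sum_comm]
    refine Finset.sum_congr rfl fun a _ => ?_
    rw [Finset.sum_comm]
    refine Finset.sum_congr rfl fun b _ => ?_
    rw [Finset.sum_comm]
    refine Finset.sum_congr rfl fun A _ => ?_
    rw [Finset.sum_comm]
  have h3 : ∀ i j, ∀ F : Ix, ∑ a, ∑ b, epsUp q a b • ∑ A : Ix, ∑ B : Ix,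
        ((∑ g, braid2 q H.1 A.1 a g * braid2 q g B.1 b F.1) *
        ∑ g, braid2 q H.2 A.2 i g * braid2 q g B.2 j F.2) • (y F.1 F.2 * c A B) =
      if F = H then q ^ 2 • (epsLow q i j • (y F.1 F.2 * k)) else 0 := by
    intro i j F
    rw [sum_split (epsUp q) (fun a b c d => ∑ g, braid2 q H.1 a c g * braid2 q g b d F.1)
      (fun a b => ∑ g, braid2 q H.2 a i g * braid2 q g b j F.2)]
    simp only [epsUp_braid2_braid2 hq]
    by_cases h0 : H.1 = F.1
    · have h4 : ∀ i' j', ∑ a, ∑ b, (q * epsUp q a b) • (y F.1 F.2 * c (a, i') (b, j')) =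
          (q * epsLow q i' j') • (y F.1 F.2 * k) := by
        intro i' j'
        have h5 := congrArg (fun t => q • (y F.1 F.2 * t)) (hk i' j')
        simpa [mul_add, smul_add, smul_smul] using h5
      simp only [h0, if_true, h4, smul_smul, ← Finset.sum_smul]
      have h6 := eps_braid2_braid2 hq H.2 i j F.2
      have h7 : ∑ i', ∑ j', (∑ g, braid2 q H.2 i' i g * braid2 q g j' j F.2) *
          (q * epsLow q i' j') = if H.2 = F.2 then q ^ 2 * epsLow q i j else 0 := by
        have h9 := congrArg (q * ·) h6
        simp only [Fin.sum_univ_two, mul_ite, mul_zero] at h9 ⊢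
        rw [pow_two, mul_assoc, ← h9]
        ring
      rw [h7]
      have h8 : F = H ↔ H.2 = F.2 := by rw [Prod.ext_iff]; simp [h0, eq_comm]
      simp only [h8]
      split_ifs <;> simp
    · have h8 : F ≠ H := fun h => h0 (by rw [h])
      simp [h0, h8]
  refine ⟨q ^ 2 • (y H.1 H.2 * k), fun i j => ?_⟩
  rw [h2, Finset.sum_congr rfl fun F _ => h3 i j F]
  rw [Finset.sum_ite_eq' Finset.univ H, if_pos (Finset.mem_univ _), smul_comm]

theorem IsVec.isCov_of_const (hq : q ≠ 0) {y : Matrix (Fin 2) (Fin 2) S} (hy : K.IsVec q y)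
    (h0 : ∀ A i j, K.D A (y i j) = 0) (i j : Fin 2) : K.IsCov q (y i j) where
  act c hc := hy.act_isSD hq (i, j) hc
  comm E := by
    have h : ∀ A, K.L A E (y i j) = _ := fun A => hy A E (i, j)
    simp only [h, map_sum, map_smul, h0, smul_zero, Finset.sum_const_zero, map_zero, add_zero]
    exact IsSD.zero
  sq := by
    simp only [h0, map_zero]
    exact IsSD.zero

/-- For `comm` the defect is `1 + R̂ ⊗ R̂`. After contraction the identity parts cancel, since `-q⁻¹
· q + 1 = 0`, and a multiple of `ε` remains. -/
theorem IsVec.isCov_of_dual (hq : q ≠ 0) {z : Matrix (Fin 2) (Fin 2) S} (hz : K.IsVec q z)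
    (hd : K.IsDual z) (i j : Fin 2) : K.IsCov q (z i j) where
  act c hc := hz.act_isSD hq (i, j) hc
  comm E := by
    refine ⟨(-q⁻¹ * (epsUp q i E.1 * epsUp q j E.2)) • 1, fun k l => ?_⟩
    have h : ∀ A B, K.D B (K.L A E (z i j)) + K.L B E (K.D A (z i j)) =
        (braid4 q (i, j) E A B + if A = (i, j) ∧ B = E then 1 else 0) • 1 := by
      intro A B
      rw [hz A E (i, j), hd A (i, j)]
      simp only [map_sum, map_smul, hd _ _, smul_ite, smul_zero, Finset.sum_ite_eq,
        Finset.mem_univ, if_true, apply_ite (K.L B E), K.L_one, map_zero, add_smul, ite_smul,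
        one_smul, zero_smul, ite_and]
    simp only [h, smul_smul, ← Finset.sum_smul, mul_add, Finset.sum_add_distrib]
    congr 1
    have h1 := epsUp_braid2 hq i E.1
    have h2 : ∑ a, ∑ b, epsUp q a b * braid4 q (i, j) E (a, k) (b, l) =
        -q⁻¹ * epsUp q i E.1 * braid2 q j E.2 k l := by
      rw [← h1]
      simp only [braid4, Finset.sum_mul, mul_assoc]
    have h3 : ∑ a, ∑ b, epsUp q a b * (if (a, k) = (i, j) ∧ (b, l) = E then 1 else 0) =
        epsUp q i E.1 * if j = k ∧ E.2 = l then 1 else 0 := by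
      by_cases hjk : j = k ∧ E.2 = l
      · obtain ⟨rfl, rfl⟩ := hjk
        simp [Prod.ext_iff, ite_and]
      · simp only [hjk, if_false, mul_zero]
        refine Finset.sum_eq_zero fun a _ => Finset.sum_eq_zero fun b _ => ?_
        rw [if_neg, mul_zero]
        rintro ⟨h4, h5⟩
        exact hjk ⟨(congrArg Prod.snd h4).symm, (congrArg Prod.snd h5).symm⟩
    rw [h2, h3, braid2]
    split_ifs <;> field_simp <;> ring
  sq := by
    have h : ∀ A B, K.D B (K.D A (z i j)) = 0 := fun A B => by
      rw [hd A (i, j)]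
      split_ifs <;> simp [K.D_one]
    simp only [h]
    exact IsSD.zero

theorem IsDiag.isCov_of_const {t : S} {r : ℂ} (h : K.IsDiag t r) (h0 : ∀ A, K.D A t = 0) :
    K.IsCov q t where
  act c hc := by
    rw [h.act]
    exact (hc.mul_left t).smul _
  comm E := by
    simp only [h _ E, apply_ite (K.D _), map_smul, h0, smul_zero, map_zero, ite_self, add_zero]
    exact IsSD.zero
  sq := by
    simp only [h0, map_zero]
    exact IsSD.zero

variable (K) in
/-- `s = |z|⁻¹` for a vector `z` with `dz = ξ`. -/
structure IsPole (q : ℂ) (z : Matrix (Fin 2) (Fin 2) S) (s : S) : Prop where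
  coord : IsCoord q z
  vec : K.IsVec q z
  dual : K.IsDual z
  inv_left : s ^ 2 * QInst.qdet q z = 1
  inv_right : QInst.qdet q z * s ^ 2 = 1
  comm : ∀ i j, Commute s (z i j)
  diag : K.IsDiag s q⁻¹
  D_eq : ∀ A, K.D A s = (-(q⁻¹ / (q + 1))) • (s ^ 2 * K.D A (QInst.qdet q z) * s)

namespace IsPole

variable {z : Matrix (Fin 2) (Fin 2) S} {s : S} (h : K.IsPole q z s)
include h

theorem commute_low (A : Ix) : Commute s (low q z A) := Calculus.commute_low h.comm A

variable (hq : q ≠ 0) (hq1 : q + 1 ≠ 0) (hq2 : q ^ 2 + 1 ≠ 0)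
include hq hq2

theorem D_inv (A : Ix) :
    K.D A s = (-(q⁻¹ / (q + 1) * q⁻¹ ^ 2)) • (s ^ 3 * low q z A) := by
  rw [h.D_eq, D_qdet hq hq2 h.coord h.vec h.dual, mul_smul_comm, smul_mul_assoc, smul_smul,
    mul_assoc, (h.commute_low A).eq.symm, ← mul_assoc, ← pow_succ]
  congr 1
  ring

theorem D_inv_pow_three (A : Ix) :
    K.D A (s ^ 3) = (-(q⁻¹ / (q + 1) * q⁻¹ ^ 2) * (1 + q⁻¹ + q⁻¹ ^ 2)) • (s ^ 5 * low q z A) := by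
  rw [show s ^ 3 = s * (s * s) by noncomm_ring, h.diag.D_mul, h.diag.D_mul, h.D_inv hq hq2]
  have h1 : ∀ m, low q z A * s ^ m = s ^ m * low q z A := fun m =>
    ((h.commute_low A).pow_left m).eq.symm
  have h2 := h1 1
  rw [pow_one] at h2
  simp only [smul_mul_assoc, mul_smul_comm, mul_assoc, h2, ← mul_assoc (low q z A) s s, mul_add,
    smul_add]
  simp only [← mul_assoc, ← pow_succ, ← pow_succ']
  match_scalars
  ring

include hq1

/-- The two Leibniz terms differ by the factor `q⁻¹` picked up at `ξ`. Their sum `1 + q⁻¹` cancels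
the `q + 1` in `d|z|⁻¹`. -/
theorem D_inv_sq (A : Ix) : K.D A (s ^ 2) = (-(q⁻¹ ^ 4)) • (s ^ 4 * low q z A) := by
  rw [pow_two, h.diag.D_mul, h.D_inv hq hq2]
  rw [smul_mul_assoc, mul_assoc, ← (h.commute_low A).eq, mul_smul_comm, ← mul_assoc, ← mul_assoc,
    ← pow_succ, ← pow_succ']
  match_scalars
  field_simp
  ring

-- Everything reduces to `s³ z_A`. The defect in `comm` is a finite table in the four lowered
-- coordinates; in `sq` one term is the metric and the other is covered by `IsCoord.sum_low`.
omit hq1 in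
theorem isCov : K.IsCov q s where
  act c hc := by
    rw [h.diag.act]
    exact (hc.mul_left s).smul _
  comm E := by
    set κ := q⁻¹ / (q + 1) * q⁻¹ ^ 2 with hκ
    refine ⟨(κ * q⁻¹ ^ 2 * q ^ 2) • ∑ F : Ix, (epsUp q E.1 F.1 * epsUp q E.2 F.2) •
      (s ^ 3 * low q z F), fun i j => ?_⟩
    have h3 := h.diag.pow 3
    have e1 : ∀ A B, K.D B (K.L A E s) =
        if A = E then (-(κ * q⁻¹)) • (s ^ 3 * low q z B) else 0 := by
      intro A B
      rw [h.diag A E, apply_ite (K.D B), map_smul, h.D_inv hq hq2, map_zero, smul_smul]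
      congr 2
      rw [hκ]; ring
    have e2 : ∀ A B, K.L B E (K.D A s) = (-(κ * q⁻¹)) • ∑ F : Ix,
        (braidInv2 q E.1 F.1 A.1 B.1 * braidInv2 q E.2 F.2 A.2 B.2) • (s ^ 3 * low q z F) := by
      intro A B
      rw [h.D_inv hq hq2, map_smul, h3.L_mul, h.vec.L_low hq, mul_smul_comm, Finset.mul_sum,
        smul_smul, smul_smul]
      simp only [mul_smul_comm]
      congr 1
      rw [hκ]
      field_simp
    simp only [e1, e2]
    generalize s ^ 3 = t
    obtain ⟨E1, E2⟩ := E
    simp only [Fintype.sum_prod_type, Fin.sum_univ_two, braidInv2, epsUp, epsLow, Prod.mk.injEq]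
    fin_cases i <;> fin_cases j <;> fin_cases E1 <;> fin_cases E2 <;>
      simp [-zero_smul] <;> match_scalars <;> field_simp <;> ring
  sq := by
    have e : ∀ A B, K.D B (K.D A s) = (-(q⁻¹ / (q + 1) * q⁻¹ ^ 2)) • (q⁻¹ ^ 3 • (s ^ 3 *
        ((epsLow q A.1 B.1 * epsLow q A.2 B.2) • 1)) +
        (-(q⁻¹ / (q + 1) * q⁻¹ ^ 2) * (1 + q⁻¹ + q⁻¹ ^ 2)) •
          (s ^ 5 * (low q z B * low q z A))) := by
      intro A B
      rw [h.D_inv hq hq2, map_smul, (h.diag.pow 3).D_mul, h.D_inv_pow_three hq hq2,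
        h.dual.D_low, smul_mul_assoc, mul_assoc]
    simp only [e]
    refine IsSD.smul (IsSD.add (IsSD.smul (IsSD.mul_left ?_ _) _)
      (IsSD.smul (IsSD.mul_left ?_ _) _)) _
    · refine ⟨(-(q + q⁻¹)) • 1, fun i j => ?_⟩
      simp only [smul_smul, ← Finset.sum_smul]
      congr 1
      simp only [Fin.sum_univ_two, epsUp, epsLow]
      fin_cases i <;> fin_cases j <;> simp <;> field_simp <;> ring
    · exact ⟨_, fun i j => IsCoord.sum_low hq hq2 h.coord i j⟩

end IsPole

end Calculus

end QInst
end

/-! ### The potentials `ρ²|z|⁻²` and their sums -/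

noncomputable section
namespace QInst

namespace Calculus

variable {q : ℂ} {S : Type*} [Ring S] [Algebra ℂ S] {K : Calculus S}

/-- All conditions on a seed are linear except commutation with the gradient. There the commutators
of different summands only need to cancel in pairs, not to vanish one by one. -/
theorem IsSeed.sum {m : ℕ} {u : Fin m → S} (h : ∀ i, K.IsSeed q (u i))
    (h2 : ∀ i j, i < j → ∀ A,
      u i * K.D A (u j) + u j * K.D A (u i) = K.D A (u j) * u i + K.D A (u i) * u j) :
    K.IsSeed q (∑ i, u i) where
  diag := IsDiag.sum _ fun i _ => (h i).diag
  comm A := by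
    set f : Fin m → Fin m → S := fun i j => u i * K.D A (u j) - K.D A (u j) * u i with hf
    have h3 : ∀ i j, f i j + f j i = 0 := by
      intro i j
      rcases lt_trichotomy i j with hij | rfl | hij
      · have := h2 i j hij A
        simp only [hf]
        linear_combination (norm := abel) this
      · simp [hf, (h i).comm A]
      · have := h2 j i hij A
        simp only [hf]
        linear_combination (norm := abel) this
    have h4 : ∑ i, ∑ j, f i j = 0 := by
      -- An antisymmetric double sum equals its own negative.
      have h5 : (2 : ℂ) • ∑ i, ∑ j, f i j = 0 := by
        rw [two_smul]
        nth_rewrite 2 [Finset.sum_comm]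
        simp only [← Finset.sum_add_distrib, h3, Finset.sum_const_zero]
      exact (smul_eq_zero_iff_right two_ne_zero).1 h5
    rw [map_sum, Finset.sum_mul_sum, Finset.sum_mul_sum, ← sub_eq_zero, ← h4]
    nth_rewrite 2 [Finset.sum_comm]
    simp only [← Finset.sum_sub_distrib, hf]
  L_D A G E := by
    simp only [map_sum, (h _).L_D, Finset.smul_sum]
    exact Finset.sum_comm
  harm i j := by
    have h3 : ∑ a, ∑ b, epsUp q a b • K.D (b, j) (K.D (a, i) (∑ i, u i)) =
        ∑ k, ∑ a, ∑ b, epsUp q a b • K.D (b, j) (K.D (a, i) (u k)) := by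
      simp only [map_sum, Finset.smul_sum]
      exact (Finset.sum_congr rfl fun a _ => Finset.sum_comm).trans Finset.sum_comm
    rw [h3]
    exact Finset.sum_eq_zero fun k _ => (h k).harm i j

variable (K) in
/-- `ρ` is the square of the size of an instanton at a pole. -/
structure IsSize (z : Matrix (Fin 2) (Fin 2) S) (s ρ : S) : Prop where
  diag : K.IsDiag ρ 1
  D_eq : ∀ A, K.D A ρ = 0
  comm : ∀ i j, Commute ρ (z i j)
  comm_inv : Commute ρ s

section

variable {z : Matrix (Fin 2) (Fin 2) S} {s ρ : S} (hq : q ≠ 0) (hq1 : q + 1 ≠ 0)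
  (hq2 : q ^ 2 + 1 ≠ 0) (h : K.IsPole q z s) (hρ : K.IsSize z s ρ)
include hq hq1 hq2 h hρ

theorem IsSize.D_pot (A : Ix) :
    K.D A (ρ * s ^ 2) = (-(q⁻¹ ^ 4)) • (ρ * s ^ 4 * low q z A) := by
  rw [hρ.diag.D_mul, hρ.D_eq, h.D_inv_sq hq hq1 hq2, one_smul, zero_mul, add_zero, mul_smul_comm,
    mul_assoc]

/-- The `q`-analogue of the harmonicity of `1/|x|²` in dimension four. The covector property comes
from the lowered coordinate in `∂(ρ s²)`, the prefactor being scalar past `ξ`. -/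
theorem IsSize.isSeed : K.IsSeed q (ρ * s ^ 2) where
  diag := by simpa using hρ.diag.mul (h.diag.pow 2)
  comm A := by
    rw [hρ.D_pot hq hq1 hq2 h, mul_smul_comm, smul_mul_assoc]
    congr 1
    have h1 : Commute (ρ * s ^ 2) ρ := (Commute.refl ρ).mul_left (hρ.comm_inv.symm.pow_left 2)
    have h2 : Commute (ρ * s ^ 2) s := hρ.comm_inv.mul_left ((Commute.refl s).pow_left 2)
    have h3 : ∀ A, Commute (ρ * s ^ 2) (low q z A) := Calculus.commute_low fun i j =>
      (hρ.comm i j).mul_left ((h.comm i j).pow_left 2)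
    exact ((h1.mul_right (h2.pow_right 4)).mul_right (h3 A)).eq
  L_D A G E := by
    have h4 : K.IsDiag (ρ * s ^ 4) (q⁻¹ ^ 4) := by simpa using hρ.diag.mul (h.diag.pow 4)
    simp only [hρ.D_pot hq hq1 hq2 h, map_smul, h4.L_mul, h.vec.L_low hq, Finset.mul_sum,
      Finset.smul_sum, smul_smul, mul_smul_comm]
    refine Finset.sum_congr rfl fun F _ => ?_
    congr 1
    field_simp
  harm i j := by
    have h4 : K.IsDiag (ρ * s ^ 4) (q⁻¹ ^ 4) := by simpa using hρ.diag.mul (h.diag.pow 4)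
    have h5 : ∀ A, K.D A (s ^ 4) = (-(q⁻¹ ^ 4) * (1 + q⁻¹ ^ 2)) • (s ^ 6 * low q z A) := by
      intro A
      rw [show s ^ 4 = s ^ 2 * s ^ 2 by rw [← pow_add], (h.diag.pow 2).D_mul,
        h.D_inv_sq hq hq1 hq2, mul_smul_comm, smul_mul_assoc, mul_assoc,
        ← ((h.commute_low A).pow_left 2).eq, ← mul_assoc, ← mul_assoc, ← pow_add, ← pow_add]
      match_scalars
      ring
    have h6 : ∀ A B, K.D B (ρ * s ^ 4 * low q z A) =
        (q⁻¹ ^ 4 * (epsLow q A.1 B.1 * epsLow q A.2 B.2)) • (ρ * s ^ 4) -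
        (q⁻¹ ^ 4 * (1 + q⁻¹ ^ 2)) • (ρ * s ^ 6 * (low q z B * low q z A)) := by
      intro A B
      rw [h4.D_mul, hρ.diag.D_mul, hρ.D_eq, h5, h.dual.D_low, one_smul, zero_mul, add_zero]
      simp only [mul_smul_comm, smul_mul_assoc, mul_one, mul_assoc]
      module
    have h7 : ∑ a, ∑ b, epsUp q a b • K.D (b, j) (ρ * s ^ 4 * low q z (a, i)) =
        (∑ a, ∑ b, epsUp q a b * (q⁻¹ ^ 4 * (epsLow q a b * epsLow q i j))) • (ρ * s ^ 4) -
        (q⁻¹ ^ 4 * (1 + q⁻¹ ^ 2)) • (ρ * s ^ 6 * ∑ a, ∑ b, epsUp q a b •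
          (low q z (b, j) * low q z (a, i))) := by
      simp only [h6, Finset.sum_smul, Finset.mul_sum, Finset.smul_sum, smul_sub, smul_smul,
        mul_smul_comm, Finset.sum_sub_distrib]
      congr 1
      exact Finset.sum_congr rfl fun a _ => Finset.sum_congr rfl fun b _ => by rw [mul_comm]
    have h8 : ρ * s ^ 6 * qdet q z = ρ * s ^ 4 := by
      rw [show s ^ 6 = s ^ 4 * s ^ 2 by rw [← pow_add], mul_assoc, mul_assoc, h.inv_left, mul_one]
    have h9 : ∑ a, ∑ b, epsUp q a b • K.D (b, j) (K.D (a, i) (ρ * s ^ 2)) =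
        (-(q⁻¹ ^ 4)) • ∑ a, ∑ b, epsUp q a b • K.D (b, j) (ρ * s ^ 4 * low q z (a, i)) := by
      simp only [hρ.D_pot hq hq1 hq2 h, map_smul, Finset.smul_sum, smul_comm (-(q⁻¹ ^ 4))]
    rw [h9, h7, IsCoord.sum_low hq hq2 h.coord, mul_smul_comm, mul_smul_comm, h8, smul_smul,
      smul_smul, ← sub_smul, smul_smul]
    -- The metric term contributes `-q⁻⁴(q + q⁻¹)` and the quadratic term `q⁻⁴(1 + q⁻²) q`, each
    -- times `ε`; they cancel.
    refine (congrArg (· • (ρ * s ^ 4)) ?_).trans (zero_smul ℂ _)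
    simp only [Fin.sum_univ_two, epsUp, epsLow]
    fin_cases i <;> fin_cases j <;> simp [hq] <;> field_simp <;> ring

end

/-- With `u' = ρ s²`, differentiate `u u' = q² u' u`. The `q⁻²` from passing `ξ` and the rule `u ∂u'
= q² ∂u' u` turn the result into the symmetrised commutation. -/
theorem IsSize.D_pot_pair (hq : q ≠ 0) (hq1 : q + 1 ≠ 0) (hq2 : q ^ 2 + 1 ≠ 0)
    {z : Matrix (Fin 2) (Fin 2) S} {s ρ u : S} (h : K.IsPole q z s) (hρ : K.IsSize z s ρ)
    (hu : K.IsSeed q u) (hz : ∀ i j, Commute u (z i j)) (hs : Commute u s)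
    (huρ : u * ρ = q ^ 2 • (ρ * u)) (A : Ix) :
    u * K.D A (ρ * s ^ 2) + ρ * s ^ 2 * K.D A u =
      K.D A (ρ * s ^ 2) * u + K.D A u * (ρ * s ^ 2) := by
  have h1 : u * K.D A (ρ * s ^ 2) = q ^ 2 • (K.D A (ρ * s ^ 2) * u) := by
    rw [hρ.D_pot hq hq1 hq2 h, mul_smul_comm, smul_mul_assoc, smul_comm, mul_assoc ρ,
      ← mul_assoc u, huρ, smul_mul_assoc, mul_assoc ρ u,
      ((hs.pow_right 4).mul_right (Calculus.commute_low hz A)).eq]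
    simp only [mul_assoc]
  have h2 : u * (ρ * s ^ 2) = q ^ 2 • (ρ * s ^ 2 * u) := by
    rw [← mul_assoc, huρ, smul_mul_assoc, mul_assoc, (hs.pow_right 2).eq, mul_assoc]
  have h3 := congrArg (K.D A) h2
  rw [hu.diag.D_mul, map_smul, (hρ.isSeed hq hq1 hq2 h).diag.D_mul, h1, smul_add, smul_smul,
    smul_smul, ← mul_pow, ← mul_pow, inv_mul_cancel₀ hq, mul_inv_cancel₀ hq, one_pow, one_smul,
    one_smul] at h3
  rw [h1]
  linear_combination (norm := abel) -h3

end Calculus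

end QInst
end

noncomputable section
namespace QInst

/-! ### The functions of the instantons -/

section Partial

variable {q : ℂ} {S : Type*} [Ring S] [Algebra ℂ S] {n : ℕ}
  {y : Fin (n + 1) → Matrix (Fin 2) (Fin 2) S}

theorem IsBraided.sub_sum (hb : ∀ μ ν, ν < μ → IsBraided q (y μ) (y ν)) {κ : Fin n}
    {T : Finset (Fin n)} (hT : ∀ ν ∈ T, ν < κ) :
    IsBraided q (y κ.succ) (y 0 - ∑ ν ∈ T, y ν.succ) := by
  induction T using Finset.induction_on with
  | empty => simpa using hb _ _ (Fin.succ_pos κ)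
  | insert a T ha ih =>
    rw [Finset.sum_insert ha, add_comm (y a.succ), ← sub_sub]
    exact (ih fun ν hν => hT ν (Finset.mem_insert_of_mem hν)).sub
      (hb _ _ (Fin.succ_lt_succ_iff.2 (hT a (Finset.mem_insert_self _ _))))

theorem IsCoord.sub_sum (hq : q ≠ 0) (hq2 : q ^ 2 + 1 ≠ 0) (hc : ∀ μ, IsCoord q (y μ))
    (hb : ∀ μ ν, ν < μ → IsBraided q (y μ) (y ν)) (T : Finset (Fin n)) :
    IsCoord q (y 0 - ∑ ν ∈ T, y ν.succ) := by
  -- Removing the largest index last ensures that each new `y` is braided with the difference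
  -- already formed.
  induction T using Finset.induction_on_max with
  | empty => simpa using hc 0
  | insert a T ha ih =>
    rw [Finset.sum_insert fun h => lt_irrefl a (ha a h), add_comm (y a.succ), ← sub_sub]
    exact ih.sub hq hq2 (hc _) (IsBraided.sub_sum hb ha)

variable {K : Calculus S}

theorem Calculus.IsVec.sub_sum (h : ∀ μ, K.IsVec q (y μ)) (T : Finset (Fin n)) :
    K.IsVec q (y 0 - ∑ ν ∈ T, y ν.succ) := by
  induction T using Finset.induction_on with
  | empty => simpa using h 0
  | insert a T ha ih =>
    rw [Finset.sum_insert ha, add_comm (y a.succ), ← sub_sub]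
    exact ih.sub (h _)

theorem Calculus.IsDual.sub_sum (h : K.IsDual (y 0))
    (h0 : ∀ (μ : Fin n) (A : Ix) i j, K.D A (y μ.succ i j) = 0) (T : Finset (Fin n)) :
    K.IsDual (y 0 - ∑ ν ∈ T, y ν.succ) := fun A C => by
  simp [Matrix.sum_apply, h A C, h0]

theorem map_qdet {S' : Type*} [Ring S'] [Algebra ℂ S'] (f : S →ₐ[ℂ] S')
    (z : Matrix (Fin 2) (Fin 2) S) : qdet q (z.map f) = f (qdet q z) := by
  simp [qdet]

end Partial

section Functions

variable {q : ℂ} {n : ℕ}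

theorem isCoord_yMat (μ : Fin (n + 1)) : IsCoord q (yMat q μ : Matrix _ _ (Fn q n)) := by
  intro A B
  have h := cls_eq.2 (Rel.coord (q := q) μ A B)
  simp only [cls_sum] at h
  exact h

theorem isBraided_yMat {μ ν : Fin (n + 1)} (hμ : ν < μ) :
    IsBraided q (yMat q μ : Matrix _ _ (Fn q n)) (yMat q ν) := by
  intro A B
  have h := cls_eq.2 (Rel.braided (q := q) μ ν A B hμ)
  simp only [cls_sum] at h
  exact h

theorem isVec_yMat (μ : Fin (n + 1)) : (fnCalc q n).IsVec q (yMat q μ) := by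
  intro A B C
  change lam A B (cls q (gen (Gen.y μ C))) = _
  rw [lam_cls, jet_gen]
  simp only [jetGen, jetGen1, jetGen0, block, Matrix.of_apply, cls_sum]
  rfl

theorem del_yMat (μ : Fin (n + 1)) (A C : Ix) :
    (fnCalc q n).D A (yMat q μ C.1 C.2) = if μ = 0 ∧ A = C then 1 else 0 := by
  change del A (cls q (gen (Gen.y μ C))) = _
  rw [del_cls, jet_gen]
  simp only [jetGen, jetGen1, jetGen0, block, Matrix.of_apply]
  split_ifs <;> rfl

theorem isDual_yMat : (fnCalc q n).IsDual (yMat q 0) := fun A C => by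
  simp [del_yMat]

theorem del_yMat_succ (μ : Fin n) (A : Ix) (i j : Fin 2) :
    (fnCalc q n).D A (yMat q μ.succ i j) = 0 := by
  simpa using del_yMat (q := q) μ.succ A (i, j)

theorem zMat_eq (μ : Fin n) : (zMat q μ : Matrix _ _ (Fn q n)) =
    yMat q 0 - ∑ ν ∈ Finset.univ.filter (fun ν : Fin n => ν ≤ μ), yMat q ν.succ := by
  ext i j
  have h : ∀ (T : Finset (Fin n)), cls q ((yFree 0 - ∑ ν ∈ T, yFree ν.succ : Matrix _ _ (Free n)) i j) =
      (yMat q 0 - ∑ ν ∈ T, yMat q ν.succ : Matrix (Fin 2) (Fin 2) (Fn q n)) i j := by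
    intro T
    rw [Matrix.sub_apply, Matrix.sub_apply, cls_sub, Matrix.sum_apply, Matrix.sum_apply, cls_sum]
    rfl
  exact h _

variable (hq : q ≠ 0) (hq1 : q + 1 ≠ 0) (hq2 : q ^ 2 + 1 ≠ 0)

include hq hq2 in
theorem isCoord_zMat (μ : Fin n) : IsCoord q (zMat q μ : Matrix _ _ (Fn q n)) := by
  rw [zMat_eq]
  exact IsCoord.sub_sum hq hq2 isCoord_yMat (fun _ _ => isBraided_yMat) _

theorem isBraided_yMat_zMat {μ κ : Fin n} (h : μ < κ) :
    IsBraided q (yMat q κ.succ : Matrix _ _ (Fn q n)) (zMat q μ) := by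
  rw [zMat_eq]
  exact IsBraided.sub_sum (fun _ _ => isBraided_yMat) fun ν hν =>
    lt_of_le_of_lt (Finset.mem_filter.1 hν).2 h

theorem qdet_zMat (μ : Fin n) : qdet q (zMat q μ : Matrix _ _ (Fn q n)) = cls q (qdet q (zFree μ)) :=
  map_qdet (clsHom q n) _

theorem qdet_yMat (μ : Fin (n + 1)) :
    qdet q (yMat q μ : Matrix _ _ (Fn q n)) = cls q (qdet q (yFree μ)) :=
  map_qdet (clsHom q n) _

theorem zNormInv_root (μ : Fin n) {a : Fn q n} (k : ℤ)
    (h : qdet q (zMat q μ) * a = q ^ (2 * k) • (a * qdet q (zMat q μ))) :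
    zNormInv q μ * a = q ^ (-k) • (a * zNormInv q μ) := by
  obtain ⟨a, rfl⟩ := cls_surjective a
  rw [qdet_zMat] at h
  exact cls_eq.2 (Rel.zroot μ a k (cls_eq.1 h))

theorem yNormInv_root (μ : Fin n) {a : Fn q n} (k : ℤ)
    (h : qdet q (yMat q μ.succ) * a = q ^ (2 * k) • (a * qdet q (yMat q μ.succ))) :
    yNormInv q μ * a = q ^ (-k) • (a * yNormInv q μ) := by
  obtain ⟨a, rfl⟩ := cls_surjective a
  rw [qdet_yMat] at h
  exact cls_eq.2 (Rel.yroot μ a k (cls_eq.1 h))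

theorem commute_zNormInv (μ : Fin n) {a : Fn q n} (h : Commute (qdet q (zMat q μ)) a) :
    Commute (zNormInv q μ) a := by
  have h1 := zNormInv_root μ (a := a) 0 (by rw [mul_zero, zpow_zero, one_smul]; exact h)
  rwa [neg_zero, zpow_zero, one_smul] at h1

theorem commute_yNormInv (μ : Fin n) {a : Fn q n} (h : Commute (qdet q (yMat q μ.succ)) a) :
    Commute (yNormInv q μ) a := by
  have h1 := yNormInv_root μ (a := a) 0 (by rw [mul_zero, zpow_zero, one_smul]; exact h)
  rwa [neg_zero, zpow_zero, one_smul] at h1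

/-- `d|z_μ|⁻¹` was defined through the jet on polynomials, which agrees there with the full jet. -/
theorem jet_qdet_zFree (μ : Fin n) : jet q (qdet q (zFree μ)) = jet0 q (qdet q (zFree μ)) := by
  have h1 : ∀ (κ : Fin (n + 1)) i j, jet q (yFree κ i j) = jet0 q (yFree κ i j) := by
    intro κ i j
    change jet q (gen (Gen.y κ (i, j))) = jet0 q (gen (Gen.y κ (i, j)))
    rw [jet_gen]
    simp [jet0, gen, jetGen, jetGen1]
  have h2 : ∀ i j, jet q (zFree μ i j) = jet0 q (zFree μ i j) := by
    intro i j
    simp only [zFree, Matrix.sub_apply, Matrix.sum_apply, map_sub, map_sum, h1]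
  simp only [qdet, map_sub, map_mul, map_smul, h2]

include hq hq2 in
theorem isPole_zMat (μ : Fin n) : (fnCalc q n).IsPole q (zMat q μ) (zNormInv q μ) where
  coord := isCoord_zMat hq hq2 μ
  vec := by
    rw [zMat_eq]
    exact Calculus.IsVec.sub_sum isVec_yMat _
  dual := by
    rw [zMat_eq]
    exact Calculus.IsDual.sub_sum isDual_yMat del_yMat_succ _
  inv_left := by
    rw [qdet_zMat]
    exact cls_eq.2 (Rel.zinv_left μ)
  inv_right := by
    rw [qdet_zMat]
    exact cls_eq.2 (Rel.zinv_right μ)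
  comm i j := commute_zNormInv μ ((isCoord_zMat hq hq2 μ).commute_qdet hq hq2 i j)
  diag A B := by
    change lam A B (cls q (gen (Gen.zinv μ))) = _
    rw [lam_cls, jet_gen]
    simp only [jetGen, jetGen1, block, Matrix.of_apply, diagBlock]
    split_ifs <;> rfl
  D_eq A := by
    rw [qdet_zMat]
    change del A (cls q (gen (Gen.zinv μ))) = _
    rw [fnCalc_D, del_cls, del_cls, jet_gen, jet_qdet_zFree]
    rfl

theorem commute_rhoSq_yMat {ν : Fin n} {μ : Fin (n + 1)} (h : μ ≤ ν.succ) (i j : Fin 2) :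
    Commute (rhoSq q ν) (yMat q μ i j) :=
  cls_eq.2 (Rel.rho_y' ν μ (i, j) h)

theorem commute_rhoSq_zMat {ν μ : Fin n} (h : μ ≤ ν) (i j : Fin 2) :
    Commute (rhoSq q ν) (zMat q μ i j) := by
  rw [zMat_eq, Matrix.sub_apply, Matrix.sum_apply]
  refine (commute_rhoSq_yMat (Fin.zero_le _) i j).sub_right (Commute.sum_right _ _ _ fun κ hκ => ?_)
  exact commute_rhoSq_yMat (Fin.succ_le_succ_iff.2 ((Finset.mem_filter.1 hκ).2.trans h)) i j

theorem commute_qdet_of {S : Type*} [Ring S] [Algebra ℂ S] {f : S} {z : Matrix (Fin 2) (Fin 2) S}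
    (h : ∀ i j, Commute f (z i j)) : Commute f (qdet q z) :=
  ((h 0 0).mul_right (h 1 1)).sub_right (((h 0 1).mul_right (h 1 0)).smul_right q)

theorem commute_rhoSq_zNormInv {ν μ : Fin n} (h : μ ≤ ν) :
    Commute (rhoSq q ν) (zNormInv q μ) :=
  (commute_zNormInv μ (commute_qdet_of (commute_rhoSq_zMat h)).symm).symm

theorem lam_rhoSq (μ : Fin n) : (fnCalc q n).IsDiag (rhoSq q μ) 1 := fun A B => by
  rw [one_smul]
  change lam A B (cls q (gen (Gen.rho μ))) = _
  rw [lam_cls, jet_gen]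
  simp only [jetGen, jetGen1, jetGen0, block, Matrix.of_apply, diagBlock]
  split_ifs <;> rfl

theorem isSize_rhoSq (μ : Fin n) :
    (fnCalc q n).IsSize (zMat q μ) (zNormInv q μ) (rhoSq q μ) where
  diag := lam_rhoSq μ
  D_eq A := by
    change del A (cls q (gen (Gen.rho μ))) = _
    rw [del_cls, jet_gen]
    rfl
  comm := commute_rhoSq_zMat le_rfl
  comm_inv := commute_rhoSq_zNormInv le_rfl

theorem inv_sq_smul_eq {S : Type*} [Ring S] [Algebra ℂ S] (hq : q ≠ 0) {a b : S}
    (h : a = q ^ 2 • b) : b = q⁻¹ ^ 2 • a := by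
  rw [h, smul_smul, ← mul_pow, inv_mul_cancel₀ hq, one_pow, one_smul]

include hq hq2 in
theorem zNormInv_mul_yMat {μ κ : Fin n} (h : μ < κ) (i j : Fin 2) :
    zNormInv q μ * yMat q κ.succ i j = q • (yMat q κ.succ i j * zNormInv q μ) := by
  have h1 := (isBraided_yMat_zMat (q := q) h).mul_qdet hq hq2 (isCoord_zMat hq hq2 μ) i j
  have h2 := zNormInv_root μ (-1) (by rw [inv_sq_smul_eq hq h1]; norm_num [zpow_neg])
  rwa [neg_neg, zpow_one] at h2

/-- `ρ_μ² |z_μ|⁻²`. -/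
def pot (q : ℂ) (μ : Fin n) : Fn q n := rhoSq q μ * zNormInv q μ ^ 2

theorem commute_mul_sq {S : Type*} [Ring S] [Algebra ℂ S] (hq : q ≠ 0) {r s y : S}
    (h1 : r * y = q⁻¹ ^ 2 • (y * r)) (h2 : s * y = q • (y * s)) : Commute (r * s ^ 2) y := by
  rw [commute_iff_eq, pow_two, mul_assoc, mul_assoc, h2, mul_smul_comm, ← mul_assoc s, h2,
    smul_mul_assoc, mul_smul_comm, mul_smul_comm, mul_assoc y, ← mul_assoc r, h1, smul_mul_assoc,
    smul_smul, smul_smul, mul_assoc]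
  rw [show q * (q * q⁻¹ ^ 2) = 1 by field_simp, one_smul, mul_assoc]

-- The factor `q²` from `|z_μ|⁻²` is compensated by the `q⁻²` of `ρ_μ²`.
include hq hq2 in
theorem commute_pot_yMat {μ κ : Fin n} (h : μ < κ) (i j : Fin 2) :
    Commute (pot q μ) (yMat q κ.succ i j) :=
  commute_mul_sq hq (cls_eq.2 (Rel.rho_y μ κ.succ (i, j) (Fin.succ_lt_succ_iff.2 h)))
    (zNormInv_mul_yMat hq hq2 h i j)

-- `z_κ` is `z_μ` minus vectors `y_ν` with `ν > μ`, and the potential commutes with each of them.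
include hq hq2 in
theorem commute_pot_zMat {μ κ : Fin n} (h : μ ≤ κ) (i j : Fin 2) :
    Commute (pot q μ) (zMat q κ i j) := by
  have h1 : (zMat q κ : Matrix _ _ (Fn q n)) i j =
      zMat q μ i j - ∑ ν ∈ Finset.univ.filter (fun ν : Fin n => μ < ν ∧ ν ≤ κ),
        yMat q ν.succ i j := by
    rw [zMat_eq, zMat_eq, Matrix.sub_apply, Matrix.sub_apply, Matrix.sum_apply, Matrix.sum_apply,
      sub_sub, ← Finset.sum_union]
    · congr 2
      ext ν
      simp only [Finset.mem_filter, Finset.mem_univ, true_and, Finset.mem_union]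
      constructor
      · exact fun h2 => (le_or_gt ν μ).imp_right fun h3 => ⟨h3, h2⟩
      · exact fun h2 => h2.elim (fun h3 => h3.trans h) fun h3 => h3.2
    · rw [Finset.disjoint_filter]
      exact fun ν _ h2 h3 => not_lt_of_ge h2 h3.1
  rw [h1]
  refine Commute.sub_right ?_ (Commute.sum_right _ _ _ fun ν hν =>
    commute_pot_yMat hq hq2 (Finset.mem_filter.1 hν).2.1 i j)
  exact (commute_rhoSq_zMat le_rfl i j).mul_left (((isPole_zMat hq hq2 μ).comm i j).pow_left 2)

include hq hq2 in
theorem commute_pot_zNormInv {μ κ : Fin n} (h : μ ≤ κ) : Commute (pot q μ) (zNormInv q κ) :=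
  (commute_zNormInv κ (commute_qdet_of (commute_pot_zMat hq hq2 h)).symm).symm

theorem pot_mul_rhoSq {μ κ : Fin n} (h : μ < κ) :
    pot q μ * rhoSq q κ = q ^ 2 • (rhoSq q κ * pot q μ) := by
  have h1 : rhoSq q μ * rhoSq q κ = q ^ 2 • (rhoSq q κ * rhoSq q μ) :=
    cls_eq.2 (Rel.rho_rho κ μ h)
  rw [pot, mul_assoc, ← ((commute_rhoSq_zNormInv h.le).pow_right 2).eq, ← mul_assoc, h1,
    smul_mul_assoc, mul_assoc]

include hq hq1 hq2 in
theorem isSeed_pot (μ : Fin n) : (fnCalc q n).IsSeed q (pot q μ) :=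
  (isSize_rhoSq μ).isSeed hq hq1 hq2 (isPole_zMat hq hq2 μ)

include hq hq1 hq2 in
theorem isSeed_sum_pot : (fnCalc q n).IsSeed q (∑ μ : Fin n, pot q μ) :=
  Calculus.IsSeed.sum (isSeed_pot hq hq1 hq2) fun i j hij A =>
    (isSize_rhoSq j).D_pot_pair hq hq1 hq2 (isPole_zMat hq hq2 j) (isSeed_pot hq hq1 hq2 i)
      (commute_pot_zMat hq hq2 hij.le) (commute_pot_zNormInv hq hq2 hij.le) (pot_mul_rhoSq hij) A

theorem phi_eq (c : ℂ) : phi q n c = 1 + c • ∑ μ : Fin n, pot q μ := rfl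

theorem cls_phiFree (c : ℂ) : cls q (phiFree n c) = phi q n c := by
  rw [phiFree, cls_add, cls_smul, potFree, cls_sum]
  rfl

theorem phiInv_mul_phi (c : ℂ) : phiInv q n c * phi q n c = 1 := by
  rw [← cls_phiFree]
  exact cls_eq.2 (Rel.pinv_left c)

theorem phi_mul_phiInv (c : ℂ) : phi q n c * phiInv q n c = 1 := by
  rw [← cls_phiFree]
  exact cls_eq.2 (Rel.pinv_right c)

theorem Calculus.dhat_eq {S : Type*} [Ring S] [Algebra ℂ S] (K : Calculus S) (hq : q ≠ 0) (f : S)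
    (i j : Fin 2) (A : Ix) :
    (∑ m, (q * (epsUp q i A.2 * epsLow q A.1 m)) •
      ∑ B : Ix, (epsUp q m B.1 * epsUp q j B.2) • K.D B f) -
      (if i = j then (q⁻¹ / (q + 1)) • K.D A f else 0) = K.dhat q f A i j := by
  rw [dhat, Matrix.of_apply]
  congr 1
  obtain ⟨a, a'⟩ := A
  have h : ∀ b, ∑ m, epsLow q a m * epsUp q m b = if a = b then 1 else 0 := by
    intro b
    simp only [Fin.sum_univ_two, epsUp, epsLow]
    fin_cases a <;> fin_cases b <;> simp [hq]
  simp only [Finset.smul_sum, smul_smul]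
  rw [Finset.sum_comm]
  simp only [← Finset.sum_smul]
  have h2 : ∀ B : Ix, ∑ m, q * (epsUp q i a' * epsLow q a m) * (epsUp q m B.1 * epsUp q j B.2) =
      if a = B.1 then q * (epsUp q i a' * epsUp q j B.2) else 0 := by
    intro B
    rw [← mul_boole, ← h]
    simp only [Fin.sum_univ_two]
    ring
  simp only [h2]
  rw [Fintype.sum_prod_type, Finset.sum_comm]
  simp [ite_smul]

include hq in
theorem Dhat_eq (f : Fn q n) (i j : Fin 2) (A : Ix) :
    Dhat f i j A = (fnCalc q n).dhat q f A i j :=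
  (fnCalc q n).dhat_eq hq f i j A

/-- The Laplacian is a further primed contraction of the expression which vanishes for a seed. -/
theorem Calculus.box_eq {S : Type*} [Ring S] [Algebra ℂ S] (K : Calculus S) {N : S}
    (h : K.IsSeed q N) (c : ℂ) :
    ∑ H : Ix, ∑ G : Ix, (epsUp q H.1 G.1 * epsUp q H.2 G.2) • K.D G (K.D H (1 + c • N)) = 0 := by
  have h1 : ∑ H : Ix, ∑ G : Ix, (epsUp q H.1 G.1 * epsUp q H.2 G.2) • K.D G (K.D H (1 + c • N)) =
      c • ∑ i, ∑ j, epsUp q i j • ∑ a, ∑ b, epsUp q a b • K.D (b, j) (K.D (a, i) N) := by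
    simp only [map_add, K.D_one, map_smul, zero_add, Fintype.sum_prod_type, Fin.sum_univ_two]
    module
  rw [h1]
  simp only [h.harm, smul_zero, Finset.sum_const_zero]

include hq hq1 hq2 in
theorem box_phi (c : ℂ) : box (phi q n c) = 0 :=
  (fnCalc q n).box_eq (isSeed_sum_pot hq hq1 hq2) c

theorem Calculus.IsSeed.sum_L_inv {S : Type*} [Ring S] [Algebra ℂ S] {K : Calculus S} {N : S}
    {p : ℂ → S} (h : K.IsSeed q N) (hl : ∀ b, p b * (1 + b • N) = 1)
    (hr : ∀ b, (1 + b • N) * p b = 1) (c : ℂ) (A : Ix) (i j : Fin 2) :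
    ∑ B, K.L A B (p c) * K.dhat q (1 + c • N) B i j =
      c • (p (c * q⁻¹ ^ 2) * K.dhat q N A i j) := by
  simp [h.L_inv hl hr, K.dhat_add, K.dhat_one, K.dhat_smul, ite_mul]

include hq hq1 hq2 in
theorem coef_Ahat (c : ℂ) (A : Ix) (i j : Fin 2) : coef (Ahat q n c) A i j =
    c • (phiInv q n (c * q⁻¹ ^ 2) * (fnCalc q n).dhat q (∑ μ : Fin n, pot q μ) A i j) := by
  rw [← (isSeed_sum_pot hq hq1 hq2).sum_L_inv phiInv_mul_phi phi_mul_phiInv c A i j]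
  change ∑ B, lam A B (phiInv q n c) * Dhat (phi q n c) i j B = _
  simp only [Dhat_eq hq]
  rfl

include hq hq1 hq2 in
theorem isSD_curv_Ahat (c : ℂ) : IsSD q ((fnCalc q n).matrix.curv (coef (Ahat q n c))) :=
  (isSeed_sum_pot hq hq1 hq2).isSD_curv hq hq1 hq2 phiInv_mul_phi phi_mul_phiInv c
    (coef_Ahat hq hq1 hq2 c)

include hq hq1 hq2 in
theorem isSelfDual_Ahat (c : ℂ) : IsSelfDual (Ahat q n c) :=
  isSelfDual_of_isSD hq hq2 (isSD_curv_Ahat hq hq1 hq2 c)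

end Functions

end QInst
end

noncomputable section
namespace QInst

/-! ### Elements commuting up to a factor -/

section QComm

variable {R : Type*} [Ring R] [Algebra ℂ R] {c d : ℂ} {a a' b b' : R}

/-- `a b = c b a`. -/
def QComm (c : ℂ) (a b : R) : Prop := a * b = c • (b * a)

theorem QComm.mul_left (h : QComm c a b) (h' : QComm d a' b) : QComm (c * d) (a * a') b := by
  rw [QComm, mul_assoc, h', mul_smul_comm, ← mul_assoc, h, smul_mul_assoc, smul_smul, mul_assoc,
    mul_comm d]

theorem QComm.mul_right (h : QComm c a b) (h' : QComm d a b') : QComm (c * d) a (b * b') := by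
  rw [QComm, ← mul_assoc, h, smul_mul_assoc, mul_assoc, h', mul_smul_comm, smul_smul, mul_assoc]

theorem QComm.sub_right (h : QComm c a b) (h' : QComm c a b') : QComm c a (b - b') := by
  rw [QComm, mul_sub, h, h', sub_mul, smul_sub]

theorem QComm.symm (h : QComm c a b) (hc : c ≠ 0) : QComm c⁻¹ b a := by
  rw [QComm, h, smul_smul, inv_mul_cancel₀ hc, one_smul]

theorem qComm_one : QComm 1 a b ↔ Commute a b := by
  rw [QComm, one_smul, commute_iff_eq]

theorem _root_.Commute.qComm (h : Commute a b) : QComm 1 a b := qComm_one.2 h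

theorem QComm.inv (h : QComm c a b) (h1 : a' * a = 1) (h2 : a * a' = 1) (hc : c ≠ 0) :
    QComm c⁻¹ a' b := by
  have h3 : a' * (a * b) * a' = c • (a' * (b * a) * a') := by
    rw [h, mul_smul_comm, smul_mul_assoc]
  rw [← mul_assoc, h1, one_mul, mul_assoc, mul_assoc, h2, mul_one] at h3
  rw [QComm, h3, smul_smul, inv_mul_cancel₀ hc, one_smul]

theorem QComm.congr (h : QComm c a b) (hc : c = d) : QComm d a b := hc ▸ h

end QComm

/-! ### Two quantum matrices -/

section Pair

variable {R : Type*} [Ring R] [Algebra ℂ R]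

/-- The relations between the matrices `z`, `z̄`, `y`, `ȳ`, with `w = |z|²`, `v = |y|²`,
`w' = |z - y|²`, `s = |z|⁻¹`, `t = |y|⁻¹`, `s' = |z - y|⁻¹`. -/
structure PairRel (q : ℂ) (z z' y y' w v w' s t s' : R) : Prop where
  z_mul : z * z' = w
  mul_z : z' * z = w
  y_mul : y * y' = v
  mul_y : y' * y = v
  sub_mul_sub : (z - y) * (z' - y') = w'
  sub_mul_sub' : (z' - y') * (z - y) = w'
  w_y : QComm (q⁻¹ ^ 2) w y
  w_y' : QComm (q⁻¹ ^ 2) w y'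
  v_z : QComm (q ^ 2) v z
  v_z' : QComm (q ^ 2) v z'
  s_w : s ^ 2 * w = 1
  w_s : w * s ^ 2 = 1
  s_z : Commute s z
  s_z' : Commute s z'
  s_y : QComm q s y
  s_y' : QComm q s y'
  t_y : Commute t y
  t_y' : Commute t y'
  t_z : QComm q⁻¹ t z
  t_z' : QComm q⁻¹ t z'
  t_s : QComm q t s
  s'_w' : s' ^ 2 * w' = 1
  w'_s' : w' * s' ^ 2 = 1
  root : ∀ a, Commute w' a → Commute s' a

namespace PairRel

variable {q : ℂ} {z z' y y' w v w' s t s' : R} (h : PairRel q z z' y y' w v w' s t s')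
include h

theorem s'_sub : Commute s' (z - y) := h.root _ <| by
  rw [commute_iff_eq]
  nth_rewrite 1 [← h.sub_mul_sub]
  rw [mul_assoc, h.sub_mul_sub']

theorem s'_sub' : Commute s' (z' - y') := h.root _ <| by
  rw [commute_iff_eq]
  nth_rewrite 1 [← h.sub_mul_sub']
  rw [mul_assoc, h.sub_mul_sub]

theorem r_z : QComm q⁻¹ (s * t) z := (h.s_z.qComm.mul_left h.t_z).congr (one_mul _)

theorem r_z' : QComm q⁻¹ (s * t) z' := (h.s_z'.qComm.mul_left h.t_z').congr (one_mul _)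

theorem r_y : QComm q (s * t) y := (h.s_y.mul_left h.t_y.qComm).congr (mul_one _)

theorem r_y' : QComm q (s * t) y' := (h.s_y'.mul_left h.t_y'.qComm).congr (mul_one _)

theorem w_z : Commute w z := by
  rw [commute_iff_eq]
  nth_rewrite 1 [← h.z_mul]
  rw [mul_assoc, h.mul_z]

theorem w_z' : Commute w z' := by
  rw [commute_iff_eq]
  nth_rewrite 1 [← h.mul_z]
  rw [mul_assoc, h.z_mul]

variable (hq : q ≠ 0)
include hq

/-- Moving `|z|²` past `y` and `|y|²` past `z` costs powers of `q` that amount to the rescaling `y ↦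
q² y` in one factor of `|z - y|²`. -/
theorem w'_z : w' * z = z * ((z' - y') * (z - q ^ 2 • y)) := by
  have e1 : y * (z' * z) = q ^ 2 • (z * (z' * y)) := by
    rw [h.mul_z, ← mul_assoc z, h.z_mul, h.w_y, smul_smul, ← mul_pow, mul_inv_cancel₀ hq, one_pow,
      one_smul]
  have e2 : y * (y' * z) = q ^ 2 • (z * (y' * y)) := by
    rw [← mul_assoc, h.y_mul, h.mul_y, h.v_z]
  rw [← h.sub_mul_sub]
  simp only [mul_sub, sub_mul, mul_assoc, mul_smul_comm, e1, e2]
  module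

theorem w'_y : w' * y = q⁻¹ ^ 2 • (y * ((z' - y') * (z - q ^ 2 • y))) := by
  have e1 : z * (z' * y) = q⁻¹ ^ 2 • (y * (z' * z)) := by
    rw [h.mul_z, ← mul_assoc z, h.z_mul, h.w_y]
  have e2 : z * (y' * y) = q⁻¹ ^ 2 • (y * (y' * z)) := by
    rw [h.mul_y, ← mul_assoc y, h.y_mul, h.v_z, smul_smul, ← mul_pow, inv_mul_cancel₀ hq, one_pow,
      one_smul]
  rw [← h.sub_mul_sub]
  simp only [mul_sub, sub_mul, mul_assoc, mul_smul_comm, e1, e2]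
  match_scalars <;> field_simp

/-- `z⁻¹ w'`. -/
theorem inv_mul_w' : z' * s ^ 2 * w' = (z' - y') * (z - q ^ 2 • y) * (z' * s ^ 2) := by
  have h1 : z * (z' * s ^ 2) = 1 := by rw [← mul_assoc, h.z_mul, h.w_s]
  have h2 : z' * s ^ 2 * z = 1 := by
    rw [mul_assoc, (h.s_z.pow_left 2).eq, ← mul_assoc, h.mul_z, h.w_s]
  rw [← mul_one (z' * s ^ 2 * w'), ← h1, ← mul_assoc, mul_assoc _ w', h.w'_z hq, ← mul_assoc _ z,
    h2, one_mul]

/-- `z` and `y` produce the same altered factor when `|z - y|²` is moved through them, so it cancels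
in `y z⁻¹` up to a power of `q`. -/
theorem w'_ratio : QComm (q⁻¹ ^ 2) w' (y * (z' * s ^ 2)) := by
  rw [QComm, ← mul_assoc, h.w'_y hq, smul_mul_assoc, mul_assoc y, ← h.inv_mul_w' hq, mul_assoc y]

/-- Here `y z̄ /(|z||y|)` is `y z⁻¹` times `|z|² |z|⁻¹ |y|⁻¹`. That last factor `q`-commutes with
both `z` and `y` in the same way, hence with `|z - y|²`, and exactly cancels the factor of
`w'_ratio`. -/
theorem w'_conj : Commute w' (y * z' * (s * t)) := by
  have hp : ∀ {a}, QComm (q⁻¹ ^ 2) w a ∧ QComm q (s * t) a ∨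
      QComm 1 w a ∧ QComm q⁻¹ (s * t) a → QComm q⁻¹ (w * (s * t)) a := by
    rintro a (⟨h1, h2⟩ | ⟨h1, h2⟩)
    · exact (h1.mul_left h2).congr (by field_simp)
    · exact (h1.mul_left h2).congr (one_mul _)
  have pz : QComm q⁻¹ (w * (s * t)) (z - y) :=
    (hp (Or.inr ⟨h.w_z.qComm, h.r_z⟩)).sub_right (hp (Or.inl ⟨h.w_y, h.r_y⟩))
  have pz' : QComm q⁻¹ (w * (s * t)) (z' - y') :=
    (hp (Or.inr ⟨h.w_z'.qComm, h.r_z'⟩)).sub_right (hp (Or.inl ⟨h.w_y', h.r_y'⟩))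
  have pw : QComm (q⁻¹ ^ 2) (w * (s * t)) w' := by
    rw [← h.sub_mul_sub]
    exact (pz.mul_right pz').congr (by ring)
  have e : y * z' * (s * t) = y * (z' * s ^ 2) * (w * (s * t)) := by
    simp only [mul_assoc]
    rw [← mul_assoc (s ^ 2) w, h.s_w, one_mul]
  rw [e, ← qComm_one]
  refine ((h.w'_ratio hq).mul_right (pw.symm (by positivity))).congr ?_
  field_simp

theorem conj_eq : t * y * (s * z') = y * z' * (s * t) := by
  have h1 : t * z' * s = q⁻¹ • (z' * (t * s)) := by rw [h.t_z', smul_mul_assoc, mul_assoc]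
  rw [h.t_y.eq, h.s_z'.eq, mul_assoc, ← mul_assoc t, h1, h.t_s, mul_smul_comm, mul_smul_comm, mul_smul_comm,
    smul_smul, inv_mul_cancel₀ hq, one_smul, mul_assoc]

/-- Without norms the swap is `z̄ y (z̄ - q²ȳ) = (z̄ - ȳ) y z̄`, which follows from `|y|² z̄ = q² z̄
|y|²`. Moving `|z|⁻¹|y|⁻¹` past `z̄ - ȳ` supplies the `q²`, and `|z - y|⁻¹` passes by `w'_conj`. -/
theorem gauge_eq : s * z' * (t * y) * (s' * (z' - y')) = s' * (z' - y') * (t * y) * (s * z') := by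
  have h1 : s * z' * (t * y) = q • (z' * y * (s * t)) := by
    rw [h.s_z'.eq, h.t_y.eq, mul_assoc, ← mul_assoc s, h.s_y, smul_mul_assoc, mul_smul_comm]
    simp only [mul_assoc]
  have h2 : s * t * (z' - y') = (q⁻¹ • z' - q • y') * (s * t) := by
    rw [mul_sub, h.r_z', h.r_y', sub_mul, smul_mul_assoc, smul_mul_assoc]
  have h3 : z' * y * (z' - q ^ 2 • y') = (z' - y') * (y * z') := by
    have : y' * (y * z') = q ^ 2 • (z' * (y * y')) := by
      rw [← mul_assoc, h.mul_y, h.y_mul, h.v_z']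
    rw [sub_mul, this, mul_sub, mul_smul_comm]
    simp only [mul_assoc]
  have h4 : q • (q⁻¹ • z' - q • y') = z' - q ^ 2 • y' := by
    rw [smul_sub, smul_smul, smul_smul, mul_inv_cancel₀ hq, one_smul, pow_two]
  rw [mul_assoc (s' * (z' - y')) (t * y), h.conj_eq hq, h.s'_sub'.eq, ← mul_assoc, h1, mul_assoc (z' - y') s',
    (h.root _ (h.w'_conj hq)).eq, ← mul_assoc (z' - y'), ← mul_assoc (z' - y'), ← h3,
    smul_mul_assoc, mul_assoc (z' * y), h2, ← h4]
  simp only [mul_smul_comm, smul_mul_assoc, mul_assoc]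

end PairRel

end Pair

end QInst
end

noncomputable section
namespace QInst

namespace Calculus

/-! ### The singular gauge transformation -/

section GaugeTwo

variable {R : Type*} [Ring R] [Algebra ℂ R] {K : Calculus R}

theorem sum_L_mul_sum_L (f g : R) (x : Ix → R) (A : Ix) :
    ∑ B, K.L A B f * ∑ E, K.L B E g * x E = ∑ E, K.L A E (f * g) * x E := by
  simp only [K.L_mul, Finset.mul_sum, Finset.sum_mul, mul_assoc]
  exact Finset.sum_comm

/-- Apply `L` to `fg = gf`: both sides acquire the same factor `r`. -/
theorem IsDiag.commute_L {f g : R} {r : ℂ} (h : K.IsDiag f r) (hr : r ≠ 0) (hc : Commute f g)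
    (A B : Ix) : Commute f (K.L A B g) := by
  have h1 := congrArg (K.L A B) hc.eq
  rw [h.L_mul, h.L_mul_right] at h1
  exact smul_right_injective R hr h1

variable (K) in
/-- The coefficients of `V dU`. -/
def pure (U V : R) (A : Ix) : R := ∑ B, K.L A B V * K.D B U

theorem D_mul_const {f g : R} (hg : ∀ A, K.D A g = 0) (A : Ix) :
    K.D A (f * g) = K.D A f * g := by
  simp [K.D_mul, hg]

variable {U₁ V₁ U₂ V₂ G G' : R} (h₁ : U₁ * V₁ = 1) (h₁' : V₁ * U₁ = 1) (h₂ : U₂ * V₂ = 1)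
  (h₂' : V₂ * U₂ = 1) (hG : G * G' = 1) (hG' : G' * G = 1)

theorem inv_triple_eq {R : Type*} [Ring R] {U₁ V₁ U₂ V₂ G G' : R} (h₁ : U₁ * V₁ = 1)
    (h₁' : V₁ * U₁ = 1) (h₂ : U₂ * V₂ = 1) (h₂' : V₂ * U₂ = 1) (hG : G * G' = 1)
    (hG' : G' * G = 1) :
    U₁ * G * U₂ * (V₂ * G' * V₁) = 1 ∧ V₂ * G' * V₁ * (U₁ * G * U₂) = 1 := by
  constructor
  · rw [mul_assoc V₂, mul_assoc (U₁ * G), ← mul_assoc U₂, h₂, one_mul, mul_assoc U₁, ← mul_assoc G,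
      hG, one_mul, h₁]
  · rw [mul_assoc U₁, mul_assoc (V₂ * G'), ← mul_assoc V₁, h₁', one_mul, mul_assoc V₂,
      ← mul_assoc G', hG', one_mul, h₂']

include h₁ h₁' h₂ h₂' hG hG' in
theorem gauge_two (hU : U₁ * G * U₂ = U₂ * G * U₁) (dG : ∀ A, K.D A G = 0) {u₁ u₂ p : R} {r b : ℂ}
    (hr : r ≠ 0) (d₁ : K.IsDiag u₁ r) (d₂ : K.IsDiag u₂ r) (c₁ : Commute u₁ (U₁ * G * U₂))
    (c₂ : Commute u₂ (U₁ * G * U₂)) (hl : p * (1 + b • (u₁ + u₂)) = 1)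
    (hr' : (1 + b • (u₁ + u₂)) * p = 1) {ω : Ix → R}
    (hω : ∀ B, ω B =
      -(b • (p * (u₁ * (K.D B U₁ * V₁) + u₂ * (K.D B U₂ * V₂))))) (A : Ix) :
    K.gauge ω (U₁ * G * U₂) (V₂ * G' * V₁) A =
      p * (K.pure U₁ V₁ A + b • (u₂ * K.pure U₁ V₁ A + u₁ * K.pure U₂ V₂ A) +
        ∑ B, K.L A B (V₁ * G') * (K.pure U₂ V₂ B * (G * U₁))) := by
  obtain ⟨hUV, hVU⟩ := inv_triple_eq h₁ h₁' h₂ h₂' hG hG'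
  obtain ⟨hUV', hVU'⟩ := inv_triple_eq h₂ h₂' h₁ h₁' hG hG'
  set U := U₁ * G * U₂ with hUdef
  set V := V₂ * G' * V₁ with hVdef
  -- The two factorisations of `U` give two factorisations of its inverse.
  have hV : V = V₁ * G' * V₂ := by
    rw [← mul_one V, ← hUV', ← hU, ← mul_assoc, hVU, one_mul]
  have cV : ∀ {u}, Commute u U → K.IsDiag u r → ∀ A B, Commute u (K.L A B V) := fun hu hd A B =>
    hd.commute_L hr (commute_inv hVU hUV hu) A B
  have cp : ∀ A B, Commute p (K.L A B V) := fun A B =>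
    (commute_inv hl hr' ((Commute.one_right _).add_right
      (((cV c₁ d₁ A B).symm.add_right (cV c₂ d₂ A B).symm).smul_right b))).symm
  have dU : ∀ {U₁ V₁ U₂ : R}, V₁ * U₁ = 1 → ∀ B, K.D B (U₁ * G * U₂) =
      ∑ E, K.L B E (U₁ * G) * K.D E U₂ + K.D B U₁ * V₁ * (U₁ * G * U₂) := by
    intro U₁ V₁ U₂ hV B
    rw [K.D_mul, D_mul_const dG]
    congr 1
    rw [mul_assoc _ V₁, mul_assoc U₁, ← mul_assoc V₁, hV, one_mul, mul_assoc]
  have e1 : ∀ B, K.D B U = ∑ E, K.L B E (U₁ * G) * K.D E U₂ + K.D B U₁ * V₁ * U := dU h₁'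
  have e2 : ∀ B, K.D B U = ∑ E, K.L B E (U₂ * G) * K.D E U₁ + K.D B U₂ * V₂ * U := by
    rw [hU]
    exact dU h₂'
  -- Write `dU = p (1 + b(u₁ + u₂)) dU` and expand `u₁ dU`, `u₂ dU` in opposite orders of `U`. The
  -- terms `u_i dU_i V_i U` cancel against `ωU`.
  have e3 : ∀ B, ω B * U + K.D B U = p * (K.D B U + b • (u₁ * ∑ E, K.L B E (U₁ * G) * K.D E U₂ +
      u₂ * ∑ E, K.L B E (U₂ * G) * K.D E U₁)) := by
    intro B
    have e4 : K.D B U = p * (1 + b • (u₁ + u₂)) * K.D B U := by rw [hl, one_mul]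
    rw [eq_sub_of_add_eq (e1 B).symm, eq_sub_of_add_eq (e2 B).symm, hω]
    nth_rewrite 1 [e4]
    simp only [neg_mul, smul_mul_assoc, mul_add, add_mul, mul_sub, mul_smul_comm, mul_one, mul_assoc]
    module
  have f1 : V * (U₁ * G) = V₂ := by
    rw [hVdef, mul_assoc, ← mul_assoc V₁, h₁', one_mul, mul_assoc, hG', mul_one]
  have f2 : V * (U₂ * G) = V₁ := by
    rw [hV, mul_assoc, ← mul_assoc V₂, h₂', one_mul, mul_assoc, hG', mul_one]
  have g1 : ∑ B, K.L A B V * K.D B U = K.pure U₁ V₁ A +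
      ∑ B, K.L A B (V₁ * G') * (K.pure U₂ V₂ B * (G * U₁)) := by
    have e5 : ∀ B, K.D B U = ∑ E, K.L B E (U₂ * G) * K.D E U₁ + K.D B U₂ * (G * U₁) := by
      intro B
      rw [hU, K.D_mul, D_mul_const dG, mul_assoc]
    simp only [e5, mul_add, Finset.sum_add_distrib]
    rw [sum_L_mul_sum_L, f2]
    congr 1
    simp only [pure, Finset.sum_mul, mul_assoc (K.L _ _ V₂)]
    rw [sum_L_mul_sum_L, ← hV]
  have g2 : ∑ B, K.L A B V * (u₁ * ∑ E, K.L B E (U₁ * G) * K.D E U₂) = u₁ * K.pure U₂ V₂ A := by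
    simp only [← mul_assoc _ u₁, ← (cV c₁ d₁ _ _).eq]
    simp only [mul_assoc u₁, ← Finset.mul_sum]
    rw [sum_L_mul_sum_L, f1, pure]
  have g3 : ∑ B, K.L A B V * (u₂ * ∑ E, K.L B E (U₂ * G) * K.D E U₁) = u₂ * K.pure U₁ V₁ A := by
    simp only [← mul_assoc _ u₂, ← (cV c₂ d₂ _ _).eq]
    simp only [mul_assoc u₂, ← Finset.mul_sum]
    rw [sum_L_mul_sum_L, f2, pure]
  simp only [gauge, e3]
  simp only [← mul_assoc _ p, ← (cp _ _).eq]
  simp only [mul_assoc p, ← Finset.mul_sum, mul_add, Finset.sum_add_distrib, mul_smul_comm,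
    ← Finset.smul_sum, g1, g2, g3]
  simp only [smul_add]
  abel

end GaugeTwo

end Calculus

end QInst
end

noncomputable section
namespace QInst

/-! ### The matrices `z̄ / |z|` -/

section Scalar

variable {q : ℂ} {S : Type*} [Ring S]

theorem scalar_mul_apply (f : S) (M : Matrix (Fin 2) (Fin 2) S) (i j : Fin 2) :
    (Matrix.scalar (Fin 2) f * M) i j = f * M i j := by
  simp [Matrix.scalar_apply]

theorem mul_scalar_apply (f : S) (M : Matrix (Fin 2) (Fin 2) S) (i j : Fin 2) :
    (M * Matrix.scalar (Fin 2) f) i j = M i j * f := by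
  simp [Matrix.scalar_apply]

theorem smul_eq_scalar_mul (f : S) (M : Matrix (Fin 2) (Fin 2) S) :
    f • M = Matrix.scalar (Fin 2) f * M := by
  ext i j
  rw [scalar_mul_apply, Matrix.smul_apply, smul_eq_mul]

variable [Algebra ℂ S]

theorem scalar_smul (c : ℂ) (f : S) :
    Matrix.scalar (Fin 2) (c • f) = c • Matrix.scalar (Fin 2) f := by
  ext i j
  simp only [Matrix.scalar_apply, Matrix.smul_apply, Matrix.diagonal_apply]
  split_ifs <;> simp

theorem qComm_scalar_iff {c : ℂ} {f : S} {M : Matrix (Fin 2) (Fin 2) S} :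
    QComm c (Matrix.scalar (Fin 2) f) M ↔ ∀ i j, QComm c f (M i j) := by
  simp only [QComm, ← Matrix.ext_iff, Matrix.smul_apply, scalar_mul_apply, mul_scalar_apply]

theorem commute_scalar_iff {f : S} {M : Matrix (Fin 2) (Fin 2) S} :
    Commute (Matrix.scalar (Fin 2) f) M ↔ ∀ i j, Commute f (M i j) := by
  simp only [← qComm_one, qComm_scalar_iff]

theorem QComm.scalar {c : ℂ} {f g : S} (h : QComm c f g) :
    QComm c (Matrix.scalar (Fin 2) f) (Matrix.scalar (Fin 2) g) := by
  rw [QComm, ← map_mul, h, scalar_smul, map_mul]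

theorem qbar_sub (z y : Matrix (Fin 2) (Fin 2) S) : qbar q (z - y) = qbar q z - qbar q y := by
  ext i j
  simp only [qbar, Matrix.of_apply, Matrix.sub_apply, smul_sub, Finset.sum_sub_distrib]

theorem QComm.qbar {c : ℂ} {f : S} {z : Matrix (Fin 2) (Fin 2) S} (h : ∀ i j, QComm c f (z i j))
    (i j : Fin 2) : QComm c f (qbar q z i j) := by
  have h' : ∀ i j, f * z i j = c • (z i j * f) := h
  simp only [QComm, QInst.qbar, Matrix.of_apply, Finset.mul_sum, Finset.sum_mul, Finset.smul_sum,
    mul_smul_comm, smul_mul_assoc, h', smul_comm c]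

variable {K : Calculus S}

theorem Calculus.IsDiag.scalar {f : S} {r : ℂ} (h : K.IsDiag f r) :
    K.matrix.IsDiag (Matrix.scalar (Fin 2) f) r := by
  intro A B
  ext i j
  rw [Calculus.matrix_L, Matrix.scalar_apply, Matrix.diagonal_apply, apply_ite (K.L A B), h A B,
    map_zero]
  by_cases hAB : A = B <;> by_cases hij : i = j <;> simp [hAB, hij]

theorem Calculus.matrix_D_scalar (f : S) (A : Ix) :
    K.matrix.D A (Matrix.scalar (Fin 2) f) = Matrix.scalar (Fin 2) (K.D A f) := by
  ext i j
  simp only [Calculus.matrix_D, Matrix.scalar_apply, Matrix.diagonal_apply]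
  split_ifs <;> simp

end Scalar

namespace Calculus

variable {q : ℂ} {S : Type*} [Ring S] [Algebra ℂ S] {K : Calculus S}
  {z : Matrix (Fin 2) (Fin 2) S} {s ρ : S}

theorem IsDual.D_qbar (hd : K.IsDual z) (A : Ix) (i j : Fin 2) :
    K.D A (qbar q z i j) = (epsUp q i A.2 * epsLow q A.1 j) • 1 := by
  simp only [qbar, Matrix.of_apply, map_sum, map_smul]
  have h1 : ∀ k l, K.D A (z l k) = if A = (l, k) then 1 else 0 := fun k l => hd A (l, k)
  simp only [h1, Prod.ext_iff, ite_and, smul_ite, smul_zero]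
  simp

/-- This writes `𝒟̂` of a single-pole potential as that potential times `dU V` with `U = z̄/|z|`,
the form of the potential required by `gauge_two` with `b = c q⁻²`. -/
theorem IsSize.dhat_pot (hq : q ≠ 0) (hq1 : q + 1 ≠ 0) (hq2 : q ^ 2 + 1 ≠ 0)
    (h : K.IsPole q z s) (hρ : K.IsSize z s ρ) (A : Ix) :
    K.dhat q (ρ * s ^ 2) A = -(q⁻¹ ^ 2 • (Matrix.scalar (Fin 2) (ρ * s ^ 2) *
      (K.matrix.D A (Matrix.scalar (Fin 2) s * qbar q z) * (Matrix.scalar (Fin 2) s * z)))) := by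
  have hz : ∀ m, Commute (Matrix.scalar (Fin 2) (s ^ m)) z := fun m =>
    commute_scalar_iff.2 fun i j => (h.comm i j).pow_left m
  have e1 : K.matrix.D A (Matrix.scalar (Fin 2) s * qbar q z) * (Matrix.scalar (Fin 2) s * z) =
      q⁻¹ • (Matrix.scalar (Fin 2) (s ^ 2) * (K.matrix.D A (qbar q z) * z)) -
        (q⁻¹ / (q + 1) * q⁻¹ ^ 2) • Matrix.scalar (Fin 2) (s ^ 2 * low q z A) := by
    have e2 : Commute (Matrix.scalar (Fin 2) s) (K.matrix.D A (qbar q z)) :=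
      commute_scalar_iff.2 fun i j => by
        rw [Calculus.matrix_D, h.dual.D_qbar]
        exact (Commute.one_right _).smul_right _
    have e3 : Commute (Matrix.scalar (Fin 2) s) (qbar q z) :=
      commute_scalar_iff.2 fun i j => qComm_one.1 (QComm.qbar (fun i j => (h.comm i j).qComm) i j)
    rw [h.diag.scalar.D_mul, matrix_D_scalar, h.D_inv hq hq2, scalar_smul, add_mul,
      smul_mul_assoc, smul_mul_assoc, smul_mul_assoc, neg_smul, ← sub_eq_add_neg]
    congr 2
    · rw [pow_two, map_mul, mul_assoc, ← mul_assoc _ _ z, ← e2.eq]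
      simp only [mul_assoc]
    · rw [mul_assoc, ← mul_assoc (qbar q z), ← e3.eq, mul_assoc _ (qbar q z),
        h.coord.qbar_mul hq hq2, ← map_mul, ← map_mul]
      congr 1
      rw [mul_assoc (s ^ 3), ← mul_assoc _ s, ← (h.commute_low A).eq, mul_assoc s,
        ← (Calculus.commute_low (fun i j => h.coord.commute_qdet hq hq2 i j) A).eq, ← mul_assoc s,
        ← mul_assoc (s ^ 3), ← mul_assoc (s ^ 3), ← pow_succ, show s ^ (3 + 1) = s ^ 2 * s ^ 2 by
        rw [← pow_add], mul_assoc (s ^ 2), h.inv_left, mul_one]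
  have e4 : ∀ i j, (K.matrix.D A (qbar q z) * z) i j =
      ∑ c, (epsUp q i A.2 * epsUp q j c) • low q z (A.1, c) := by
    intro i j
    have e5 : ∀ l, ∑ c, epsUp q j c * epsLow q c l = if j = l then 1 else 0 := by
      intro l
      simp only [Fin.sum_univ_two, epsUp, epsLow]
      fin_cases j <;> fin_cases l <;> simp [hq]
    have e6 : ∑ c, (epsUp q i A.2 * epsUp q j c) • low q z (A.1, c) =
        ∑ F : Ix, (epsUp q i A.2 * epsLow q A.1 F.1 * ∑ c, epsUp q j c * epsLow q c F.2) •
          z F.1 F.2 := by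
      simp only [low, Finset.smul_sum, smul_smul]
      rw [Finset.sum_comm]
      simp only [← Finset.sum_smul, Finset.mul_sum]
      refine Finset.sum_congr rfl fun F _ => ?_
      congr 1
      exact Finset.sum_congr rfl fun c _ => by ring
    rw [e6, Matrix.mul_apply, Fintype.sum_prod_type]
    simp [e5, h.dual.D_qbar]
  rw [e1]
  ext i j
  have e7 : ∀ f, ρ * s ^ 2 * (s ^ 2 * f) = ρ * s ^ 4 * f := by
    intro f
    simp only [mul_assoc, ← mul_assoc (s ^ 2) (s ^ 2), ← pow_add]
  rw [Matrix.neg_apply, Matrix.smul_apply, scalar_mul_apply, Matrix.sub_apply, Matrix.smul_apply,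
    Matrix.smul_apply, scalar_mul_apply, e4, Matrix.scalar_apply, Matrix.diagonal_apply, dhat,
    Matrix.of_apply]
  simp only [hρ.D_pot hq hq1 hq2 h, Fin.sum_univ_two]
  by_cases hij : i = j
  · simp only [hij, if_true, mul_add, mul_sub, mul_smul_comm, e7]
    match_scalars <;> field_simp
  · simp only [hij, if_false, mul_add, mul_sub, mul_smul_comm, e7, smul_zero, mul_zero]
    match_scalars <;> field_simp

/-- The coefficients of `|z| z⁻¹ d(z̄ |z|⁻¹)` with respect to `z^A |z|⁻²`. -/
def poleCoef (q : ℂ) (A : Ix) (i j : Fin 2) (F : Ix) : ℂ :=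
  (if i = j then q⁻¹ / (q + 1) * q⁻¹ ^ 2 * (epsLow q A.1 F.1 * epsLow q A.2 F.2) else 0) -
    if A.1 = i then q⁻¹ * (epsUp q A.2 F.2 * epsLow q F.1 j) else 0

/-- Use `V dU = -(dV) U`: in `V = z/|z|` the derivative of `z` is constant, so a single power of `z`
times `|z|⁻²` survives. -/
theorem IsPole.pure_apply (hq : q ≠ 0) (hq2 : q ^ 2 + 1 ≠ 0)
    (h : K.IsPole q z s) (A : Ix) (i j : Fin 2) :
    K.matrix.pure (Matrix.scalar (Fin 2) s * qbar q z) (Matrix.scalar (Fin 2) s * z) A i j =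
      ∑ F : Ix, poleCoef q A i j F • (z F.1 F.2 * s ^ 2) := by
  have e3 : Commute (Matrix.scalar (Fin 2) s) (qbar q z) :=
      commute_scalar_iff.2 fun i j => qComm_one.1 (QComm.qbar (fun i j => (h.comm i j).qComm) i j)
  have hz : Commute (Matrix.scalar (Fin 2) s) z := commute_scalar_iff.2 h.comm
  have h1 : (Matrix.scalar (Fin 2) s * z) * (Matrix.scalar (Fin 2) s * qbar q z) = 1 := by
    rw [mul_assoc, ← mul_assoc z, ← hz.eq, mul_assoc _ z, h.coord.mul_qbar hq hq2, ← map_mul,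
      ← map_mul, ← mul_assoc, ← pow_two, h.inv_left, map_one]
  have h2 := K.matrix.D_mul A (Matrix.scalar (Fin 2) s * z) (Matrix.scalar (Fin 2) s * qbar q z)
  rw [h1, D_one] at h2
  have h3 := eq_neg_of_add_eq_zero_left h2.symm
  rw [← pure] at h3
  rw [h3, h.diag.scalar.D_mul, matrix_D_scalar, h.D_inv hq hq2, scalar_smul, add_mul]
  have h4 : Matrix.scalar (Fin 2) (s ^ 3 * low q z A) * z * (Matrix.scalar (Fin 2) s * qbar q z) =
      Matrix.scalar (Fin 2) (low q z A * s ^ 2) := by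
    rw [mul_assoc, ← mul_assoc z, ← hz.eq, mul_assoc _ z, h.coord.mul_qbar hq hq2, ← map_mul,
      ← map_mul]
    congr 1
    rw [((h.commute_low A).pow_left 3).eq, mul_assoc, ← mul_assoc (s ^ 3), ← pow_succ,
      show s ^ (3 + 1) = s ^ 2 * s ^ 2 by rw [← pow_add], mul_assoc (s ^ 2), h.inv_left, mul_one]
  have h5 : (q⁻¹ • (Matrix.scalar (Fin 2) s * K.matrix.D A z)) *
      (Matrix.scalar (Fin 2) s * qbar q z) =
      q⁻¹ • (K.matrix.D A z * qbar q z * Matrix.scalar (Fin 2) (s ^ 2)) := by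
    have e2 : Commute (Matrix.scalar (Fin 2) s) (K.matrix.D A z) :=
      commute_scalar_iff.2 fun i j => by
        rw [Calculus.matrix_D, h.dual A (i, j)]
        split_ifs
        exacts [Commute.one_right _, Commute.zero_right _]
    rw [smul_mul_assoc, e2.eq, e3.eq, pow_two, map_mul, mul_assoc, ← mul_assoc _ (qbar q z), e3.eq]
    simp only [mul_assoc]
  have h6 : ∀ i j, (K.matrix.D A z * qbar q z) i j = if A.1 = i then qbar q z A.2 j else 0 := by
    intro i j
    have : ∀ k, K.D A (z i k) = if A = (i, k) then 1 else 0 := fun k => h.dual A (i, k)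
    simp only [Matrix.mul_apply, Calculus.matrix_D, this, Prod.ext_iff, ite_and, ite_mul, one_mul,
      zero_mul]
    simp
  rw [h5, smul_mul_assoc, smul_mul_assoc, h4, Matrix.neg_apply, Matrix.add_apply,
    Matrix.smul_apply, Matrix.smul_apply, mul_scalar_apply, h6, Matrix.scalar_apply,
    Matrix.diagonal_apply]
  have h7 : ∀ j, qbar q z A.2 j = ∑ F : Ix, (epsUp q A.2 F.2 * epsLow q F.1 j) • z F.1 F.2 := by
    intro j
    rw [Fintype.sum_prod_type, Finset.sum_comm]
    rfl
  simp only [poleCoef, sub_smul, Finset.sum_sub_distrib, ite_smul, zero_smul, h7, low,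
    Finset.sum_mul, smul_mul_assoc]
  split_ifs <;> simp only [Fintype.sum_prod_type, Fin.sum_univ_two, zero_mul, smul_zero,
    add_mul, smul_mul_assoc] <;> module

end Calculus

end QInst
end

/-! ### Clearing the denominators of the two-pole expression -/

noncomputable section
namespace QInst

namespace PairRel

section Regular

variable {R : Type*} [Ring R] [Algebra ℂ R] {q : ℂ} {z z' y y' w v w' s t s' : R}
  (h : PairRel q z z' y y' w v w' s t s')
include h

theorem qComm_t_w : QComm (q⁻¹ ^ 2) t w := by
  rw [← h.z_mul]
  exact (h.t_z.mul_right h.t_z').congr (by ring)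

theorem r_conj_w (hq : q ≠ 0) :
    s * t * (y * z' * (s * t)) * w = q⁻¹ ^ 3 • (y * z' * t ^ 2) := by
  have h1 : s * t * (y * z') = y * z' * (s * t) :=
    ((h.r_y.mul_right h.r_z').congr (mul_inv_cancel₀ hq)).trans (one_smul _ _)
  have h2 : s * t * (s * t) = q • (s ^ 2 * t ^ 2) := by
    rw [mul_assoc, ← mul_assoc t, h.t_s, smul_mul_assoc, mul_smul_comm, pow_two, pow_two]
    simp only [mul_assoc]
  have h3 : t ^ 2 * w = q⁻¹ ^ 4 • (w * t ^ 2) := by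
    rw [pow_two]
    exact ((h.qComm_t_w).mul_left (h.qComm_t_w)).congr (by ring)
  rw [← mul_assoc, h1, mul_assoc (y * z'), h2, mul_assoc, smul_mul_assoc, mul_assoc (s ^ 2), h3,
    mul_smul_comm, mul_smul_comm, mul_smul_comm, smul_smul, ← mul_assoc (s ^ 2), h.s_w, one_mul]
  congr 1
  field_simp

variable {ρ ρ' p : R} {b : ℂ} (u_z : Commute (ρ * s ^ 2) z) (u_z' : Commute (ρ * s ^ 2) z')
  (u_y : Commute (ρ * s ^ 2) y) (u_y' : Commute (ρ * s ^ 2) y')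
  (u_ρ' : QComm (q ^ 2) (ρ * s ^ 2) ρ')
  (ρ'_z : Commute ρ' z) (ρ'_z' : Commute ρ' z') (ρ'_y : Commute ρ' y) (ρ'_y' : Commute ρ' y')
  (ρ'_s : Commute ρ' s)
include u_z u_z' u_y u_y'

theorem u_s' : Commute (ρ * s ^ 2) s' := by
  refine (h.root _ ?_).symm
  rw [← h.sub_mul_sub]
  exact ((u_z.sub_right u_y).mul_right (u_z'.sub_right u_y')).symm

include ρ'_z ρ'_z' ρ'_y ρ'_y' in
omit u_z u_z' u_y u_y' in
theorem ρ'_s' : Commute ρ' s' := by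
  refine (h.root _ ?_).symm
  rw [← h.sub_mul_sub]
  exact ((ρ'_z.sub_right ρ'_y).mul_right (ρ'_z'.sub_right ρ'_y')).symm

include u_ρ' ρ'_z ρ'_z' ρ'_y ρ'_y' ρ'_s

/-- The rational part of the regular potential is a polynomial over the denominator. -/
theorem regular_eq (hq : q ≠ 0) (hl : p * (1 + b • (ρ * s ^ 2 + ρ' * s' ^ 2)) = 1)
    (hr : (1 + b • (ρ * s ^ 2 + ρ' * s' ^ 2)) * p = 1) :
    p * (z' * s ^ 2 + b • (ρ' * s' ^ 2 * (z' * s ^ 2) + ρ * s ^ 2 * ((z' - y') * s' ^ 2))) =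
      ((z' - y') * (z - q ^ 2 • y) * z' + b • (ρ' * z' + (z' - y') * ρ)) *
        (s ^ 2 * s' ^ 2 * p) := by
  have us' := h.u_s' u_z u_z' u_y u_y'
  have ρs' := h.ρ'_s' ρ'_z ρ'_z' ρ'_y ρ'_y'
  have ss : s' ^ 2 * w' = 1 := h.s'_w'
  have I₂ : (z' - y') * s' ^ 2 * (z - y) = 1 := by
    rw [mul_assoc, (h.s'_sub.pow_left 2).eq, ← mul_assoc, h.sub_mul_sub', h.w'_s']
  have I₁ : z * (z' * s ^ 2) = 1 := by rw [← mul_assoc, h.z_mul, h.w_s]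
  set i₁ := z' * s ^ 2 with hi₁
  set i₂ := (z' - y') * s' ^ 2 with hi₂
  set u := ρ * s ^ 2 with hu
  set u' := ρ' * s' ^ 2 with hu'
  have u_i₂ : Commute u i₂ := (u_z'.sub_right u_y').mul_right (us'.pow_right 2)
  have u_i₁ : Commute u i₁ := by
    have : i₁ = (z' * s ^ 2) * (z * i₁) := by rw [I₁, mul_one]
    have h1 : i₁ * z = 1 := by
      rw [hi₁, mul_assoc, (h.s_z.pow_left 2).eq, ← mul_assoc, h.mul_z, h.w_s]
    exact Calculus.commute_inv h1 I₁ u_z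
  have u'_i₂ : Commute u' i₂ :=
    ((ρ'_z'.sub_right ρ'_y').mul_right (ρs'.pow_right 2)).mul_left
      ((h.s'_sub'.mul_right ((Commute.refl s').pow_right 2)).pow_left 2)
  -- The resolvent identity for `i₁ = z⁻¹` and `i₂ = (z - y)⁻¹`: their difference is `Q`, which
  -- commutes with `u` and `q`-commutes with `u'`.
  set Q := i₂ * (y * i₁) with hQ
  have Qeq : Q = i₂ - i₁ := by
    have : Q = i₂ * (z * i₁) - i₂ * (z - y) * i₁ := by rw [hQ]; noncomm_ring
    rw [this, I₁, I₂, mul_one, one_mul]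
  have u_Q : Commute u Q := by
    rw [Qeq]
    exact u_i₂.sub_right u_i₁
  have u'_Q : QComm (q ^ 2) u' Q := by
    have h1 : QComm (q ^ 2) (s' ^ 2) (y * i₁) :=
      ((h.w'_ratio hq).inv h.s'_w' h.w'_s' (by positivity)).congr (by field_simp)
    have h2 : Commute ρ' (y * i₁) := ρ'_y.mul_right (ρ'_z'.mul_right (ρ'_s.pow_right 2))
    exact (u'_i₂.qComm.mul_right ((h2.qComm.mul_left h1).congr (one_mul _))).congr (one_mul _)
  have u_u' : u * u' = q ^ 2 • (u' * u) :=
    (u_ρ'.mul_right (us'.pow_right 2).qComm).congr (mul_one _)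
  have h3 : u' * (Q * u) = Q * (u * u') := by
    rw [← mul_assoc, u'_Q, u_u', smul_mul_assoc, mul_smul_comm, mul_assoc]
  -- The powers of `q` in `u'Q` and `u u'` match, so `1 + b(u + u')` can be moved through, the term
  -- `u' i₁` becoming `i₁ u'`. Hence `p` passes to the right.
  have h4 : (i₁ + b • (u' * i₁ + u * i₂)) * (1 + b • (u + u')) =
      (1 + b • (u + u')) * (i₁ + b • (i₁ * u' + u * i₂)) := by
    have e1 : i₁ = i₂ - Q := by rw [Qeq]; abel
    have e2 : i₁ + b • (u' * i₁ + u * i₂) = (1 + b • (u + u')) * i₂ - (Q + b • (u' * Q)) := by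
      rw [e1, mul_sub, add_mul, one_mul, smul_mul_assoc, add_mul]
      module
    have e3 : i₁ + b • (i₁ * u' + u * i₂) = i₂ * (1 + b • (u + u')) - (Q + b • (Q * u')) := by
      rw [e1, sub_mul, mul_add i₂, mul_one, mul_smul_comm, mul_add, u_i₂.eq]
      module
    have e4 : u * (Q * u') = Q * (u * u') := by rw [← mul_assoc, u_Q.eq, mul_assoc]
    have e5 : (Q + b • (u' * Q)) * (1 + b • (u + u')) =
        (1 + b • (u + u')) * (Q + b • (Q * u')) := by
      simp only [mul_add, add_mul, smul_add, mul_smul_comm, smul_mul_assoc, mul_one, one_mul,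
        mul_assoc, h3, e4, u_Q.eq]
      module
    rw [e2, e3, sub_mul, mul_sub, e5]
    simp only [mul_assoc]
  have h5 : p * (i₁ + b • (u' * i₁ + u * i₂)) = (i₁ + b • (i₁ * u' + u * i₂)) * p := by
    rw [← mul_one (p * _), ← hr, ← mul_assoc, mul_assoc p, h4, ← mul_assoc p, hl, one_mul]
  -- With `p` on the right, inserting this clears every pole in the remaining left factor.
  have h6 : p = w' * w * (s ^ 2 * s' ^ 2 * p) := by
    rw [mul_assoc, ← mul_assoc w, ← mul_assoc w, h.w_s, one_mul, ← mul_assoc, h.w'_s', one_mul]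
  have h7 : i₁ * w = z' := by rw [hi₁, mul_assoc, h.s_w, mul_one]
  have f1 : i₁ * (w' * w) = (z' - y') * (z - q ^ 2 • y) * z' := by
    rw [← mul_assoc, h.inv_mul_w' hq, mul_assoc, h7]
  have f2 : i₁ * u' * (w' * w) = ρ' * z' := by
    have : Commute ρ' i₁ := ρ'_z'.mul_right (ρ'_s.pow_right 2)
    rw [hu', mul_assoc, mul_assoc ρ', ← mul_assoc (s' ^ 2), h.s'_w', one_mul, ← mul_assoc,
      ← this.eq, mul_assoc, h7]
  have f3 : u * i₂ * (w' * w) = (z' - y') * ρ := by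
    rw [hi₂, mul_assoc, mul_assoc (z' - y'), ← mul_assoc (s' ^ 2), h.s'_w', one_mul, ← mul_assoc,
      (u_z'.sub_right u_y').eq, mul_assoc, hu, mul_assoc, h.s_w, mul_one]
  rw [h5]
  nth_rewrite 1 [h6]
  rw [← mul_assoc, add_mul, smul_mul_assoc, add_mul (i₁ * u'), f1, f2, f3]

end Regular

end PairRel

end QInst
end

/-! ### Two poles: the relations needed for the gauge transformation -/

noncomputable section
namespace QInst

section TwoInstanton

variable {q : ℂ} {S : Type*} [Ring S] [Algebra ℂ S]

/-- Two instantons at the poles of `|z|⁻¹` and `|z - y|⁻¹`, of sizes `ρ` and `ρ'`. -/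
structure IsTwoInst (K : Calculus S) (q : ℂ) (z y : Matrix (Fin 2) (Fin 2) S) (s t s' ρ ρ' : S) :
    Prop where
  pole : K.IsPole q z s
  pole' : K.IsPole q (z - y) s'
  size : K.IsSize z s ρ
  size' : K.IsSize (z - y) s' ρ'
  coord : IsCoord q y
  vec : K.IsVec q y
  D_y : ∀ A i j, K.D A (y i j) = 0
  t_diag : K.IsDiag t q⁻¹
  D_t : ∀ A, K.D A t = 0
  t_inv : t ^ 2 * qdet q y = 1
  braided : IsBraided q y z
  t_y : ∀ i j, Commute t (y i j)
  t_z : ∀ i j, QComm q⁻¹ t (z i j)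
  t_s : QComm q t s
  s_y : ∀ i j, QComm q s (y i j)
  root : ∀ a, Commute (qdet q (z - y)) a → Commute s' a
  u_y : ∀ i j, Commute (ρ * s ^ 2) (y i j)
  u_t : Commute (ρ * s ^ 2) t
  u_ρ' : QComm (q ^ 2) (ρ * s ^ 2) ρ'
  ρ'_z : ∀ i j, Commute ρ' (z i j)
  ρ'_y : ∀ i j, Commute ρ' (y i j)
  ρ'_s : Commute ρ' s
  ρ'_t : Commute ρ' t

theorem commute_qbar {f : S} {z : Matrix (Fin 2) (Fin 2) S} (h : ∀ i j, Commute f (z i j))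
    (i j : Fin 2) : Commute f (qbar q z i j) :=
  qComm_one.1 (QComm.qbar (fun i j => (h i j).qComm) i j)

theorem exists_eq_smul_qbar (hq : q ≠ 0) (F : Ix) : ∃ (r : ℂ) (i j : Fin 2),
    ∀ z : Matrix (Fin 2) (Fin 2) S, z F.1 F.2 = r • qbar q z i j := by
  obtain ⟨a, b⟩ := F
  fin_cases a <;> fin_cases b
  · exact ⟨1, 1, 1, fun z => by simp [qbar_apply z hq]⟩
  · exact ⟨-q, 0, 1, fun z => by simp [qbar_apply z hq, smul_smul, hq]⟩
  · exact ⟨-q⁻¹, 1, 0, fun z => by simp [qbar_apply z hq, smul_smul, hq]⟩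
  · exact ⟨1, 0, 0, fun z => by simp [qbar_apply z hq]⟩

theorem IsCoord.gauge_inv (hq : q ≠ 0) (hq2 : q ^ 2 + 1 ≠ 0)
    {z : Matrix (Fin 2) (Fin 2) S} {s : S} (hz : IsCoord q z) (hs : ∀ i j, Commute s (z i j))
    (h1 : s ^ 2 * qdet q z = 1) :
    (Matrix.scalar (Fin 2) s * qbar q z) * (Matrix.scalar (Fin 2) s * z) = 1 ∧
      (Matrix.scalar (Fin 2) s * z) * (Matrix.scalar (Fin 2) s * qbar q z) = 1 := by
  have e1 := commute_scalar_iff.2 hs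
  have e2 : Commute (Matrix.scalar (Fin 2) s) (qbar q z) :=
    commute_scalar_iff.2 fun i j => commute_qbar hs i j
  constructor
  · rw [mul_assoc, ← mul_assoc _ _ z, ← e2.eq, mul_assoc _ _ z, hz.qbar_mul hq hq2, ← map_mul,
      ← map_mul, ← mul_assoc, ← pow_two, h1, map_one]
  · rw [mul_assoc, ← mul_assoc z, ← e1.eq, mul_assoc _ z, hz.mul_qbar hq hq2, ← map_mul,
      ← map_mul, ← mul_assoc, ← pow_two, h1, map_one]

namespace IsTwoInst

variable {K : Calculus S} {z y : Matrix (Fin 2) (Fin 2) S} {s t s' ρ ρ' : S}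
  (hq : q ≠ 0) (hq1 : q + 1 ≠ 0) (hq2 : q ^ 2 + 1 ≠ 0) (h : IsTwoInst K q z y s t s' ρ ρ')
include hq hq2 h

theorem pairRel : PairRel q z (qbar q z) y (qbar q y) (Matrix.scalar (Fin 2) (qdet q z))
    (Matrix.scalar (Fin 2) (qdet q y)) (Matrix.scalar (Fin 2) (qdet q (z - y)))
    (Matrix.scalar (Fin 2) s) (Matrix.scalar (Fin 2) t) (Matrix.scalar (Fin 2) s') := by
  have wy : ∀ i j, QComm (q⁻¹ ^ 2) (qdet q z) (y i j) := fun i j =>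
    inv_sq_smul_eq hq (h.braided.mul_qdet hq hq2 h.pole.coord i j)
  have vz : ∀ i j, QComm (q ^ 2) (qdet q y) (z i j) := h.braided.qdet_mul hq hq2 h.coord
  exact
  { z_mul := h.pole.coord.mul_qbar hq hq2
    mul_z := h.pole.coord.qbar_mul hq hq2
    y_mul := h.coord.mul_qbar hq hq2
    mul_y := h.coord.qbar_mul hq hq2
    sub_mul_sub := by
      rw [← qbar_sub]
      exact h.pole'.coord.mul_qbar hq hq2
    sub_mul_sub' := by
      rw [← qbar_sub]
      exact h.pole'.coord.qbar_mul hq hq2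
    w_y := qComm_scalar_iff.2 wy
    w_y' := qComm_scalar_iff.2 (QComm.qbar wy)
    v_z := qComm_scalar_iff.2 vz
    v_z' := qComm_scalar_iff.2 (QComm.qbar vz)
    s_w := by rw [← map_pow, ← map_mul, h.pole.inv_left, map_one]
    w_s := by rw [← map_pow, ← map_mul, h.pole.inv_right, map_one]
    s_z := commute_scalar_iff.2 h.pole.comm
    s_z' := commute_scalar_iff.2 (commute_qbar h.pole.comm)
    s_y := qComm_scalar_iff.2 h.s_y
    s_y' := qComm_scalar_iff.2 (QComm.qbar h.s_y)
    t_y := commute_scalar_iff.2 h.t_y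
    t_y' := commute_scalar_iff.2 (commute_qbar h.t_y)
    t_z := qComm_scalar_iff.2 h.t_z
    t_z' := qComm_scalar_iff.2 (QComm.qbar h.t_z)
    t_s := h.t_s.scalar
    s'_w' := by rw [← map_pow, ← map_mul, h.pole'.inv_left, map_one]
    w'_s' := by rw [← map_pow, ← map_mul, h.pole'.inv_right, map_one]
    root := fun a ha => commute_scalar_iff.2 fun i j => h.root _ (commute_scalar_iff.1 ha i j) }

omit hq hq2 in
theorem u_z (i j : Fin 2) : Commute (ρ * s ^ 2) (z i j) :=
  (h.size.comm i j).mul_left ((h.pole.comm i j).pow_left 2)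

omit hq hq2 in
theorem u_s' : Commute (ρ * s ^ 2) s' :=
  (h.root _ (commute_qdet_of fun i j => (h.u_z i j).sub_right (h.u_y i j)).symm).symm

omit hq hq2 in
theorem u_s : Commute (ρ * s ^ 2) s :=
  h.size.comm_inv.mul_left ((Commute.refl s).pow_left 2)

/-- `ρ'` commutes with every factor separately; `|z - y|⁻¹` commutes only with the normalised
product, by `w'_conj`. -/
theorem u'_conj : Commute (Matrix.scalar (Fin 2) (ρ' * s' ^ 2))
    ((Matrix.scalar (Fin 2) t * y) * (Matrix.scalar (Fin 2) s * qbar q z)) := by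
  have hP := h.pairRel hq hq2
  have h1 : Commute (Matrix.scalar (Fin 2) ρ')
      ((Matrix.scalar (Fin 2) t * y) * (Matrix.scalar (Fin 2) s * qbar q z)) :=
    ((qComm_one.1 h.ρ'_t.qComm.scalar).mul_right (commute_scalar_iff.2 h.ρ'_y)).mul_right
      ((qComm_one.1 h.ρ'_s.qComm.scalar).mul_right
        (commute_scalar_iff.2 (commute_qbar h.ρ'_z)))
  rw [map_mul, map_pow]
  refine h1.mul_left (Commute.pow_left ?_ 2)
  rw [hP.conj_eq hq]
  exact hP.root _ (hP.w'_conj hq)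

omit hq hq2 in
theorem u_conj : Commute (Matrix.scalar (Fin 2) (ρ * s ^ 2))
    ((Matrix.scalar (Fin 2) t * y) * (Matrix.scalar (Fin 2) s * qbar q z)) :=
  ((qComm_one.1 h.u_t.qComm.scalar).mul_right (commute_scalar_iff.2 h.u_y)).mul_right
    ((qComm_one.1 h.u_s.qComm.scalar).mul_right
      (commute_scalar_iff.2 (commute_qbar h.u_z)))

end IsTwoInst

end TwoInstanton

end QInst
end

/-! ### Regularity of the gauge-transformed potential -/

noncomputable section
namespace QInst

namespace IsTwoInst

variable {q : ℂ} {S : Type*} [Ring S] [Algebra ℂ S]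
variable {K : Calculus S} {z y : Matrix (Fin 2) (Fin 2) S} {s t s' ρ ρ' : S}
  (hq : q ≠ 0) (hq1 : q + 1 ≠ 0) (hq2 : q ^ 2 + 1 ≠ 0) (h : IsTwoInst K q z y s t s' ρ ρ')

local notation "σ" => Matrix.scalar (Fin 2)

theorem scalar_inv {p : S} {u u' : S} {b : ℂ} (hl : p * (1 + b • (u + u')) = 1)
    (hr : (1 + b • (u + u')) * p = 1) : σ p * (1 + b • (σ u + σ u')) = 1 ∧
      (1 + b • (σ u + σ u')) * σ p = 1 := by
  rw [← map_add, ← scalar_smul, ← map_one σ, ← map_add, ← map_mul, ← map_mul, hl, hr]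
  exact ⟨rfl, rfl⟩

include hq hq2 h in
theorem isUnit_gauge :
    (σ s * qbar q z) * (σ t * y) * (σ s' * qbar q (z - y)) *
      ((σ s' * (z - y)) * (σ t * qbar q y) * (σ s * z)) = 1 ∧
    (σ s' * (z - y)) * (σ t * qbar q y) * (σ s * z) *
      ((σ s * qbar q z) * (σ t * y) * (σ s' * qbar q (z - y))) = 1 := by
  obtain ⟨a, a'⟩ := h.pole.coord.gauge_inv hq hq2 h.pole.comm h.pole.inv_left
  obtain ⟨b, b'⟩ := h.pole'.coord.gauge_inv hq hq2 h.pole'.comm h.pole'.inv_left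
  obtain ⟨c, c'⟩ := h.coord.gauge_inv hq hq2 h.t_y h.t_inv
  exact Calculus.inv_triple_eq a a' b b' c' c

include hq hq2 h in
theorem isCov_gauge (i j : Fin 2) :
    K.IsCov q (((σ s * qbar q z) * (σ t * y) * (σ s' * qbar q (z - y))) i j) ∧
    K.IsCov q (((σ s' * (z - y)) * (σ t * qbar q y) * (σ s * z)) i j) := by
  have mul : ∀ {M N : Matrix (Fin 2) (Fin 2) S}, (∀ i j, K.IsCov q (M i j)) →
      (∀ i j, K.IsCov q (N i j)) → ∀ i j, K.IsCov q ((M * N) i j) := fun hM hN i j => by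
    rw [Matrix.mul_apply]
    exact Calculus.IsCov.sum _ fun k _ => (hM i k).mul (hN k j)
  have smul : ∀ {f : S} {M : Matrix (Fin 2) (Fin 2) S}, K.IsCov q f →
      (∀ i j, K.IsCov q (M i j)) → ∀ i j, K.IsCov q ((σ f * M) i j) := fun hf hM i j => by
    rw [scalar_mul_apply]
    exact hf.mul (hM i j)
  have bar : ∀ {M : Matrix (Fin 2) (Fin 2) S}, (∀ i j, K.IsCov q (M i j)) →
      ∀ i j, K.IsCov q (qbar q M i j) := fun hM i j => by
    rw [qbar, Matrix.of_apply]
    exact Calculus.IsCov.sum _ fun k _ => Calculus.IsCov.sum _ fun l _ => (hM l k).smul _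
  have hz := h.pole.vec.isCov_of_dual hq h.pole.dual
  have hz' := h.pole'.vec.isCov_of_dual hq h.pole'.dual
  have hy := h.vec.isCov_of_const hq h.D_y
  have hs := h.pole.isCov hq hq2
  have hs' := h.pole'.isCov hq hq2
  have ht : K.IsCov q t := h.t_diag.isCov_of_const h.D_t
  exact ⟨mul (mul (smul hs (bar hz)) (smul ht hy)) (smul hs' (bar hz')) i j,
    mul (mul (smul hs' hz') (smul ht (bar hy))) (smul hs hz) i j⟩

variable {p : ℂ → S} (hl : ∀ b, p b * (1 + b • (ρ * s ^ 2 + ρ' * s' ^ 2)) = 1)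
  (hr : ∀ b, (1 + b • (ρ * s ^ 2 + ρ' * s' ^ 2)) * p b = 1) {c : ℂ}
  {ω : Ix → Matrix (Fin 2) (Fin 2) S}
  (hω : ∀ A i j, ω A i j =
    c • (p (c * q⁻¹ ^ 2) * K.dhat q (ρ * s ^ 2 + ρ' * s' ^ 2) A i j))

include hq hq1 hq2 h hl hr hω

theorem gauge_eq (A : Ix) :
    K.matrix.gauge ω ((σ s * qbar q z) * (σ t * y) * (σ s' * qbar q (z - y)))
      ((σ s' * (z - y)) * (σ t * qbar q y) * (σ s * z)) A =
    σ (p (c * q⁻¹ ^ 2)) * (K.matrix.pure (σ s * qbar q z) (σ s * z) A +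
      (c * q⁻¹ ^ 2) • (σ (ρ' * s' ^ 2) * K.matrix.pure (σ s * qbar q z) (σ s * z) A +
        σ (ρ * s ^ 2) * K.matrix.pure (σ s' * qbar q (z - y)) (σ s' * (z - y)) A) +
      ∑ B, K.matrix.L A B ((σ s * z) * (σ t * qbar q y)) *
        (K.matrix.pure (σ s' * qbar q (z - y)) (σ s' * (z - y)) B *
          ((σ t * y) * (σ s * qbar q z)))) := by
  obtain ⟨a, a'⟩ := h.pole.coord.gauge_inv hq hq2 h.pole.comm h.pole.inv_left
  obtain ⟨b, b'⟩ := h.pole'.coord.gauge_inv hq hq2 h.pole'.comm h.pole'.inv_left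
  obtain ⟨d, d'⟩ := h.coord.gauge_inv hq hq2 h.t_y h.t_inv
  have hP := h.pairRel hq hq2
  obtain ⟨hl', hr'⟩ := scalar_inv (hl (c * q⁻¹ ^ 2)) (hr (c * q⁻¹ ^ 2))
  have hU : (σ s * qbar q z) * (σ t * y) * (σ s' * qbar q (z - y)) =
      (σ s' * qbar q (z - y)) * (σ t * y) * (σ s * qbar q z) := by
    rw [qbar_sub]
    exact hP.gauge_eq hq
  have u'_U : Commute (σ (ρ' * s' ^ 2)) (σ s' * qbar q (z - y)) :=
    (qComm_one.1 ((h.size'.comm_inv.mul_left ((Commute.refl s').pow_left 2)).qComm.scalar)).mul_right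
      (commute_scalar_iff.2 (commute_qbar fun i j =>
        (h.size'.comm i j).mul_left ((h.pole'.comm i j).pow_left 2)))
  have u_U : Commute (σ (ρ * s ^ 2)) (σ s' * qbar q (z - y)) :=
    (qComm_one.1 h.u_s'.qComm.scalar).mul_right
      (commute_scalar_iff.2 (commute_qbar fun i j => (h.u_z i j).sub_right (h.u_y i j)))
  refine Calculus.gauge_two a a' b b' d' d hU (fun A => ?_) (r := q⁻¹ ^ 2) (by positivity)
    (h.size.isSeed hq hq1 hq2 h.pole).diag.scalar (h.size'.isSeed hq hq1 hq2 h.pole').diag.scalar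
    ?_ ?_ hl' hr' (fun B => ?_) A
  · ext i j
    rw [h.t_diag.scalar.D_mul, Calculus.matrix_D_scalar, h.D_t, map_zero, zero_mul, add_zero,
      Matrix.smul_apply, scalar_mul_apply, Calculus.matrix_D, h.D_y, mul_zero, smul_zero,
      Matrix.zero_apply]
  · rw [hU, mul_assoc]
    exact u_U.mul_right h.u_conj
  · rw [hU, mul_assoc]
    exact u'_U.mul_right (h.u'_conj hq hq2)
  · have e : ω B = c • (σ (p (c * q⁻¹ ^ 2)) * K.dhat q (ρ * s ^ 2 + ρ' * s' ^ 2) B) := by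
      ext i j
      rw [hω, Matrix.smul_apply, scalar_mul_apply]
    rw [e, K.dhat_add, h.size.dhat_pot hq hq1 hq2 h.pole, h.size'.dhat_pot hq hq1 hq2 h.pole']
    simp only [mul_add, mul_neg, mul_smul_comm, smul_add, smul_neg, smul_smul, neg_add]

omit hq hq1 hq2 h hω in
theorem commute_inv_of {b : ℂ} {M : Matrix (Fin 2) (Fin 2) S} (h1 : Commute (σ (ρ * s ^ 2)) M)
    (h2 : Commute (σ (ρ' * s' ^ 2)) M) : Commute (σ (p b)) M := by
  obtain ⟨hl', hr'⟩ := scalar_inv (hl b) (hr b)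
  exact (Calculus.commute_inv hl' hr' ((Commute.one_right M).add_right
    ((h1.symm.add_right h2.symm).smul_right b))).symm

variable {A : Subalgebra ℂ S} (hz : ∀ i j, z i j ∈ A) (hy : ∀ i j, y i j ∈ A) (hρ : ρ ∈ A)
  (hρ' : ρ' ∈ A) (ht : t ∈ A) (hd : s ^ 2 * s' ^ 2 * p (c * q⁻¹ ^ 2) ∈ A)

omit hq hq1 hq2 h hl hr hω in
theorem qbar_mem {M : Matrix (Fin 2) (Fin 2) S} (hM : ∀ i j, M i j ∈ A) (i j : Fin 2) :
    qbar q M i j ∈ A := by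
  rw [qbar, Matrix.of_apply]
  exact A.sum_mem fun _ _ => A.sum_mem fun _ _ => A.smul_mem (hM _ _) _

omit hq hq1 hq2 h hl hr hω in
theorem mul_mem_matrix {M N : Matrix (Fin 2) (Fin 2) S} (hM : ∀ i j, M i j ∈ A)
    (hN : ∀ i j, N i j ∈ A) (i j : Fin 2) : (M * N) i j ∈ A := by
  rw [Matrix.mul_apply]
  exact A.sum_mem fun k _ => A.mul_mem (hM i k) (hN k j)

include hz hy hρ hρ' hd

-- `regular_eq` is an identity for matrices built on `z̄`; the entries of `z̄` are scalar multiples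
-- of those of `z`, which gives the statement for each coordinate.
omit hq1 hω in
theorem rational_mem (F : Ix) :
    p (c * q⁻¹ ^ 2) * (z F.1 F.2 * s ^ 2 + (c * q⁻¹ ^ 2) • (ρ' * s' ^ 2 * (z F.1 F.2 * s ^ 2) +
      ρ * s ^ 2 * ((z - y) F.1 F.2 * s' ^ 2))) ∈ A := by
  have hP := h.pairRel hq hq2
  set b := c * q⁻¹ ^ 2
  obtain ⟨hl', hr'⟩ := scalar_inv (hl b) (hr b)
  have e1 : σ (ρ * s ^ 2) = σ ρ * σ s ^ 2 := by rw [map_mul, map_pow]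
  have e2 : σ (ρ' * s' ^ 2) = σ ρ' * σ s' ^ 2 := by rw [map_mul, map_pow]
  have u_z := commute_scalar_iff.2 h.u_z
  have u_z' := commute_scalar_iff.2 (commute_qbar (q := q) h.u_z)
  have u_y := commute_scalar_iff.2 h.u_y
  have u_y' := commute_scalar_iff.2 (commute_qbar (q := q) h.u_y)
  have u_ρ' := h.u_ρ'.scalar
  rw [e1, e2] at hl' hr'
  rw [e1] at u_z u_z' u_y u_y' u_ρ'
  have key := hP.regular_eq u_z u_z' u_y u_y' u_ρ' (commute_scalar_iff.2 h.ρ'_z)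
    (commute_scalar_iff.2 (commute_qbar h.ρ'_z)) (commute_scalar_iff.2 h.ρ'_y)
    (commute_scalar_iff.2 (commute_qbar h.ρ'_y)) (qComm_one.1 h.ρ'_s.qComm.scalar) hq hl' hr'
  rw [← e1, ← e2, ← map_pow, ← map_pow, ← map_mul, ← map_mul, ← qbar_sub] at key
  obtain ⟨r, i, j, hF⟩ := exists_eq_smul_qbar (S := S) hq F
  have k1 := congrFun (congrFun key i) j
  rw [scalar_mul_apply, mul_scalar_apply, Matrix.add_apply, Matrix.smul_apply, Matrix.add_apply,
    scalar_mul_apply, scalar_mul_apply, mul_scalar_apply, mul_scalar_apply] at k1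
  have k2 : p b * (z F.1 F.2 * s ^ 2 + b • (ρ' * s' ^ 2 * (z F.1 F.2 * s ^ 2) +
      ρ * s ^ 2 * ((z - y) F.1 F.2 * s' ^ 2))) = r • (p b * (qbar q z i j * s ^ 2 +
        b • (ρ' * s' ^ 2 * (qbar q z i j * s ^ 2) +
          ρ * s ^ 2 * (qbar q (z - y) i j * s' ^ 2)))) := by
    rw [hF z, hF (z - y)]
    simp only [smul_mul_assoc, mul_smul_comm, mul_add, smul_add, smul_comm b r]
  rw [k2, k1]
  have hzy : ∀ i j, (z - y) i j ∈ A := fun i j => A.sub_mem (hz i j) (hy i j)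
  refine A.smul_mem (A.mul_mem ?_ hd) _
  rw [Matrix.add_apply, Matrix.smul_apply, Matrix.add_apply, scalar_mul_apply, mul_scalar_apply]
  refine A.add_mem (mul_mem_matrix (mul_mem_matrix (qbar_mem hzy) fun i j => ?_) (qbar_mem hz) i j)
    (A.smul_mem (A.add_mem (A.mul_mem hρ' (qbar_mem hz i j))
      (A.mul_mem (qbar_mem hzy i j) hρ)) _)
  exact A.sub_mem (hz i j) (A.smul_mem (hy i j) _)

include ht

-- The inverse `p` commutes with all three factors. The conjugating matrices each bring
-- `|z|⁻¹|y|⁻¹`, and the middle one brings `|z - y|⁻²`. Together with `p` these combine to the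
-- regular inverse and powers of `|y|⁻¹`.
omit hq1 hω hρ hρ' in
theorem conj_mem (E B : Ix) (i j : Fin 2) :
    (σ (p (c * q⁻¹ ^ 2)) * (K.matrix.L E B ((σ s * z) * (σ t * qbar q y)) *
        (K.matrix.pure (σ s' * qbar q (z - y)) (σ s' * (z - y)) B *
          ((σ t * y) * (σ s * qbar q z))))) i j ∈ A := by
  have hP := h.pairRel hq hq2
  set b := c * q⁻¹ ^ 2
  set W := (σ t * y) * (σ s * qbar q z) with hW
  obtain ⟨a, a'⟩ := h.pole.coord.gauge_inv hq hq2 h.pole.comm h.pole.inv_left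
  obtain ⟨d, d'⟩ := h.coord.gauge_inv hq hq2 h.t_y h.t_inv
  set V := (σ s * z) * (σ t * qbar q y) with hV
  set α := K.matrix.pure (σ s' * qbar q (z - y)) (σ s' * (z - y)) B with hα
  have hWV : W * V = 1 := by
    rw [hW, hV, mul_assoc, ← mul_assoc _ (σ s * z), a, one_mul, d']
  have hVW : V * W = 1 := by
    rw [hW, hV, mul_assoc, ← mul_assoc _ (σ t * y), d, one_mul, a']
  have uW : Commute (σ (ρ * s ^ 2)) W := h.u_conj
  have u'W : Commute (σ (ρ' * s' ^ 2)) W := h.u'_conj hq hq2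
  have hα' : α = Matrix.of (fun i j => ∑ F : Ix, Calculus.poleCoef q B i j F • (z - y) F.1 F.2) *
      σ (s' ^ 2) := by
    ext i j
    rw [mul_scalar_apply, hα, h.pole'.pure_apply hq hq2, Matrix.of_apply, Finset.sum_mul]
    simp only [smul_mul_assoc]
  set M : Matrix (Fin 2) (Fin 2) S :=
    Matrix.of (fun i j => ∑ F : Ix, Calculus.poleCoef q B i j F • (z - y) F.1 F.2) with hM
  have cL : Commute (σ (p b)) (K.matrix.L E B V) := by
    have hi : q⁻¹ ^ 2 ≠ 0 := by positivity
    refine commute_inv_of hl hr ?_ ?_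
    · have hdiag : K.IsDiag (ρ * s ^ 2) (q⁻¹ ^ 2) := by
        simpa using h.size.diag.mul (h.pole.diag.pow 2)
      exact hdiag.scalar.commute_L hi (Calculus.commute_inv hVW hWV uW) E B
    · have hdiag : K.IsDiag (ρ' * s' ^ 2) (q⁻¹ ^ 2) := by
        simpa using h.size'.diag.mul (h.pole'.diag.pow 2)
      exact hdiag.scalar.commute_L hi (Calculus.commute_inv hVW hWV u'W) E B
  have cα : Commute (σ (p b)) α := by
    rw [hα']
    have hs : ∀ {f : S}, (∀ i j, Commute f ((z - y) i j)) → Commute f s' →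
        Commute (σ f) (M * σ (s' ^ 2)) := fun hf hfs =>
      (commute_scalar_iff.2 fun i j => by
        rw [hM, Matrix.of_apply]
        exact Commute.sum_right _ _ _ fun F _ => (hf F.1 F.2).smul_right _).mul_right (qComm_one.1 (hfs.pow_right 2).qComm.scalar)
    refine commute_inv_of hl hr (hs (fun i j => (h.u_z i j).sub_right (h.u_y i j)) h.u_s') (hs ?_ ?_)
    · exact fun i j => (h.size'.comm i j).mul_left ((h.pole'.comm i j).pow_left 2)
    · exact h.size'.comm_inv.mul_left ((Commute.refl s').pow_left 2)
  have cW : Commute (σ (p b)) W := commute_inv_of hl hr uW u'W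
  have hW' : W = y * qbar q z * (σ s * σ t) := hP.conj_eq hq
  have hV' : V = q • (z * qbar q y * σ (s * t)) := by
    rw [hV, hP.s_z.eq, hP.t_y'.eq, mul_assoc, ← mul_assoc (σ s), hP.s_y', smul_mul_assoc,
      mul_smul_comm, map_mul]
    simp only [mul_assoc]
  have hLV : K.matrix.L E B V = q⁻¹ • (K.matrix.L E B (z * qbar q y) * σ (s * t)) := by
    rw [hV', map_smul, (h.pole.diag.mul h.t_diag).scalar.L_mul_right, smul_smul]
    congr 1
    field_simp
  -- `M'` is `M` after `|z|⁻¹|y|⁻¹` has passed through `z - y`, which it rescales to `q⁻¹ z - q y`.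
  set M' : Matrix (Fin 2) (Fin 2) S := Matrix.of fun i j =>
    ∑ F : Ix, Calculus.poleCoef q B i j F • (q⁻¹ • z F.1 F.2 - q • y F.1 F.2) with hM'
  have hr' : σ (s * t) * M = M' * σ (s * t) := by
    have hz1 := qComm_scalar_iff.1 (show QComm q⁻¹ (σ (s * t)) z by rw [map_mul]; exact hP.r_z)
    have hy1 := qComm_scalar_iff.1 (show QComm q (σ (s * t)) y by rw [map_mul]; exact hP.r_y)
    ext i j
    rw [scalar_mul_apply, mul_scalar_apply, hM, hM', Matrix.of_apply, Matrix.of_apply,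
      Finset.mul_sum, Finset.sum_mul]
    refine Finset.sum_congr rfl fun F _ => ?_
    rw [mul_smul_comm, smul_mul_assoc, Matrix.sub_apply, mul_sub, hz1, hy1, sub_mul,
      smul_mul_assoc, smul_mul_assoc]
  have cs : σ (s' ^ 2) * W = W * σ (s' ^ 2) := by
    rw [map_pow, hW']
    exact ((hP.root _ (hP.w'_conj hq)).pow_left 2).eq
  -- The `|z|²` produced here absorbs the two factors `|z|⁻¹` of the conjugating matrices.
  have hw : σ (s' ^ 2) * σ (p b) = σ (qdet q z) * σ (s ^ 2 * s' ^ 2 * p b) := by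
    rw [← map_mul, ← map_mul, ← mul_assoc, ← mul_assoc, h.pole.inv_right, one_mul]
  have hrw : σ (s * t) * W * σ (qdet q z) = q⁻¹ ^ 3 • (y * qbar q z * σ t ^ 2) := by
    rw [hW', map_mul]
    exact hP.r_conj_w hq
  have key : σ (p b) * (K.matrix.L E B V * (α * W)) =
      (q⁻¹ * q⁻¹ ^ 3) • (K.matrix.L E B (z * qbar q y) * M' * (y * qbar q z * σ t ^ 2) *
        σ (s ^ 2 * s' ^ 2 * p b)) :=
    calc σ (p b) * (K.matrix.L E B V * (α * W)) = K.matrix.L E B V * (α * W) * σ (p b) :=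
          (cL.mul_right (cα.mul_right cW)).eq
      _ = q⁻¹ • (K.matrix.L E B (z * qbar q y) * (σ (s * t) * M) * (σ (s' ^ 2) * W) * σ (p b)) := by
          rw [hLV, hα']
          simp only [smul_mul_assoc, mul_assoc]
      _ = q⁻¹ • (K.matrix.L E B (z * qbar q y) * M' * (σ (s * t) * W * σ (qdet q z)) *
            σ (s ^ 2 * s' ^ 2 * p b)) := by
          rw [hr', cs]
          simp only [mul_assoc, hw]
      _ = _ := by
          rw [hrw, mul_smul_comm, smul_mul_assoc, smul_smul]
  rw [key, Matrix.smul_apply, mul_scalar_apply, ← map_pow]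
  have hzA : ∀ B E i j, K.L B E (z i j) ∈ A := fun B E i j => by
    rw [h.pole.vec B E (i, j)]
    exact A.sum_mem fun F _ => A.smul_mem (hz _ _) _
  have hyA : ∀ B E i j, K.L B E (qbar q y i j) ∈ A := fun B E i j => by
    rw [qbar, Matrix.of_apply]
    simp only [map_sum, map_smul]
    refine A.sum_mem fun k _ => A.sum_mem fun l _ => A.smul_mem ?_ _
    rw [h.vec B E (l, k)]
    exact A.sum_mem fun F _ => A.smul_mem (hy _ _) _
  have hLA : ∀ i j, K.matrix.L E B (z * qbar q y) i j ∈ A := fun i j => by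
    rw [Calculus.matrix_L, Matrix.mul_apply, map_sum]
    refine A.sum_mem fun k _ => ?_
    rw [K.L_mul]
    exact A.sum_mem fun F _ => A.mul_mem (hzA _ _ _ _) (hyA _ _ _ _)
  have hMA : ∀ i j, M' i j ∈ A := fun i j => by
    rw [hM', Matrix.of_apply]
    exact A.sum_mem fun F _ => A.smul_mem (A.sub_mem (A.smul_mem (hz _ _) _) (A.smul_mem (hy _ _) _)) _
  refine A.smul_mem (A.mul_mem (mul_mem_matrix (mul_mem_matrix hLA hMA) (fun i j => ?_) i j) hd) _
  rw [mul_scalar_apply]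
  exact A.mul_mem (mul_mem_matrix hy (qbar_mem hz) i j) (A.pow_mem ht 2)

theorem gauge_mem (E : Ix) (i j : Fin 2) :
    K.matrix.gauge ω ((σ s * qbar q z) * (σ t * y) * (σ s' * qbar q (z - y)))
      ((σ s' * (z - y)) * (σ t * qbar q y) * (σ s * z)) E i j ∈ A := by
  rw [h.gauge_eq hq hq1 hq2 hl hr hω, mul_add, Matrix.add_apply, Finset.mul_sum, Matrix.sum_apply]
  refine A.add_mem ?_ (A.sum_mem fun B _ => h.conj_mem hq hq2 hl hr hz hy ht hd E B i j)
  rw [scalar_mul_apply, Matrix.add_apply, Matrix.smul_apply, Matrix.add_apply, scalar_mul_apply,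
    scalar_mul_apply, h.pole.pure_apply hq hq2, h.pole'.pure_apply hq hq2]
  have e : p (c * q⁻¹ ^ 2) * (∑ F : Ix, Calculus.poleCoef q E i j F • (z F.1 F.2 * s ^ 2) +
      (c * q⁻¹ ^ 2) • (ρ' * s' ^ 2 * ∑ F : Ix, Calculus.poleCoef q E i j F • (z F.1 F.2 * s ^ 2) +
        ρ * s ^ 2 * ∑ F : Ix, Calculus.poleCoef q E i j F • ((z - y) F.1 F.2 * s' ^ 2))) =
      ∑ F : Ix, Calculus.poleCoef q E i j F • (p (c * q⁻¹ ^ 2) * (z F.1 F.2 * s ^ 2 + (c * q⁻¹ ^ 2) •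
        (ρ' * s' ^ 2 * (z F.1 F.2 * s ^ 2) + ρ * s ^ 2 * ((z - y) F.1 F.2 * s' ^ 2)))) := by
    simp only [mul_add, smul_add, Finset.sum_add_distrib, Finset.mul_sum, Finset.smul_sum,
      mul_smul_comm, smul_comm (c * q⁻¹ ^ 2)]
  rw [e]
  exact A.sum_mem fun F _ => A.smul_mem (h.rational_mem hq hq2 hl hr hz hy hρ hρ' hd F) _

end IsTwoInst

end QInst
end

noncomputable section
namespace QInst

/-! ### Two instantons -/

section Two

variable {q : ℂ} (hq : q ≠ 0) (hq1 : q + 1 ≠ 0) (hq2 : q ^ 2 + 1 ≠ 0)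

theorem zMat_one : (zMat q 1 : Matrix _ _ (Fn q 2)) = zMat q 0 - yMat q 2 := by
  have h0 : Finset.univ.filter (fun ν : Fin 2 => ν ≤ 0) = {0} := by decide
  have h1 : Finset.univ.filter (fun ν : Fin 2 => ν ≤ 1) = {0, 1} := by decide
  rw [zMat_eq, zMat_eq, h0, h1, Finset.sum_singleton, Finset.sum_pair (by decide), sub_sub]
  rfl

theorem isDiag_yNormInv {n : ℕ} (μ : Fin n) : (fnCalc q n).IsDiag (yNormInv q μ) q⁻¹ := fun A B => by
  change lam A B (cls q (gen (Gen.yinv μ))) = _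
  rw [lam_cls, jet_gen]
  simp only [jetGen, jetGen1, block, Matrix.of_apply, diagBlock]
  split_ifs <;> rfl

theorem del_yNormInv {n : ℕ} (μ : Fin n) (A : Ix) : (fnCalc q n).D A (yNormInv q μ) = 0 := by
  change del A (cls q (gen (Gen.yinv μ))) = _
  rw [del_cls, jet_gen]
  rfl

theorem yNormInv_sq_mul {n : ℕ} (μ : Fin n) :
    yNormInv q μ ^ 2 * qdet q (yMat q μ.succ) = 1 := by
  rw [qdet_yMat]
  exact cls_eq.2 (Rel.yinv_left μ)

include hq hq2 in
theorem isTwoInst : IsTwoInst (fnCalc q 2) q (zMat q 0) (yMat q 2) (zNormInv q 0) (yNormInv q 1)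
    (zNormInv q 1) (rhoSq q 0) (rhoSq q 1) := by
  have hbr : IsBraided q (yMat q 2 : Matrix _ _ (Fn q 2)) (zMat q 0) :=
    isBraided_yMat_zMat (q := q) (n := 2) (μ := 0) (κ := 1) (by decide)
  have t_y : ∀ i j, Commute (yNormInv q 1) ((yMat q 2 : Matrix _ _ (Fn q 2)) i j) := fun i j =>
    commute_yNormInv (n := 2) 1 ((isCoord_yMat 2).commute_qdet hq hq2 i j)
  have t_z : ∀ i j, QComm q⁻¹ (yNormInv q 1) ((zMat q 0 : Matrix _ _ (Fn q 2)) i j) := fun i j => by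
    have h1 := yNormInv_root (n := 2) 1 (a := zMat q 0 i j) 1
      (by rw [mul_one, zpow_ofNat]; exact hbr.qdet_mul hq hq2 (isCoord_yMat 2) i j)
    rwa [zpow_neg_one] at h1
  have t_w : QComm (q⁻¹ ^ 2) (yNormInv q 1) (qdet q (zMat q 0 : Matrix _ _ (Fn q 2))) := by
    refine QComm.sub_right (((t_z 0 0).mul_right (t_z 1 1)).congr (pow_two _).symm) ?_
    rw [QComm, mul_smul_comm, ((t_z 0 1).mul_right (t_z 1 0)), smul_mul_assoc, smul_comm q, pow_two]
  have hz1 : (zMat q 0 - yMat q 2 : Matrix _ _ (Fn q 2)) = zMat q 1 := zMat_one.symm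
  exact
  { pole := isPole_zMat hq hq2 0
    pole' := by
      rw [hz1]
      exact isPole_zMat hq hq2 1
    size := isSize_rhoSq 0
    size' := by
      rw [hz1]
      exact isSize_rhoSq 1
    coord := isCoord_yMat 2
    vec := isVec_yMat 2
    D_y := fun A i j => del_yMat_succ (n := 2) 1 A i j
    t_diag := isDiag_yNormInv 1
    D_t := del_yNormInv 1
    t_inv := yNormInv_sq_mul 1
    braided := hbr
    t_y := t_y
    t_z := t_z
    t_s := by
      -- The square-root rule for `|y_2|` has fixed how `|y_2|⁻¹` commutes with `|z_1|²`; the rule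
      -- for `|z_1|` now halves that exponent.
      have h1 := zNormInv_root (n := 2) 0 (a := yNormInv q 1) 1 (by
        rw [mul_one, zpow_ofNat]
        exact (t_w.symm (by positivity)).congr (by rw [inv_pow, inv_inv]))
      rw [zpow_neg_one] at h1
      exact (QComm.symm h1 (inv_ne_zero hq)).congr (inv_inv q)
    s_y := fun i j => zNormInv_mul_yMat hq hq2 (n := 2) (μ := 0) (κ := 1) (by decide) i j
    root := fun a ha => commute_zNormInv 1 (by rwa [hz1] at ha)
    u_y := fun i j => commute_pot_yMat hq hq2 (n := 2) (μ := 0) (κ := 1) (by decide) i j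
    u_t := (commute_yNormInv (n := 2) 1 (commute_qdet_of fun i j =>
      commute_pot_yMat hq hq2 (n := 2) (μ := 0) (κ := 1) (by decide) i j).symm).symm
    u_ρ' := pot_mul_rhoSq (n := 2) (μ := 0) (κ := 1) (by decide)
    ρ'_z := fun i j => commute_rhoSq_zMat (n := 2) (by decide) i j
    ρ'_y := fun i j => commute_rhoSq_yMat (n := 2) (by decide) i j
    ρ'_s := commute_rhoSq_zNormInv (n := 2) (by decide)
    ρ'_t := (commute_yNormInv (n := 2) 1 (commute_qdet_of fun i j =>
      commute_rhoSq_yMat (n := 2) (by decide) i j).symm).symm }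

theorem U2_eq : U2 q = (Matrix.scalar (Fin 2) (zNormInv q 0) * qbar q (zMat q 0)) *
    (Matrix.scalar (Fin 2) (yNormInv q 1) * yMat q 2) *
    (Matrix.scalar (Fin 2) (zNormInv q 1) * qbar q (zMat q 0 - yMat q 2)) := by
  rw [U2, smul_eq_scalar_mul, smul_eq_scalar_mul, smul_eq_scalar_mul, zMat_one]

theorem sum_pot_two : ∑ μ : Fin 2, pot q μ =
    rhoSq q 0 * zNormInv q 0 ^ 2 + rhoSq q 1 * zNormInv q 1 ^ 2 := Fin.sum_univ_two _

/-- The inverse of the denominator. -/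
theorem regDenom_inv {S : Type*} [Ring S] [Algebra ℂ S] {w w' s s' ρ ρ' p : S} {b : ℂ}
    (hs : s ^ 2 * w = 1) (hs₂ : w * s ^ 2 = 1) (hs' : s' ^ 2 * w' = 1) (hs'₂ : w' * s' ^ 2 = 1)
    (hu : Commute (ρ * s ^ 2) w') (hl : p * (1 + b • (ρ * s ^ 2 + ρ' * s' ^ 2)) = 1)
    (hr : (1 + b • (ρ * s ^ 2 + ρ' * s' ^ 2)) * p = 1) :
    s ^ 2 * s' ^ 2 * p * (w' * w + b • (w' * ρ + ρ' * w)) = 1 ∧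
      (w' * w + b • (w' * ρ + ρ' * w)) * (s ^ 2 * s' ^ 2 * p) = 1 := by
  have h1 : w' * w + b • (w' * ρ + ρ' * w) =
      (1 + b • (ρ * s ^ 2 + ρ' * s' ^ 2)) * (w' * w) := by
    have e1 : ρ * s ^ 2 * (w' * w) = w' * ρ := by
      rw [← mul_assoc, hu.eq, mul_assoc, mul_assoc, hs, mul_one]
    have e2 : ρ' * s' ^ 2 * (w' * w) = ρ' * w := by
      rw [mul_assoc, ← mul_assoc (s' ^ 2), hs', one_mul]
    rw [add_mul, one_mul, smul_mul_assoc, add_mul, e1, e2]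
  have h2 : w' * w * (s ^ 2 * s' ^ 2) = 1 := by
    rw [mul_assoc, ← mul_assoc w, hs₂, one_mul, hs'₂]
  have h3 : s ^ 2 * s' ^ 2 * (w' * w) = 1 := by
    rw [mul_assoc, ← mul_assoc (s' ^ 2), hs', one_mul, hs]
  rw [h1]
  constructor
  · rw [mul_assoc, ← mul_assoc p, hl, one_mul, h3]
  · rw [mul_assoc, ← mul_assoc (w' * w), h2, one_mul, hr]

include hq hq2

theorem inv_mem_regularFn (c : ℂ) :
    zNormInv q 0 ^ 2 * zNormInv q 1 ^ 2 * phiInv q 2 (c * q⁻¹ ^ 2) ∈ regularFn q c := by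
  have h := isTwoInst hq hq2
  have hl := phiInv_mul_phi (q := q) (n := 2) (c * q⁻¹ ^ 2)
  have hr := phi_mul_phiInv (q := q) (n := 2) (c * q⁻¹ ^ 2)
  rw [phi_eq, sum_pot_two] at hl hr
  -- The shift `k = -1` arises because `φ⁻¹` has been moved once past `ξ`.
  have hw : c * q ^ (2 * (-1 : ℤ)) = c * q⁻¹ ^ 2 := by norm_num [zpow_neg]
  refine Algebra.subset_adjoin (Or.inr ⟨-1, ?_⟩)
  rw [hw, regDenom, zMat_one]
  exact regDenom_inv h.pole.inv_left h.pole.inv_right h.pole'.inv_left h.pole'.inv_right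
    (commute_qdet_of fun i j => (h.u_z i j).sub_right (h.u_y i j)) hl hr

include hq1

/-- The witness is the reversed product of the inverses `z_2/|z_2|`, `ȳ_2/|y_2|`, `z_1/|z_1|`. -/
theorem exists_gauge (c : ℂ) : ∃ V : Matrix (Fin 2) (Fin 2) (Fn q 2),
    U2 q * V = 1 ∧ V * U2 q = 1 ∧
    (∀ i j A, gauge (Ahat q 2 c) (U2 q) V i j A ∈ regularFn q c) ∧
    IsSelfDual (gauge (Ahat q 2 c) (U2 q) V) := by
  have h := isTwoInst hq hq2
  obtain ⟨hUV, hVU⟩ := h.isUnit_gauge hq hq2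
  have hcov := h.isCov_gauge hq hq2
  rw [← U2_eq] at hUV hVU hcov
  refine ⟨_, hUV, hVU, fun i j A => ?_, isSelfDual_of_isSD hq hq2 ?_⟩
  · have hl := phiInv_mul_phi (q := q) (n := 2)
    have hr := phi_mul_phiInv (q := q) (n := 2)
    have hω := coef_Ahat (n := 2) hq hq1 hq2 c
    simp only [phi_eq, sum_pot_two] at hl hr hω
    have key := h.gauge_mem hq hq1 hq2 hl hr hω (A := regularFn q c)
      (fun i j => ?_) (fun i j => ?_) ?_ ?_ ?_ (inv_mem_regularFn hq hq2 c) A i j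
    · rw [← U2_eq, ← coef_gauge] at key
      exact key
    · rw [zMat_eq, Matrix.sub_apply, Matrix.sum_apply]
      exact sub_mem (Algebra.subset_adjoin (Or.inl (Or.inl (Or.inl ⟨_, i, j, rfl⟩))))
        (sum_mem fun ν _ => Algebra.subset_adjoin (Or.inl (Or.inl (Or.inl ⟨_, i, j, rfl⟩))))
    · exact Algebra.subset_adjoin (Or.inl (Or.inl (Or.inl ⟨2, i, j, rfl⟩)))
    · exact Algebra.subset_adjoin (Or.inl (Or.inl (Or.inr ⟨0, rfl⟩)))
    · exact Algebra.subset_adjoin (Or.inl (Or.inl (Or.inr ⟨1, rfl⟩)))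
    · exact Algebra.subset_adjoin (Or.inl (Or.inr rfl))
  · rw [coef_gauge]
    exact (fnCalc q 2).matrix.isSD_curv_gauge hUV hVU
      (Calculus.IsCov.matrix fun i j => (hcov i j).1) (Calculus.IsCov.matrix fun i j => (hcov i j).2)
      (isSD_curv_Ahat hq hq1 hq2 c)

end Two

end QInst
end


theorem mainTheorem3 (q : ℝ) (hq : q ≠ 0) (hq' : q ≠ -1) (c : ℂ) (hc : c ≠ 0) :
    (∀ n : ℕ,
      QInst.phi (q : ℂ) n c * QInst.phiInv (q : ℂ) n c = 1 ∧
      QInst.phiInv (q : ℂ) n c * QInst.phi (q : ℂ) n c = 1 ∧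
      QInst.box (QInst.phi (q : ℂ) n c) = 0 ∧
      QInst.IsSelfDual (QInst.Ahat (q : ℂ) n c)) ∧
    (∃ V : Matrix (Fin 2) (Fin 2) (QInst.Fn (q : ℂ) 2),
      QInst.U2 (q : ℂ) * V = 1 ∧ V * QInst.U2 (q : ℂ) = 1 ∧
      (∀ i j A, QInst.gauge (QInst.Ahat (q : ℂ) 2 c) (QInst.U2 (q : ℂ)) V i j A ∈
        QInst.regularFn (q : ℂ) c) ∧
      QInst.IsSelfDual (QInst.gauge (QInst.Ahat (q : ℂ) 2 c) (QInst.U2 (q : ℂ)) V)) := by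
  have h0 : (q : ℂ) ≠ 0 := Complex.ofReal_ne_zero.2 hq
  have h1 : (q : ℂ) + 1 ≠ 0 := by
    rw [← Complex.ofReal_one, ← Complex.ofReal_add, Complex.ofReal_ne_zero]
    exact fun h => hq' (eq_neg_of_add_eq_zero_left h)
  -- Reality of `q` excludes `q = ±i`.
  have h2 : (q : ℂ) ^ 2 + 1 ≠ 0 := by
    rw [← Complex.ofReal_one, ← Complex.ofReal_pow, ← Complex.ofReal_add, Complex.ofReal_ne_zero]
    positivity
  exact ⟨fun n => ⟨QInst.phi_mul_phiInv c, QInst.phiInv_mul_phi c, QInst.box_phi h0 h1 h2 c,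
    QInst.isSelfDual_Ahat h0 h1 h2 c⟩, QInst.exists_gauge h0 h1 h2 c⟩
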